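/- **Setting.** Use coordinates $(x_1,x_2,z)$ on $\mathbb{R}^3$. A generalized link (all of whose components are arcs) is a finite family $L$ of disjoint arcs, each endpoint $x$ being constrained to an affine subspace $M_x$, which avoids obstacles $\{g_j<0\}$, where finitely many $C^1$ functions $g_j$ with regular value $0$ are given. Its Gehring thickness $\mathrm{Thi}(L)$ is the minimal distance between points on different components; a strut is a pair of points on different components at distance $\mathrm{Thi}(L)$; $O(L)=\min_j\min_{L}g_j$. A continuous vector field $\xi$ along $L$ is compatible if $\xi_x$ is tangent to $M_x$ at each endpoint $x$. If $L$ has finite total curvature, $\delta_\xi\mathrm{Len}(L)$ denotes the first variation of length, extended as a Radon measure to all continuous $\xi$. $L$ is (strongly) critical for Gehring ropelength if it has finite total curvature and there is $\varepsilon>0$ with $\min(\delta^+_\xi\mathrm{Thi}(L),\delta^+_\xi O(L))\le-\varepsilon$ for all compatible $\xi$ with $\delta_\xi\mathrm{Len}(L)=-1$, where $\delta^+_\xi$ is the one-sided derivative at $h=0^+$ along $L+h\xi$. **Clasp curves.** For $\sigma,\rho\in[0,1]$ let $K(\sigma,\rho)$ be the planar convex curve, symmetric in a vertical axis, with tip at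 the origin and opening upwards, whose curved arc is parametrized by the vertical component $u\in[-\sigma,\sigma]$ of its unit tangent: its horizontal coordinate is the odd function of $u$ with $$x(u)=\sqrt{\frac{u^2(1-w^2)}{1-u^2w^2}},\qquad w=\rho\,(1-u/\sigma),\qquad 0\le u\le\sigma,$$ its height is determined by $dz/dx=u/\sqrt{1-u^2}$, and it is prolonged at both ends by tangent straight segments. (If $\sigma=0$ the curved arc is a point.) By $K(\sigma,\rho)$ split at the tip we mean that the two halves are translated horizontally apart and a horizontal unit segment is inserted between them. **Configurations.** Let $m\in\{1,2\}$, $0\le\tau\le m$, $\tau_1=\tau/2$, $\tau_2=\tau/m$, and let $a,b>0$. $L^m(\tau)$ consists of two $\beta$ curves in the planes $x_2=\pm\frac12$, translates of each other, and $m$ translates of one $\gamma$ curve, in the plane $x_1=0$ if $m=1$ and in the planes $x_1=\pm\frac12$ if $m=2$. The $\beta$ curves are congruent to $K(\tau_1,\tau_2)$ turned upside down, with straight ends of length $a$, split at the tip if $m=2$ but not if $m=1$. The $\gamma$ curves are congruent to $K(\tau_2,\tau_1)$ with straight ends of length $b$, split at the tip. All are symmetric about the $z$-axis (the $\beta$ curves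 in the $x_1$-direction, the $\gamma$ curves in the $x_2$-direction), and the tips of the $\beta$ curves lie above those of the $\gamma$ curves by $\sqrt{1-\tau_2^2}$ plus the height of the curved arc of $\gamma$, so that an end of the curved arc of a $\gamma$ has distance $1$ from the tip (or the corresponding point beside the inserted segment) of the nearest $\beta$. Thus for $m=2$ all four curves are congruent to split ordinary $\tau/2$-clasp curves. For the generalized link problem $C^m_{0,2}(\tau)$, the four bounding planes are perpendicular to the ends of the curves, at angle $\arcsin\tau_1$ from the vertical for the left and right ends of the $\beta$ curves and $\arcsin\tau_2$ for those of the $\gamma$ curves; the ends are constrained to these planes, and the complement of the tetrahedral region they bound is an obstacle. **Theorem 5.1.** For $m=1$, $0\le\tau\le1$ and for $m=2$, $0\le\tau\le2$, the configuration $L^m(\tau)$ is a generalized link satisfying these constraints, has Gehring thickness $1$, and is critical for Gehring ropelength. Moreover, if $\tau>0$, its curvature force is balanced, as a functional on compatible fields, by positive strut forces which close into hexagons if $m=1$ and octagons if $m=2$: there are a continuous family, indexed by $r\in(0,1)$, of closed $N$-gons ($N=6$ for $m=1$, $N=8$ for $m=2$) with vertices on $L^m(\tau)$, no two of the vertices coinciding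 (whether of the same or of different polygons), all of whose edges are struts, and positive integrable force densities in $r$ on the $N$ edges, such that for every compatible $\xi$, $\delta_\xi\mathrm{Len}$ is the integral over $r$ of the sum over the edges $\{x,y\}$ of the force density times $\langle\xi_x-\xi_y,\,x-y\rangle$. -/

import Mathlib

open scoped RealInnerProductSpace

noncomputable section

namespace Gehring

/-! ### Generalized links made of arcs -/

/-- Euclidean three-space with coordinates `(x₁, x₂, z)`. -/
abbrev E3 : Type := EuclideanSpace ℝ (Fin 3)

/-- The data of a generalized link problem, all of whose components are arcs: parameter intervals
of the components (indexed by `ι`), the affine subspaces on which the two endpoints of each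
component are constrained to stay, and the functions whose negativity sets are the obstacles. -/
structure LinkProblem (ι κ : Type) where
  lo : ι → ℝ
  hi : ι → ℝ
  startSpace : ι → AffineSubspace ℝ E3
  endSpace : ι → AffineSubspace ℝ E3
  obstacle : κ → E3 → ℝ

variable {ι κ : Type}

/-- The parameter interval of the component `i`. -/
abbrev LinkProblem.Dom (P : LinkProblem ι κ) (i : ι) : Type := Set.Icc (P.lo i) (P.hi i)

/-- Points of the abstract curve: a component together with a parameter on it. -/
abbrev LinkProblem.Point (P : LinkProblem ι κ) : Type := Σ i, P.Dom i

/-- A family of parametrized arcs in space. -/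
abbrev LinkProblem.Arcs (P : LinkProblem ι κ) : Type := ∀ i, P.Dom i → E3

/-- Continuous vector fields along the arcs. -/
abbrev LinkProblem.Field (P : LinkProblem ι κ) : Type := ∀ i, C(P.Dom i, E3)

/-- `L` is a generalized link for the problem `P`: the components are disjoint continuous arcs,
the endpoints lie on their constraint spaces, the obstacle functions are `C¹` with regular
value `0`, and `L` stays where all of them are nonnegative. -/
structure IsGeneralizedLink (P : LinkProblem ι κ) (L : P.Arcs) : Prop where
  lo_lt_hi : ∀ i, P.lo i < P.hi i
  continuous : ∀ i, Continuous (L i)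
  disjoint : ∀ x y : P.Point, x.1 ≠ y.1 → L x.1 x.2 ≠ L y.1 y.2
  start_mem : ∀ i (t : P.Dom i), (t : ℝ) = P.lo i → L i t ∈ P.startSpace i
  end_mem : ∀ i (t : P.Dom i), (t : ℝ) = P.hi i → L i t ∈ P.endSpace i
  obstacle_contDiff : ∀ j, ContDiff ℝ 1 (P.obstacle j)
  obstacle_regular : ∀ j p, P.obstacle j p = 0 → fderiv ℝ (P.obstacle j) p ≠ 0
  avoids : ∀ j (x : P.Point), 0 ≤ P.obstacle j (L x.1 x.2)

/-- The Gehring thickness: the minimal distance between points on different components. -/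
def gThi (P : LinkProblem ι κ) (L : P.Arcs) : ℝ :=
  ⨅ q : {q : P.Point × P.Point // q.1.1 ≠ q.2.1},
    dist (L q.1.1.1 q.1.1.2) (L q.1.2.1 q.1.2.2)

/-- The minimal value `O(L)` of the obstacle functions on the link. -/
def obstacleMin (P : LinkProblem ι κ) (L : P.Arcs) : ℝ :=
  ⨅ q : κ × P.Point, P.obstacle q.1 (L q.2.1 q.2.2)

/-- The points `x` and `y` form a Gehring strut. -/
def IsGStrut (P : LinkProblem ι κ) (L : P.Arcs) (x y : P.Point) : Prop :=
  x.1 ≠ y.1 ∧ dist (L x.1 x.2) (L y.1 y.2) = gThi P L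

/-- The total length. -/
def len [Fintype ι] (P : LinkProblem ι κ) (L : P.Arcs) : ℝ :=
  ∑ i, (eVariationOn (L i) Set.univ).toReal

/-- The arcs `L + h ξ`. -/
def move (P : LinkProblem ι κ) (L : P.Arcs) (ξ : P.Field) (h : ℝ) : P.Arcs :=
  fun i t => L i t + h • ξ i t

/-- The field `ξ` is continuously differentiable on each (closed) parameter interval. -/
def IsC1Field (P : LinkProblem ι κ) (ξ : P.Field) : Prop :=
  ∀ i, ∃ η : ℝ → E3, ContDiff ℝ 1 η ∧ ∀ t : P.Dom i, ξ i t = η t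

/-- `L` has finite total curvature, and `D` is the first variation of its length, as a continuous
linear functional on all continuous vector fields along `L` (that is, by the Riesz representation
theorem, a vector-valued Radon measure along `L`, namely minus the curvature force, with its atoms
at the endpoints). Since `C¹` fields are dense, `D` is unique. -/
def IsLengthVariation [Fintype ι] (P : LinkProblem ι κ) (L : P.Arcs) (D : P.Field →L[ℝ] ℝ) :
    Prop :=
  ∀ ξ : P.Field, IsC1Field P ξ → HasDerivAt (fun h => len P (move P L ξ h)) (D ξ) 0

/-- The continuous field `ξ` is compatible with the endpoint constraints: it is tangent to the
constraint space at each endpoint. -/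
def IsCompatible (P : LinkProblem ι κ) (ξ : P.Field) : Prop :=
  ∀ i (t : P.Dom i),
    ((t : ℝ) = P.lo i → ξ i t ∈ (P.startSpace i).direction) ∧
    ((t : ℝ) = P.hi i → ξ i t ∈ (P.endSpace i).direction)

/-- `L` is strongly critical for minimizing length when constrained by Gehring thickness (and by
the obstacles and endpoint constraints): there is `ε > 0` such that every compatible `ξ` with
`δ_ξ Len = -1` has `min (δ⁺_ξ gThi) (δ⁺_ξ O) ≤ -ε`, with one-sided first variations. -/
def StronglyCritical [Fintype ι] (P : LinkProblem ι κ) (L : P.Arcs) : Prop :=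
  ∃ D : P.Field →L[ℝ] ℝ, IsLengthVariation P L D ∧
    ∃ ε : ℝ, 0 < ε ∧ ∀ ξ : P.Field, IsCompatible P ξ → D ξ = -1 →
      ∃ dThi dO : ℝ,
        HasDerivWithinAt (fun h => gThi P (move P L ξ h)) dThi (Set.Ici 0) 0 ∧
        HasDerivWithinAt (fun h => obstacleMin P (move P L ξ h)) dO (Set.Ici 0) 0 ∧
        min dThi dO ≤ -ε

/-- The curvature force of `L` is balanced by strut forces which close into `N`-gons: there is a
continuous family of closed `N`-gons `v 0 r, …, v (N - 1) r`, `0 < r < 1`, no two of which share a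
vertex, all of whose edges are Gehring struts, and there are positive integrable force densities
`w k` on the `k`-th edges, such that for every compatible `ξ` the first variation of length is the
total first variation of the strut lengths weighted by the `w k` (where
`⟪ξ_x - ξ_y, x - y⟫` is the first variation of the length of a strut `x y` of length `1`). -/
def BalancedByPolygons [Fintype ι] (P : LinkProblem ι κ) (L : P.Arcs) (N : ℕ) [NeZero N] : Prop :=
  ∃ D : P.Field →L[ℝ] ℝ, IsLengthVariation P L D ∧
    ∃ (v : Fin N → ℝ → P.Point) (w : Fin N → ℝ → ℝ),
      (∀ k, ContinuousOn (v k) (Set.Ioo 0 1)) ∧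
      Set.InjOn (fun q : Fin N × ℝ => v q.1 q.2) (Set.univ ×ˢ Set.Ioo 0 1) ∧
      (∀ k, ∀ r ∈ Set.Ioo (0 : ℝ) 1, IsGStrut P L (v k r) (v (k + 1) r)) ∧
      (∀ k, ∀ r ∈ Set.Ioo (0 : ℝ) 1, 0 < w k r) ∧
      (∀ k, MeasureTheory.IntegrableOn (w k) (Set.Ioo 0 1)) ∧
      ∀ ξ : P.Field, IsCompatible P ξ →
        D ξ = ∫ r in Set.Ioo (0 : ℝ) 1, ∑ k, w k r *
          ⟪ξ (v k r).1 (v k r).2 - ξ (v (k + 1) r).1 (v (k + 1) r).2,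
            L (v k r).1 (v k r).2 - L (v (k + 1) r).1 (v (k + 1) r).2⟫

/-! ### Weighted clasp curves

A convex clasp curve is drawn here with its tip at the origin and opening upwards. `σ` is its own
parameter and `ρ` the one of the curve it is clasped with. It is parametrized by the angle `θ` of
its tangent with the horizontal, so that the vertical component of the unit tangent is
`u = sin θ`, with `|u| ≤ σ` along the curved arc. -/

/-- The horizontal coordinate as an (odd) function of `u`: for `u ≥ 0` it equals
`√(u² (1 - w²) / (1 - u² w²))` with `u / σ + w / ρ = 1`. -/
def claspX (σ ρ u : ℝ) : ℝ :=
  u * √((1 - (ρ * (1 - |u| / σ)) ^ 2) / (1 - u ^ 2 * (ρ * (1 - |u| / σ)) ^ 2))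

/-- The height above the tip, determined by `dz / dx = u / √(1 - u²)`. With `u = sin φ` this
reads `dz = tan φ dx = x'(sin φ) sin φ dφ`. -/
def claspRise (σ ρ θ : ℝ) : ℝ :=
  ∫ φ in (0 : ℝ)..θ, deriv (claspX σ ρ) (Real.sin φ) * Real.sin φ

/-- The point of `[-r, r]` closest to `t`. -/
def clamp (r t : ℝ) : ℝ := max (-r) (min r t)

/-- Horizontal coordinate of the clasp curve prolonged by straight ends, at the parameter `t`: the
curved arc is `|t| ≤ arcsin σ`, with `t` the tangent angle; beyond it `t` is arclength. -/
def armX (σ ρ t : ℝ) : ℝ :=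
  claspX σ ρ (Real.sin (clamp (Real.arcsin σ) t)) + √(1 - σ ^ 2) * (t - clamp (Real.arcsin σ) t)

/-- Height of the clasp curve prolonged by straight ends. -/
def armZ (σ ρ t : ℝ) : ℝ :=
  claspRise σ ρ (clamp (Real.arcsin σ) t) + σ * |t - clamp (Real.arcsin σ) t|

/-- Horizontal coordinate of the clasp curve split apart at its tip, with a horizontal segment of
length `g` inserted (`|t| ≤ g / 2`). For `g = 0` this is the curve itself. -/
def splitX (g σ ρ t : ℝ) : ℝ := clamp (g / 2) t + armX σ ρ (t - clamp (g / 2) t)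

/-- Height of the split clasp curve. -/
def splitZ (g σ ρ t : ℝ) : ℝ := armZ σ ρ (t - clamp (g / 2) t)

/-- The height of the tip of the upper clasped curve (parameter `σ`, opening downwards) above the
tip of the lower one (parameter `ρ`, opening upwards), fixed by the condition that the strut from
the tip of the former to the end of the curved arc of the latter has length `1`. -/
def tipGap (σ ρ : ℝ) : ℝ := √(1 - ρ ^ 2) + claspRise ρ σ (Real.arcsin ρ)

/-! ### The problem `C^m_{0,2}(τ)` and the configuration `L^m(τ)`, for `m = 1, 2`

There are two components `β` (`Sum.inl`), parallel to the `x₁z`-plane and opening downwards, and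
`m` components `γ` (`Sum.inr`), parallel to the `x₂z`-plane and opening upwards. The straight ends
have length `a` on the `β`s and `b` on the `γ`s. -/

/-- The position of the `i`-th of `n` objects spaced at distance `1` symmetrically about `0`. -/
def offset (n : ℕ) (i : Fin n) : ℝ := (i : ℝ) - ((n : ℝ) - 1) / 2

/-- Half the length of the parameter interval of the `β`s; the segment inserted in them has
length `m - 1`. -/
def betaEnd (m : ℕ) (τ a : ℝ) : ℝ := ((m : ℝ) - 1) / 2 + Real.arcsin (τ / 2) + a

/-- Half the length of the parameter interval of the `γ`s; the segment inserted in them has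
length `1`. -/
def gammaEnd (m : ℕ) (τ b : ℝ) : ℝ := 1 / 2 + Real.arcsin (τ / m) + b

/-- The `β` curve in the plane `x₂ = y`. -/
def beta (m : ℕ) (τ y t : ℝ) : E3 :=
  !₂[splitX ((m : ℝ) - 1) (τ / 2) (τ / m) t, y,
    tipGap (τ / 2) (τ / m) - splitZ ((m : ℝ) - 1) (τ / 2) (τ / m) t]

/-- The `γ` curve in the plane `x₁ = y`. -/
def gamma (m : ℕ) (τ y t : ℝ) : E3 :=
  !₂[y, splitX 1 (τ / m) (τ / 2) t, splitZ 1 (τ / m) (τ / 2) t]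

/-- The outer unit normals of the four bounding planes: at angle `arcsin (τ / 2)` from the vertical
for the left and right ends of the `β`s, at angle `arcsin (τ / m)` for those of the `γ`s. -/
def wallNormal (m : ℕ) (τ : ℝ) : Fin 4 → E3 :=
  ![!₂[-√(1 - (τ / 2) ^ 2), 0, -(τ / 2)], !₂[√(1 - (τ / 2) ^ 2), 0, -(τ / 2)],
    !₂[0, -√(1 - (τ / m) ^ 2), τ / m], !₂[0, √(1 - (τ / m) ^ 2), τ / m]]

/-- The signed distances of the four bounding planes from the origin, in the direction of their
normals. By mirror symmetry each is found from the right end of a `β` or of a `γ`. -/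
def wallDist (m : ℕ) (τ a b : ℝ) : Fin 4 → ℝ :=
  ![⟪wallNormal m τ 1, beta m τ 0 (betaEnd m τ a)⟫,
    ⟪wallNormal m τ 1, beta m τ 0 (betaEnd m τ a)⟫,
    ⟪wallNormal m τ 3, gamma m τ 0 (gammaEnd m τ b)⟫,
    ⟪wallNormal m τ 3, gamma m τ 0 (gammaEnd m τ b)⟫]

/-- The `j`-th bounding plane. -/
def wall (m : ℕ) (τ a b : ℝ) (j : Fin 4) : AffineSubspace ℝ E3 :=
  AffineSubspace.mk' (wallDist m τ a b j • wallNormal m τ j) (ℝ ∙ wallNormal m τ j)ᗮ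

/-- The generalized link problem: the ends of the arcs are constrained to the four bounding planes,
and the complement of the tetrahedron they bound is an obstacle. -/
def claspProblem (m : ℕ) (τ a b : ℝ) : LinkProblem (Fin 2 ⊕ Fin m) (Fin 4) where
  lo := Sum.elim (fun _ => -betaEnd m τ a) (fun _ => -gammaEnd m τ b)
  hi := Sum.elim (fun _ => betaEnd m τ a) (fun _ => gammaEnd m τ b)
  startSpace := Sum.elim (fun _ => wall m τ a b 0) (fun _ => wall m τ a b 2)
  endSpace := Sum.elim (fun _ => wall m τ a b 1) (fun _ => wall m τ a b 3)
  obstacle := fun j p => wallDist m τ a b j - ⟪wallNormal m τ j, p⟫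

/-- The configuration `L^m(τ)`: two translates of the `β` curve in the planes `x₂ = ±1/2`, and `m`
translates of the `γ` curve in the plane `x₁ = 0` (for `m = 1`) or the planes `x₁ = ±1/2`
(for `m = 2`). -/
def splitClasp (m : ℕ) (τ a b : ℝ) : (claspProblem m τ a b).Arcs
  | .inl i => fun t => beta m τ (offset 2 i) t
  | .inr i => fun t => gamma m τ (offset m i) t

end Gehring

end

/-! Two clasped curves with parameters `σ` (upper) and `ρ` (lower) lie in perpendicular planes. Let
the point with `u = σ r` on the first face the point with `w = ρ (1 - r)` on the second, and let the
segment between them have horizontal components `X`, `Y` and height `H`. Asking it to have length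
one and to be orthogonal to both tangents, `X √(1 - u²) = u H` and `Y √(1 - w²) = w H`, gives
exactly the formulas `claspX` and `strutHeight`. Differentiating `X² + Y² + H² = 1` and using
orthogonality, the sum of the two rises and `H` is constant in `r`; so these segments do join points
of the curves (`tipGap_sub_claspRise`).

They are shortest possible: with one endpoint fixed, the derivative of the squared distance in the
other endpoint has the sign of a difference of two rises and changes sign once, at the mate
(`one_le_sq_dist_arcs`). Straight ends and inserted segments do not bring points closer, and
parallel components lie in planes at distance at least one. Hence the thickness is one.

Along an arc the curvature force is the unit normal times `dθ = σ dr / √(1 - u²)`, so its vertical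
density in `r` is the constant `σ`. A clasp strut with force `σ / H` supplies this vertical density
and, by orthogonality, also the horizontal one in the plane of its `β`. Each vertex on a `β` has one
clasp strut and each vertex on a `γ` has `2 / m`, which matches the parameters `τ / 2` and `τ / m`.
Components across the planes cancel by symmetry on the single `γ` of `m = 1`, and are otherwise
carried by unit struts between parallel neighbours. The balance therefore holds separately for each
`r`, on one hexagon or octagon (`hexagons`, `octagons`).

Balance implies criticality: by Danskin's theorem the one-sided derivative of the thickness is at
most the first variation of every strut, and the weighted total of these is `δLen = -1`; so it is at
most `-1 / W` with `W` the total strut force. The first variation of length itself comes from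
differentiating the integral of the speed and integrating by parts; its endpoint terms vanish on
compatible fields because the curves meet the walls orthogonally. If `τ = 0` the curves are straight
and `δLen` vanishes on compatible fields. -/

open scoped RealInnerProductSpace

noncomputable section

namespace Gehring

open MeasureTheory Set Filter Topology

/-! ### Length as total variation, and its first variation -/

section

theorem eVariationOn_comp_subtype_univ {E : Type*} [PseudoEMetricSpace E] (f : ℝ → E) (s : Set ℝ) :
    eVariationOn (fun t : s => f t) univ = eVariationOn f s := by
  have := eVariationOn.comp_eq_of_monotoneOn f (t := univ) (Subtype.val : s → ℝ)
    fun _ _ _ _ h => h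
  rw [image_univ, Subtype.range_coe] at this
  exact this

section Variation

variable {E : Type*} [NormedAddCommGroup E] [NormedSpace ℝ E]

theorem norm_sub_le_integral_norm_deriv [CompleteSpace E] {f f' : ℝ → E} {a b x y : ℝ} {S : Set ℝ}
    (hS : S.Countable) (hc : ContinuousOn f (Icc a b))
    (hd : ∀ x ∈ Ioo a b \ S, HasDerivAt f (f' x) x) (hi : IntervalIntegrable f' volume a b)
    (hax : a ≤ x) (hxy : x ≤ y) (hyb : y ≤ b) :
    ‖f y - f x‖ ≤ ∫ t in x..y, ‖f' t‖ := by
  have hi' : IntervalIntegrable f' volume x y := hi.mono_set (by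
    rw [uIcc_of_le hxy, uIcc_of_le (hax.trans (hxy.trans hyb))]
    exact Icc_subset_Icc hax hyb)
  rw [← integral_eq_of_hasDerivAt_off_countable_of_le f f' hxy hS
    (hc.mono (Icc_subset_Icc hax hyb))
    (fun t ht => hd t ⟨⟨hax.trans_lt ht.1.1, ht.1.2.trans_le hyb⟩, ht.2⟩) hi']
  exact intervalIntegral.norm_integral_le_integral_norm hxy

theorem eVariationOn_le_integral_norm_deriv [CompleteSpace E] {f f' : ℝ → E} {a b : ℝ} {S : Set ℝ}
    (hS : S.Countable) (hc : ContinuousOn f (Icc a b))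
    (hd : ∀ x ∈ Ioo a b \ S, HasDerivAt f (f' x) x) (hi : IntervalIntegrable f' volume a b) :
    eVariationOn f (Icc a b) ≤ ENNReal.ofReal (∫ t in a..b, ‖f' t‖) := by
  have hint : ∀ x y, a ≤ x → x ≤ y → y ≤ b →
      IntervalIntegrable (fun t => ‖f' t‖) volume x y := fun x y hx hxy hy =>
    hi.norm.mono_set (by
      rw [uIcc_of_le hxy, uIcc_of_le (hx.trans (hxy.trans hy))]
      exact Icc_subset_Icc hx hy)
  refine iSup_le fun p => ?_
  obtain ⟨n, u, hu, hus⟩ := p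
  have key : ∀ n, ∑ i ∈ Finset.range n, edist (f (u (i + 1))) (f (u i)) ≤
      ENNReal.ofReal (∫ t in u 0..u n, ‖f' t‖) := by
    intro n
    induction n with
    | zero => simp
    | succ n ih =>
      rw [Finset.sum_range_succ, ← intervalIntegral.integral_add_adjacent_intervals
        (hint (u 0) (u n) (hus 0).1 (hu (Nat.zero_le n)) (hus n).2)
        (hint (u n) (u (n + 1)) (hus n).1 (hu (Nat.le_succ n)) (hus (n + 1)).2),
        ENNReal.ofReal_add
          (intervalIntegral.integral_nonneg (hu (Nat.zero_le n)) fun _ _ => norm_nonneg _)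
          (intervalIntegral.integral_nonneg (hu (Nat.le_succ n)) fun _ _ => norm_nonneg _)]
      refine add_le_add ih ?_
      rw [edist_dist, dist_eq_norm]
      exact ENNReal.ofReal_le_ofReal (norm_sub_le_integral_norm_deriv hS hc hd hi
        (hus n).1 (hu (Nat.le_succ n)) (hus (n + 1)).2)
  refine (key n).trans (ENNReal.ofReal_le_ofReal ?_)
  have hab : a ≤ b := (hus 0).1.trans (hus 0).2
  exact intervalIntegral.integral_mono_interval (hus 0).1 (hu (Nat.zero_le n)) (hus n).2
    (Eventually.of_forall fun _ => norm_nonneg _) hi.norm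

/-- The variation function `V` of `f` is monotone, hence differentiable almost everywhere with `∫ V'
≤ V b - V a`. Difference quotients of `f` are bounded in norm by those of `V`, so `‖f'‖ ≤ V'`
wherever both derivatives exist. -/
theorem integral_norm_deriv_le_eVariationOn {f f' : ℝ → E} {a b : ℝ} {S : Set ℝ}
    (hab : a ≤ b) (hS : S.Countable) (hd : ∀ x ∈ Ioo a b \ S, HasDerivAt f (f' x) x)
    (hi : IntervalIntegrable f' volume a b) (hf : BoundedVariationOn f (Icc a b)) :
    ∫ t in a..b, ‖f' t‖ ≤ (eVariationOn f (Icc a b)).toReal := by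
  set V : ℝ → ℝ := variationOnFromTo f (Icc a b) a with hV
  have hl := hf.locallyBoundedVariationOn
  have ha : a ∈ Icc a b := left_mem_Icc.2 hab
  have hb : b ∈ Icc a b := right_mem_Icc.2 hab
  have hm : MonotoneOn V (Icc a b) := variationOnFromTo.monotoneOn hl ha
  have hVab : V b - V a = (eVariationOn f (Icc a b)).toReal := by
    rw [hV, variationOnFromTo.self, variationOnFromTo.eq_of_le _ _ hab, inter_self, sub_zero]
  have hm' : MonotoneOn V (uIcc a b) := by rwa [uIcc_of_le hab]
  have h1 : ∫ t in a..b, deriv V t ≤ V b - V a := by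
    have := hm'.intervalIntegral_deriv_mem_uIcc
    rw [uIcc_of_le (sub_nonneg.2 (hm ha hb hab))] at this
    exact this.2
  rw [← hVab]
  refine le_trans ?_ h1
  refine intervalIntegral.integral_mono_ae_restrict hab hi.norm hm'.intervalIntegrable_deriv ?_
  rw [← restrict_Ioo_eq_restrict_Icc]
  have hSn : ∀ᵐ x ∂(volume.restrict (Ioo a b)), x ∉ S :=
    ae_restrict_of_ae (hS.ae_notMem volume)
  have hdiff : ∀ᵐ x ∂(volume.restrict (Ioo a b)), DifferentiableWithinAt ℝ V (Ioo a b) x :=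
    (hm.mono Ioo_subset_Icc_self).ae_differentiableWithinAt measurableSet_Ioo
  filter_upwards [hSn, hdiff, ae_restrict_mem measurableSet_Ioo] with x hxS hxd hx
  have hD : HasDerivAt V (deriv V x) x :=
    (hxd.differentiableAt (Ioo_mem_nhds hx.1 hx.2)).hasDerivAt
  have t1 := (hd x ⟨hx, hxS⟩).tendsto_slope.norm
  have t2 := hD.tendsto_slope
  have hle : 𝓝[>] x ≤ 𝓝[≠] x := nhdsWithin_mono _ fun y hy => ne_of_gt hy
  refine le_of_tendsto_of_tendsto (t1.mono_left hle) (t2.mono_left hle) ?_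
  filter_upwards [Ioo_mem_nhdsGT hx.2] with y hy
  have hyI : y ∈ Icc a b := ⟨(hx.1.trans hy.1).le, hy.2.le⟩
  have hxI : x ∈ Icc a b := ⟨hx.1.le, hx.2.le⟩
  rw [slope_def_module, slope_def_field, norm_smul, norm_inv, Real.norm_eq_abs,
    abs_of_pos (sub_pos.2 hy.1), div_eq_inv_mul]
  refine mul_le_mul_of_nonneg_left ?_ (inv_nonneg.2 (sub_pos.2 hy.1).le)
  rw [hV, variationOnFromTo.sub_right hl ha hyI hxI, variationOnFromTo.eq_of_le _ _ hy.1.le]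
  have hfin : eVariationOn f (Icc a b ∩ Icc x y) ≠ ⊤ := hl x y hxI hyI
  rw [← dist_eq_norm, ← ENNReal.ofReal_le_iff_le_toReal hfin, ← edist_dist]
  exact eVariationOn.edist_le f ⟨hyI, hy.1.le, le_rfl⟩ ⟨hxI, le_rfl, hy.1.le⟩

theorem toReal_eVariationOn_eq_integral [CompleteSpace E] {f f' : ℝ → E} {a b : ℝ} {S : Set ℝ}
    (hab : a ≤ b) (hS : S.Countable) (hc : ContinuousOn f (Icc a b))
    (hd : ∀ x ∈ Ioo a b \ S, HasDerivAt f (f' x) x) (hi : IntervalIntegrable f' volume a b) :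
    (eVariationOn f (Icc a b)).toReal = ∫ t in a..b, ‖f' t‖ := by
  have h := eVariationOn_le_integral_norm_deriv hS hc hd hi
  refine le_antisymm (ENNReal.toReal_le_of_le_ofReal
    (intervalIntegral.integral_nonneg hab fun _ _ => norm_nonneg _) h)
    (integral_norm_deriv_le_eVariationOn hab hS hd hi (ne_top_of_le_ne_top ENNReal.ofReal_ne_top h))

end Variation

section FirstVariation

variable {E : Type*} [NormedAddCommGroup E] [InnerProductSpace ℝ E]

/-- `γ` is a continuous curve with velocity a positive multiple of the continuous unit field `T`,
whose derivative is the bounded field `ν`; differentiability is required off a countable set. -/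
structure IsTurningCurve (γ T ν : ℝ → E) (S : Set ℝ) : Prop where
  countable : S.Countable
  continuous : Continuous γ
  velocity : ∃ C : ℝ, ∀ t ∉ S, ∃ s : ℝ, 0 < s ∧ s ≤ C ∧ HasDerivAt γ (s • T t) t
  norm_tangent : ∀ t, ‖T t‖ = 1
  continuous_tangent : Continuous T
  hasDerivAt_tangent : ∀ t ∉ S, HasDerivAt T (ν t) t
  measurable_normal : StronglyMeasurable ν
  norm_normal_le : ∀ t, ‖ν t‖ ≤ 1

theorem hasDerivAt_norm_add_smul {v w T : E} {s : ℝ} (hs : 0 < s) (hT : ‖T‖ = 1) (hv : v = s • T) :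
    HasDerivAt (fun h : ℝ => ‖v + h • w‖) ⟪T, w⟫ 0 := by
  have hT0 : v + (0 : ℝ) • w ≠ 0 := by
    rw [hv, zero_smul, add_zero]
    exact smul_ne_zero hs.ne' (by rw [← norm_ne_zero_iff, hT]; norm_num)
  have h1 : HasDerivAt (fun h : ℝ => v + h • w) w 0 := by
    simpa using ((hasDerivAt_id (0 : ℝ)).smul_const w).const_add v
  have h2 := h1.norm_sq.sqrt (by simpa using hT0)
  simp only [Real.sqrt_sq (norm_nonneg _)] at h2
  convert h2 using 1
  rw [zero_smul, add_zero, hv, norm_smul, hT, Real.norm_eq_abs, abs_of_pos hs, inner_smul_left]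
  simp only [RCLike.conj_to_real]
  field_simp

theorem IsTurningCurve.intervalIntegrable_inner_normal [SecondCountableTopology E] {γ T ν : ℝ → E} {S : Set ℝ}
    (hγ : IsTurningCurve γ T ν S) {ξ : ℝ → E} (hξ : Continuous ξ) (a b : ℝ) :
    IntervalIntegrable (fun t => ⟪ν t, ξ t⟫) volume a b := by
  refine (hξ.norm.intervalIntegrable a b).mono_fun
    (hγ.measurable_normal.inner hξ.stronglyMeasurable).aestronglyMeasurable
    (Eventually.of_forall fun t => ?_)
  simp only [norm_norm]
  exact (norm_inner_le_norm _ _).trans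
    (mul_le_of_le_one_left (norm_nonneg _) (hγ.norm_normal_le t))

/-- After integration by parts the first variation contains no derivative of the field, so it makes
sense for all continuous fields and is bounded in the sup norm because `‖ν‖ ≤ 1`. -/
theorem IsTurningCurve.exists_lengthVariation [SecondCountableTopology E] {γ T ν : ℝ → E} {S : Set ℝ}
    (hγ : IsTurningCurve γ T ν S) {a b : ℝ} (hab : a ≤ b) :
    ∃ D : C(Icc a b, E) →L[ℝ] ℝ, ∀ ξ : C(Icc a b, E), D ξ =
      ⟪T b, ξ ⟨b, right_mem_Icc.2 hab⟩⟫ - ⟪T a, ξ ⟨a, left_mem_Icc.2 hab⟩⟫ -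
        ∫ t in a..b, ⟪ν t, ξ (projIcc a b hab t)⟫ := by
  have hcont : ∀ ξ : C(Icc a b, E), Continuous fun t => ξ (projIcc a b hab t) := fun ξ =>
    ξ.continuous.comp continuous_projIcc
  let I : C(Icc a b, E) →ₗ[ℝ] ℝ :=
    { toFun := fun ξ => ∫ t in a..b, ⟪ν t, ξ (projIcc a b hab t)⟫
      map_add' := fun ξ ζ => by
        simp only [ContinuousMap.add_apply, inner_add_right]
        exact intervalIntegral.integral_add
          (hγ.intervalIntegrable_inner_normal (hcont ξ) a b)
          (hγ.intervalIntegrable_inner_normal (hcont ζ) a b)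
      map_smul' := fun c ξ => by
        simp only [ContinuousMap.smul_apply, inner_smul_right, RingHom.id_apply, smul_eq_mul]
        exact intervalIntegral.integral_const_mul _ _ }
  have hI : ∀ ξ, ‖I ξ‖ ≤ |b - a| * ‖ξ‖ := fun ξ => by
    have := intervalIntegral.norm_integral_le_of_norm_le_const (a := a) (b := b) (C := ‖ξ‖)
      (f := fun t => ⟪ν t, ξ (projIcc a b hab t)⟫) fun t _ =>
        ((norm_inner_le_norm _ _).trans (mul_le_of_le_one_left (norm_nonneg _)
          (hγ.norm_normal_le t))).trans (ξ.norm_coe_le_norm _)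
    rwa [mul_comm] at this
  exact ⟨(innerSL ℝ (T b)).comp (ContinuousMap.evalCLM ℝ (⟨b, right_mem_Icc.2 hab⟩ : Icc a b)) -
    (innerSL ℝ (T a)).comp (ContinuousMap.evalCLM ℝ (⟨a, left_mem_Icc.2 hab⟩ : Icc a b)) -
    I.mkContinuous _ hI, fun ξ => rfl⟩

variable [CompleteSpace E] [MeasurableSpace E] [BorelSpace E] [SecondCountableTopology E]

/-- The derivative of `‖γ' + h η'‖` at `h = 0` is `⟪T, η'⟫`, in which the speed of `γ` no longer
appears; the speed need only be positive and bounded off a countable set. -/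
theorem IsTurningCurve.hasDerivAt_length {γ T ν : ℝ → E} {S : Set ℝ} (hγ : IsTurningCurve γ T ν S)
    {a b : ℝ} (hab : a ≤ b) {η : ℝ → E} (hη : ContDiff ℝ 1 η) :
    HasDerivAt (fun h : ℝ => (eVariationOn (fun t => γ t + h • η t) (Icc a b)).toReal)
      (⟪T b, η b⟫ - ⟪T a, η a⟫ - ∫ t in a..b, ⟪ν t, η t⟫) 0 := by
  have hηd : ∀ t, HasDerivAt η (deriv η t) t := fun t =>
    (hη.differentiable one_ne_zero t).hasDerivAt
  have hη' : Continuous (deriv η) := hη.continuous_deriv le_rfl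
  obtain ⟨C, hvel⟩ := hγ.velocity
  have hSae : ∀ᵐ t ∂(volume : Measure ℝ), t ∉ S := hγ.countable.ae_notMem volume
  have hγi : IntervalIntegrable (deriv γ) volume a b := by
    rw [intervalIntegrable_iff_integrableOn_Icc_of_le hab]
    refine Measure.integrableOn_of_bounded (M := C) (by simp)
      (measurable_deriv γ).aestronglyMeasurable ?_
    filter_upwards [ae_restrict_of_ae hSae] with t ht
    obtain ⟨s, hs0, hsC, hs⟩ := hvel t ht
    rwa [hs.deriv, norm_smul, hγ.norm_tangent, mul_one, Real.norm_eq_abs, abs_of_pos hs0]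
  have hlen : ∀ h : ℝ, (eVariationOn (fun t => γ t + h • η t) (Icc a b)).toReal =
      ∫ t in a..b, ‖deriv γ t + h • deriv η t‖ := by
    intro h
    refine toReal_eVariationOn_eq_integral hab hγ.countable
      (hγ.continuous.add (hη.continuous.const_smul h)).continuousOn (fun t ht => ?_)
      (hγi.add ((hη'.const_smul h).intervalIntegrable a b))
    obtain ⟨s, -, -, hs⟩ := hvel t ht.2
    rw [hs.deriv]
    exact hs.add ((hηd t).const_smul h)
  simp only [hlen]
  -- Integration by parts: the derivative is moved from `η` to the tangent `T`.
  have hvar : ∫ t in a..b, ⟪T t, deriv η t⟫ =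
      ⟪T b, η b⟫ - ⟪T a, η a⟫ - ∫ t in a..b, ⟪ν t, η t⟫ := by
    have i1 : IntervalIntegrable (fun t => ⟪ν t, η t⟫) volume a b := by
      obtain ⟨M, hM⟩ := isCompact_Icc.exists_bound_of_continuousOn
        (hη.continuous.continuousOn (s := Icc a b))
      rw [intervalIntegrable_iff_integrableOn_Icc_of_le hab]
      refine Measure.integrableOn_of_bounded (M := M) (by simp)
        (hγ.measurable_normal.inner hη.continuous.stronglyMeasurable).aestronglyMeasurable ?_
      filter_upwards [ae_restrict_mem measurableSet_Icc] with t ht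
      calc ‖⟪ν t, η t⟫‖ ≤ ‖ν t‖ * ‖η t‖ := norm_inner_le_norm _ _
        _ ≤ 1 * M := mul_le_mul (hγ.norm_normal_le t) (hM t ht) (norm_nonneg _) zero_le_one
        _ = M := one_mul M
    have i2 : IntervalIntegrable (fun t => ⟪T t, deriv η t⟫) volume a b :=
      (hγ.continuous_tangent.inner hη').intervalIntegrable a b
    have := integral_eq_of_hasDerivAt_off_countable_of_le (fun t => ⟪T t, η t⟫)
      (fun t => ⟪T t, deriv η t⟫ + ⟪ν t, η t⟫) hab hγ.countable
      (hγ.continuous_tangent.inner hη.continuous).continuousOn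
      (fun t ht => (hγ.hasDerivAt_tangent t ht.2).inner ℝ (hηd t)) (i2.add i1)
    rw [intervalIntegral.integral_add i2 i1] at this
    linarith
  rw [← hvar]
  -- Domination is immediate: `h ↦ ‖γ' + h η'‖` is Lipschitz with constant `‖η'‖`.
  refine (intervalIntegral.hasDerivAt_integral_of_dominated_loc_of_lip (s := univ)
    (bound := fun t => ‖deriv η t‖) univ_mem ?_ ?_ ?_ ?_ ?_ ?_).2
  · refine Eventually.of_forall fun h => ?_
    exact ((measurable_deriv γ).add (hη'.measurable.const_smul h)).norm.aestronglyMeasurable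
  · simpa using hγi.norm
  · exact (hγ.continuous_tangent.inner hη').aestronglyMeasurable
  · refine Eventually.of_forall fun t _ => ?_
    refine LipschitzWith.lipschitzOnWith (LipschitzWith.of_dist_le_mul fun x y => ?_)
    rw [Real.coe_nnabs, abs_norm, Real.dist_eq, Real.dist_eq]
    refine (abs_norm_sub_norm_le _ _).trans ?_
    rw [add_sub_add_left_eq_sub, ← sub_smul, norm_smul, Real.norm_eq_abs, mul_comm]
  · exact hη'.norm.intervalIntegrable a b
  · filter_upwards [hSae] with t ht _
    obtain ⟨s, hs0, -, hs⟩ := hvel t ht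
    exact hasDerivAt_norm_add_smul hs0 (hγ.norm_tangent t) hs.deriv

end FirstVariation

theorem exists_isLengthVariation {ι κ : Type} [Fintype ι] (P : LinkProblem ι κ) (L : P.Arcs)
    (γ T ν : ι → ℝ → E3) (S : ι → Set ℝ) (hγ : ∀ i, IsTurningCurve (γ i) (T i) (ν i) (S i))
    (hP : ∀ i, P.lo i ≤ P.hi i) (hL : ∀ i (t : P.Dom i), L i t = γ i t) :
    ∃ D : P.Field →L[ℝ] ℝ, IsLengthVariation P L D ∧ ∀ ξ : P.Field, D ξ =
      ∑ i, (⟪T i (P.hi i), ξ i ⟨P.hi i, right_mem_Icc.2 (hP i)⟩⟫ -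
        ⟪T i (P.lo i), ξ i ⟨P.lo i, left_mem_Icc.2 (hP i)⟩⟫ -
        ∫ t in P.lo i..P.hi i, ⟪ν i t, ξ i (projIcc (P.lo i) (P.hi i) (hP i) t)⟫) := by
  choose D hD using fun i => (hγ i).exists_lengthVariation (hP i)
  refine ⟨∑ i, (D i).comp (ContinuousLinearMap.proj i), fun ξ hξ => ?_, fun ξ => ?_⟩
  · simp only [len, _root_.sum_apply, ContinuousLinearMap.comp_apply,
      ContinuousLinearMap.proj_apply]
    refine HasDerivAt.fun_sum fun i _ => ?_
    obtain ⟨η, hη, hξη⟩ := hξ i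
    have h := (hγ i).hasDerivAt_length (hP i) hη
    have hint : ∫ t in P.lo i..P.hi i, ⟪ν i t, ξ i (projIcc (P.lo i) (P.hi i) (hP i) t)⟫ =
        ∫ t in P.lo i..P.hi i, ⟪ν i t, η t⟫ := by
      refine intervalIntegral.integral_congr fun t ht => ?_
      rw [uIcc_of_le (hP i)] at ht
      simp only [hξη, projIcc_of_mem (hP i) ht]
    rw [hD, hint, hξη, hξη]
    refine h.congr_of_eventuallyEq (Eventually.of_forall fun s => ?_)
    have hmove : move P L ξ s i = fun t : Icc (P.lo i) (P.hi i) => γ i t + s • η t := by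
      funext t
      rw [move, hL, hξη]
    dsimp only
    rw [hmove, eVariationOn_comp_subtype_univ fun t => γ i t + s • η t]
  · simp only [_root_.sum_apply, ContinuousLinearMap.comp_apply,
      ContinuousLinearMap.proj_apply, hD]

end

/-! ### Danskin's theorem, and criticality from balanced strut forces -/

section

/-- Danskin's theorem for the minimum over a compact space of functions with uniformly quadratic
remainder. -/
theorem exists_hasDerivWithinAt_iInf {K : Type*} [TopologicalSpace K] [CompactSpace K] [Nonempty K]
    {F : ℝ → K → ℝ} {G : K → ℝ} {C : ℝ} (hF : Continuous (F 0)) (hG : Continuous G)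
    (hFG : ∀ h q, |F h q - F 0 q - h * G q| ≤ C * h ^ 2) :
    ∃ d : ℝ, HasDerivWithinAt (fun h => ⨅ q, F h q) d (Ici 0) 0 ∧
      ∀ q, (∀ q', F 0 q ≤ F 0 q') → d ≤ G q := by
  obtain ⟨p₀, -, hp₀⟩ := isCompact_univ.exists_isMinOn univ_nonempty hF.continuousOn
  have hAc : IsClosed {q | F 0 q ≤ F 0 p₀} := isClosed_le hF continuous_const
  -- Among the minimizers of `F 0`, `q₀` is one with the least `G`; the derivative is `G q₀`.
  obtain ⟨q₀, hq₀A, hq₀⟩ := hAc.isCompact.exists_isMinOn ⟨p₀, le_refl (F 0 p₀)⟩ hG.continuousOn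
  have hq₀A : F 0 q₀ ≤ F 0 p₀ := hq₀A
  have hmin : ∀ q', F 0 q₀ ≤ F 0 q' := fun q' => hq₀A.trans (hp₀ (mem_univ q'))
  obtain ⟨M, hM⟩ := isCompact_univ.exists_bound_of_continuousOn hG.continuousOn
  have hC : 0 ≤ C := by simpa using (abs_nonneg _).trans (hFG 1 q₀)
  have hM0 : 0 ≤ M := (norm_nonneg _).trans (hM q₀ (mem_univ _))
  have hM' : ∀ q, |G q| ≤ M := fun q => hM q (mem_univ q)
  have hbdd : ∀ h, 0 ≤ h → BddBelow (range (F h)) := by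
    rintro h hh
    refine ⟨F 0 q₀ - h * M - C * h ^ 2, ?_⟩
    rintro _ ⟨q, rfl⟩
    have h1 := (abs_le.1 (hFG h q)).1
    have h2 := mul_le_mul_of_nonneg_left (abs_le.1 (hM' q)).1 hh
    have h3 := hmin q
    linarith
  have hzero : ⨅ q, F 0 q = F 0 q₀ :=
    le_antisymm (ciInf_le (hbdd 0 le_rfl) q₀) (le_ciInf hmin)
  refine ⟨G q₀, ?_, fun q hq => hq₀ (hq p₀)⟩
  rw [hasDerivWithinAt_iff_isLittleO, Asymptotics.isLittleO_iff]
  intro ε hε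
  simp only [hzero, sub_zero, smul_eq_mul, Real.norm_eq_abs]
  -- Points with `G` well below `G q₀` form a compact set free of minimizers, so there `F 0` exceeds
  -- its minimum by a fixed `η`.
  obtain ⟨η, hη, hgap⟩ : ∃ η > 0, ∀ q, G q ≤ G q₀ - ε / 2 → F 0 q₀ + η ≤ F 0 q := by
    rcases {q | G q ≤ G q₀ - ε / 2}.eq_empty_or_nonempty with he | hne
    · exact ⟨1, one_pos, fun q hq => absurd (show q ∈ {q | G q ≤ G q₀ - ε / 2} from hq) (by simp [he])⟩
    obtain ⟨q₁, hq₁, hq₁min⟩ :=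
      (isClosed_le hG continuous_const).isCompact.exists_isMinOn hne hF.continuousOn
    refine ⟨F 0 q₁ - F 0 q₀, ?_, fun q hq => ?_⟩
    · by_contra hcon
      have h1 : F 0 q₁ ≤ F 0 p₀ := by linarith
      have h2 : G q₀ ≤ G q₁ := hq₀ h1
      have h3 : G q₁ ≤ G q₀ - ε / 2 := hq₁
      linarith
    · have : F 0 q₁ ≤ F 0 q := hq₁min hq
      linarith
  -- For `h ≤ 1`, moving from `0` to `h` closes a gap between two points by at most `(C + 2 M) h`,
  -- so `h B ≤ η` keeps the points of the compact set above `q₀`. The condition `2 B h ≤ ε` makes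
  -- the quadratic error at most `ε h / 2`.
  set B : ℝ := C + 2 * M + 1 with hB
  have hBpos : 0 < B := by positivity
  have hδ : 0 < min 1 (min (ε / (2 * B)) (η / B)) := by positivity
  filter_upwards [self_mem_nhdsWithin, nhdsWithin_le_nhds (Iio_mem_nhds hδ)] with h h0 hlt
  have h0 : 0 ≤ h := h0
  have hlt : h < min 1 (min (ε / (2 * B)) (η / B)) := hlt
  have hh1 : h ≤ 1 := (hlt.trans_le (min_le_left _ _)).le
  have hh2 : h * (2 * B) ≤ ε := by
    rw [← le_div_iff₀ (by positivity)]
    exact (hlt.trans_le ((min_le_right _ _).trans (min_le_left _ _))).le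
  have hh3 : h * B ≤ η := by
    rw [← le_div_iff₀ hBpos]
    exact (hlt.trans_le ((min_le_right _ _).trans (min_le_right _ _))).le
  have hCh : C * h ^ 2 ≤ ε / 2 * h := by nlinarith [mul_nonneg h0 hM0]
  have hup : ⨅ q, F h q ≤ F h q₀ := ciInf_le (hbdd h h0) q₀
  have hup' := (abs_le.1 (hFG h q₀)).2
  have hlow : F 0 q₀ + h * G q₀ - ε * h ≤ ⨅ q, F h q := by
    refine le_ciInf fun q => ?_
    have h1 := (abs_le.1 (hFG h q)).1
    rcases le_or_gt (G q) (G q₀ - ε / 2) with hq | hq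
    · have h2 := hgap q hq
      have h3 := mul_le_mul_of_nonneg_left (abs_le.1 (hM' q)).1 h0
      have h4 := mul_le_mul_of_nonneg_left (abs_le.1 (hM' q₀)).2 h0
      nlinarith [mul_nonneg hC h0]
    · have h2 := mul_le_mul_of_nonneg_left hq.le h0
      have h3 := hmin q
      nlinarith
  rw [abs_of_nonneg h0, abs_le]
  constructor
  · linarith
  · nlinarith

/-- The remainder is nonnegative by Cauchy–Schwarz applied to `f + h g` and `f`; the upper bound
comes from expanding `(‖f + h g‖ - ‖f‖)² ≥ 0`. -/
theorem abs_norm_add_smul_sub_le {E : Type*} [NormedAddCommGroup E] [InnerProductSpace ℝ E]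
    {f g : E} (hf : f ≠ 0) (h : ℝ) :
    |‖f + h • g‖ - ‖f‖ - h * (⟪g, f⟫ / ‖f‖)| ≤ ‖g‖ ^ 2 / ‖f‖ * h ^ 2 := by
  have hf0 : 0 < ‖f‖ := norm_pos_iff.2 hf
  have hsq : ‖f + h • g‖ ^ 2 = ‖f‖ ^ 2 + 2 * (h * ⟪g, f⟫) + h ^ 2 * ‖g‖ ^ 2 := by
    rw [norm_add_sq_real, inner_smul_right, norm_smul, mul_pow, Real.norm_eq_abs, sq_abs,
      real_inner_comm]
  have hinner : ‖f‖ ^ 2 + h * ⟪g, f⟫ ≤ ‖f + h • g‖ * ‖f‖ := by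
    have := real_inner_le_norm (f + h • g) f
    rwa [inner_add_left, inner_smul_left, real_inner_self_eq_norm_sq, RCLike.conj_to_real] at this
  have heq : ‖f + h • g‖ - ‖f‖ - h * (⟪g, f⟫ / ‖f‖) =
      (‖f + h • g‖ * ‖f‖ - ‖f‖ ^ 2 - h * ⟪g, f⟫) / ‖f‖ := by
    field_simp
  rw [heq, abs_of_nonneg (div_nonneg (by linarith) hf0.le), div_mul_eq_mul_div]
  refine div_le_div_of_nonneg_right ?_ hf0.le
  nlinarith [sq_nonneg (‖f + h • g‖ - ‖f‖), mul_nonneg (sq_nonneg ‖g‖) (sq_nonneg h)]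

section Links

variable {ι κ : Type}

theorem continuous_point_arc {P : LinkProblem ι κ} {X : ∀ i, P.Dom i → E3} (hX : ∀ i, Continuous (X i)) :
    Continuous fun x : P.Point => X x.1 x.2 :=
  continuous_sigma hX

/-- The obstacle functions are affine, so Danskin's theorem applies with zero remainder. Only
existence matters: the bound on the minimum of the two derivatives comes from the thickness. -/
theorem exists_hasDerivWithinAt_obstacleMin [Finite ι] {P : LinkProblem ι κ} {L : P.Arcs} [Finite κ] [Nonempty κ] [Nonempty P.Point]
    (hL : ∀ i, Continuous (L i)) (c : κ → ℝ) (n : κ → E3)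
    (hP : ∀ j p, P.obstacle j p = c j - ⟪n j, p⟫) (ξ : P.Field) :
    ∃ d : ℝ, HasDerivWithinAt (fun h => obstacleMin P (move P L ξ h)) d (Ici 0) 0 := by
  let _ : TopologicalSpace κ := ⊥
  have : DiscreteTopology κ := ⟨rfl⟩
  have hpt : ∀ {X : ∀ i, P.Dom i → E3}, (∀ i, Continuous (X i)) →
      Continuous fun q : κ × P.Point => ⟪n q.1, X q.2.1 q.2.2⟫ := fun hX =>
    (continuous_of_discreteTopology.comp continuous_fst).inner
      ((continuous_point_arc hX).comp continuous_snd)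
  have hc : Continuous fun q : κ × P.Point => c q.1 :=
    continuous_of_discreteTopology.comp continuous_fst
  obtain ⟨d, hd, -⟩ := exists_hasDerivWithinAt_iInf
    (F := fun h (q : κ × P.Point) => P.obstacle q.1 (move P L ξ h q.2.1 q.2.2))
    (G := fun q => -⟪n q.1, ξ q.2.1 q.2.2⟫) (C := 0)
    (by
      simp only [hP, move, zero_smul, add_zero]
      exact hc.sub (hpt hL))
    (hpt fun i => (ξ i).continuous).neg (fun h q => by
      simp only [hP, move, inner_add_right, inner_smul_right]
      refine (abs_nonpos_iff.2 ?_).trans_eq (zero_mul _).symm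
      ring)
  exact ⟨d, hd⟩

variable [Finite ι] [TopologicalSpace ι] [DiscreteTopology ι] {P : LinkProblem ι κ} {L : P.Arcs}

theorem compactSpace_pairs (P : LinkProblem ι κ) :
    CompactSpace {q : P.Point × P.Point // q.1.1 ≠ q.2.1} := by
  have h1 : Continuous fun x : P.Point => x.1 := continuous_sigma fun i => continuous_const
  refine isCompact_iff_compactSpace.1 (IsClosed.isCompact ?_)
  exact isClosed_discrete {p : ι × ι | p.1 ≠ p.2} |>.preimage
    ((h1.comp continuous_fst).prodMk (h1.comp continuous_snd))

/-- The one-sided first variation of the Gehring thickness exists and is attained by a strut. -/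
theorem exists_hasDerivWithinAt_gThi (hL : ∀ i, Continuous (L i)) (hthi : gThi P L = 1)
    (hne : Nonempty {q : P.Point × P.Point // q.1.1 ≠ q.2.1}) (ξ : P.Field) :
    ∃ d : ℝ, HasDerivWithinAt (fun h => gThi P (move P L ξ h)) d (Ici 0) 0 ∧
      ∀ x y : P.Point, IsGStrut P L x y →
        d ≤ ⟪ξ x.1 x.2 - ξ y.1 y.2, L x.1 x.2 - L y.1 y.2⟫ := by
  have := compactSpace_pairs P
  let f : {q : P.Point × P.Point // q.1.1 ≠ q.2.1} → E3 := fun q =>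
    L q.1.1.1 q.1.1.2 - L q.1.2.1 q.1.2.2
  let g : {q : P.Point × P.Point // q.1.1 ≠ q.2.1} → E3 := fun q =>
    ξ q.1.1.1 q.1.1.2 - ξ q.1.2.1 q.1.2.2
  have hpair : ∀ {X : ∀ i, P.Dom i → E3}, (∀ i, Continuous (X i)) →
      Continuous fun q : {q : P.Point × P.Point // q.1.1 ≠ q.2.1} =>
        X q.1.1.1 q.1.1.2 - X q.1.2.1 q.1.2.2 := fun hX =>
    ((continuous_point_arc hX).comp (continuous_fst.comp continuous_subtype_val)).sub
      ((continuous_point_arc hX).comp (continuous_snd.comp continuous_subtype_val))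
  have hf : Continuous f := hpair hL
  have hg : Continuous g := hpair fun i => (ξ i).continuous
  -- Distances bounded below by one make the quadratic remainder uniform over all pairs, with
  -- constant `M²`.
  have hf1 : ∀ q, 1 ≤ ‖f q‖ := fun q => by
    rw [← hthi, ← dist_eq_norm]
    exact ciInf_le ⟨0, by rintro _ ⟨_, rfl⟩; exact dist_nonneg⟩ q
  have hf0 : ∀ q, f q ≠ 0 := fun q h => by
    have := hf1 q
    rw [h, norm_zero] at this
    linarith
  obtain ⟨M, hM⟩ := isCompact_univ.exists_bound_of_continuousOn hg.continuousOn
  have hmove : ∀ h, gThi P (move P L ξ h) = ⨅ q, ‖f q + h • g q‖ := fun h => by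
    refine iInf_congr fun q => ?_
    rw [dist_eq_norm]
    congr 1
    simp only [move, f, g, smul_sub]
    abel
  obtain ⟨d, hd, hdmin⟩ := exists_hasDerivWithinAt_iInf (F := fun h q => ‖f q + h • g q‖)
    (G := fun q => ⟪g q, f q⟫ / ‖f q‖) (C := M ^ 2) (by simpa using hf.norm)
    ((hg.inner hf).div hf.norm fun q => norm_ne_zero_iff.2 (hf0 q)) (fun h q => by
      simp only [zero_smul, add_zero]
      refine (abs_norm_add_smul_sub_le (hf0 q) h).trans
        (mul_le_mul_of_nonneg_right ?_ (sq_nonneg h))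
      refine (div_le_self (sq_nonneg _) (hf1 q)).trans ?_
      exact pow_le_pow_left₀ (norm_nonneg _) (hM q (mem_univ q)) 2)
  refine ⟨d, by simpa only [hmove] using hd, fun x y hxy => ?_⟩
  have hn : ‖f ⟨(x, y), hxy.1⟩‖ = 1 := by
    have h2 := hxy.2
    rw [hthi, dist_eq_norm] at h2
    exact h2
  have := hdmin ⟨(x, y), hxy.1⟩ fun q' => by
    simp only [zero_smul, add_zero, hn]
    exact hf1 q'
  simpa only [hn, div_one] using this

/-- Criticality follows from balance by strut forces. -/
theorem BalancedByPolygons.stronglyCritical [Fintype ι] [Finite κ] [Nonempty κ] [Nonempty P.Point]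
    {N : ℕ} [NeZero N] (hbal : BalancedByPolygons P L N)
    (hL : ∀ i, Continuous (L i)) (hthi : gThi P L = 1)
    (c : κ → ℝ) (n : κ → E3) (hP : ∀ j p, P.obstacle j p = c j - ⟪n j, p⟫) :
    StronglyCritical P L := by
  obtain ⟨D, hD, v, w, -, -, hstrut, hw, hwi, hDw⟩ := hbal
  refine ⟨D, hD, ?_⟩
  have hsum : IntegrableOn (fun r => ∑ k, w k r) (Ioo 0 1) := integrable_finsetSum _ fun k _ => hwi k
  have hpos : ∀ r ∈ Ioo (0 : ℝ) 1, 0 < ∑ k, w k r := fun r hr =>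
    Finset.sum_pos (fun k _ => hw k r hr) ⟨0, Finset.mem_univ _⟩
  have hW : 0 < ∫ r in Ioo (0 : ℝ) 1, ∑ k, w k r := by
    rw [setIntegral_pos_iff_support_of_nonneg_ae _ hsum]
    · have : Ioo (0 : ℝ) 1 ⊆ (Function.support fun r => ∑ k, w k r) ∩ Ioo 0 1 := fun r hr =>
        ⟨(hpos r hr).ne', hr⟩
      exact lt_of_lt_of_le (by simp) (measure_mono this)
    · filter_upwards [ae_restrict_mem measurableSet_Ioo] with r hr using (hpos r hr).le
  have hhalf : (1 / 2 : ℝ) ∈ Ioo (0 : ℝ) 1 := by norm_num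
  have hne : Nonempty {q : P.Point × P.Point // q.1.1 ≠ q.2.1} :=
    ⟨⟨(v 0 (1 / 2), v (0 + 1) (1 / 2)), (hstrut 0 _ hhalf).1⟩⟩
  set W := ∫ r in Ioo (0 : ℝ) 1, ∑ k, w k r with hWdef
  -- `W` is the total strut force; every strut varies at rate at least `d`, so `-1 = D ξ ≥ d W`.
  refine ⟨1 / W, by positivity, fun ξ hξ hDξ => ?_⟩
  obtain ⟨d, hd, hdle⟩ := exists_hasDerivWithinAt_gThi hL hthi hne ξ
  obtain ⟨d', hd'⟩ := exists_hasDerivWithinAt_obstacleMin (L := L) hL c n hP ξ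
  refine ⟨d, d', hd, hd', (min_le_left _ _).trans ?_⟩
  rw [hDw ξ hξ] at hDξ
  have hle : d * W ≤ -1 := by
    rw [← hDξ, hWdef, ← integral_const_mul]
    refine setIntegral_mono_on (hsum.const_mul d) ?_ measurableSet_Ioo fun r hr => ?_
    -- The integrand must be integrable: otherwise its integral would have the default value `0`,
    -- not `-1`.
    · by_contra hcon
      rw [integral_undef hcon] at hDξ
      norm_num at hDξ
    · rw [Finset.mul_sum]
      refine Finset.sum_le_sum fun k _ => ?_
      rw [mul_comm]
      exact mul_le_mul_of_nonneg_left (hdle _ _ (hstrut k r hr)) (hw k r hr).le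
  rw [← neg_div, le_div_iff₀ hW]
  exact hle

end Links

end

/-! ### The horizontal coordinate of a clasp curve and its derivative -/

section

/-- The parameter on the clasped curve of the points joined by struts to the points `±u`. -/
def mate (σ ρ u : ℝ) : ℝ := ρ * (1 - |u| / σ)

/-- The derivative of `claspX`. -/
def claspSlope (σ ρ u : ℝ) : ℝ :=
  √((1 - mate σ ρ u ^ 2) / (1 - u ^ 2 * mate σ ρ u ^ 2)) + |u| / √(1 - mate σ ρ u ^ 2) *
    ((mate σ ρ u * (ρ / σ) * (1 - u ^ 2) + |u| * mate σ ρ u ^ 2 * (1 - mate σ ρ u ^ 2)) /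
      ((1 - u ^ 2 * mate σ ρ u ^ 2) * √(1 - u ^ 2 * mate σ ρ u ^ 2)))

theorem claspX_eq (σ ρ u : ℝ) :
    claspX σ ρ u = u * √((1 - mate σ ρ u ^ 2) / (1 - u ^ 2 * mate σ ρ u ^ 2)) := rfl

theorem mate_neg (σ ρ u : ℝ) : mate σ ρ (-u) = mate σ ρ u := by rw [mate, mate, abs_neg]

theorem claspX_neg (σ ρ u : ℝ) : claspX σ ρ (-u) = -claspX σ ρ u := by
  rw [claspX_eq, claspX_eq, mate_neg, neg_sq, neg_mul]

theorem claspSlope_neg (σ ρ u : ℝ) : claspSlope σ ρ (-u) = claspSlope σ ρ u := by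
  rw [claspSlope, claspSlope, mate_neg, neg_sq, abs_neg]

theorem claspX_self (σ ρ : ℝ) (hσ : 0 ≤ σ) : claspX σ ρ σ = σ := by
  rcases hσ.eq_or_lt with rfl | h
  · simp [claspX]
  · rw [claspX, abs_of_pos h, div_self h.ne']
    simp

theorem claspX_zero (σ ρ : ℝ) : claspX σ ρ 0 = 0 := by simp [claspX]

theorem claspRise_zero (σ ρ : ℝ) : claspRise σ ρ 0 = 0 := by simp [claspRise]

theorem mate_nonneg {σ ρ u : ℝ} (hσ : 0 < σ) (hρ : 0 ≤ ρ) (hu : |u| ≤ σ) : 0 ≤ mate σ ρ u :=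
  mul_nonneg hρ (sub_nonneg.2 ((div_le_one hσ).2 hu))

theorem mate_le {σ ρ u : ℝ} (hσ : 0 < σ) (hρ1 : ρ ≤ 1) (hu : |u| ≤ σ) :
    mate σ ρ u ≤ 1 - |u| / σ :=
  mul_le_of_le_one_left (sub_nonneg.2 ((div_le_one hσ).2 hu)) hρ1

/-- With `w` the mate of `u`, `w² ≤ w ≤ 1 - |u| / σ` since `0 ≤ w ≤ 1`. This linear bound controls
the degenerate case `ρ = 1`, in which `1 - w²` vanishes at the tip. -/
theorem div_le_one_sub_mate_sq {σ ρ u : ℝ} (hσ : 0 < σ) (hρ : 0 ≤ ρ) (hρ1 : ρ ≤ 1)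
    (hu : |u| ≤ σ) : |u| / σ ≤ 1 - mate σ ρ u ^ 2 := by
  have h0 := mate_nonneg hσ hρ hu
  have h1 := mate_le hσ hρ1 hu
  have h2 : 0 ≤ |u| / σ := by positivity
  have h3 : |u| / σ ≤ 1 := (div_le_one hσ).2 hu
  nlinarith

theorem one_sub_mate_sq_nonneg {σ ρ u : ℝ} (hσ : 0 < σ) (hρ : 0 ≤ ρ) (hρ1 : ρ ≤ 1)
    (hu : |u| ≤ σ) : 0 ≤ 1 - mate σ ρ u ^ 2 :=
  (by positivity : (0 : ℝ) ≤ |u| / σ).trans (div_le_one_sub_mate_sq hσ hρ hρ1 hu)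

theorem one_sub_mate_sq_pos {σ ρ u : ℝ} (hσ : 0 < σ) (hρ : 0 ≤ ρ) (hρ1 : ρ ≤ 1)
    (hu : |u| ≤ σ) (hu0 : u ≠ 0) : 0 < 1 - mate σ ρ u ^ 2 :=
  (div_pos (abs_pos.2 hu0) hσ).trans_le (div_le_one_sub_mate_sq hσ hρ hρ1 hu)

theorem one_sub_sq_mul_mate_sq_pos {σ ρ u : ℝ} (hσ : 0 < σ) (hσ1 : σ ≤ 1) (hρ : 0 ≤ ρ)
    (hρ1 : ρ ≤ 1) (hu : |u| ≤ σ) : 0 < 1 - u ^ 2 * mate σ ρ u ^ 2 := by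
  rcases eq_or_ne u 0 with rfl | h
  · simp
  have h1 := one_sub_mate_sq_pos hσ hρ hρ1 hu h
  have h2 : u ^ 2 ≤ 1 := by
    rw [← sq_abs]
    exact pow_le_one₀ (abs_nonneg u) (hu.trans hσ1)
  nlinarith [sq_nonneg (mate σ ρ u)]

theorem claspSlope_nonneg {σ ρ u : ℝ} (hσ : 0 < σ) (hσ1 : σ ≤ 1) (hρ : 0 ≤ ρ)
    (hρ1 : ρ ≤ 1) (hu : |u| ≤ σ) : 0 ≤ claspSlope σ ρ u := by
  have h1 := mate_nonneg hσ hρ hu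
  have h2 := one_sub_mate_sq_nonneg hσ hρ hρ1 hu
  have h3 := one_sub_sq_mul_mate_sq_pos hσ hσ1 hρ hρ1 hu
  have h4 : 0 ≤ 1 - u ^ 2 := by
    rw [← sq_abs, sub_nonneg]
    exact pow_le_one₀ (abs_nonneg u) (hu.trans hσ1)
  rw [claspSlope]
  positivity

/-- The tip must be excluded: the slope there is `√(1 - ρ²)`, which is zero for `ρ = 1`. -/
theorem claspSlope_pos {σ ρ u : ℝ} (hσ : 0 < σ) (hσ1 : σ ≤ 1) (hρ : 0 ≤ ρ)
    (hρ1 : ρ ≤ 1) (hu : |u| ≤ σ) (hu0 : u ≠ 0) : 0 < claspSlope σ ρ u := by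
  have h1 := mate_nonneg hσ hρ hu
  have h2 := one_sub_mate_sq_pos hσ hρ hρ1 hu hu0
  have h3 := one_sub_sq_mul_mate_sq_pos hσ hσ1 hρ hρ1 hu
  have h4 : 0 ≤ 1 - u ^ 2 := by
    rw [← sq_abs, sub_nonneg]
    exact pow_le_one₀ (abs_nonneg u) (hu.trans hσ1)
  rw [claspSlope]
  positivity

theorem continuous_mate (σ ρ : ℝ) : Continuous (mate σ ρ) := by
  unfold mate
  fun_prop

/-- For `ρ = 1` numerator and denominator both vanish at the tip; there `|u| ≤ σ (1 - w²)` squeezes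
the quotient below `√(σ |u|)`. -/
theorem continuousOn_abs_div_sqrt {σ ρ : ℝ} (hσ : 0 < σ) (hρ : 0 ≤ ρ) (hρ1 : ρ ≤ 1) :
    ContinuousOn (fun u => |u| / √(1 - mate σ ρ u ^ 2)) (Icc (-σ) σ) := by
  intro u hu
  rcases eq_or_ne u 0 with rfl | h
  · rw [ContinuousWithinAt, abs_zero, zero_div]
    have hlim : Tendsto (fun u => √(σ * |u|)) (𝓝[Icc (-σ) σ] 0) (𝓝 0) := by
      have : Continuous fun u : ℝ => √(σ * |u|) := by fun_prop
      simpa using (this.tendsto 0).mono_left nhdsWithin_le_nhds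
    refine tendsto_of_tendsto_of_tendsto_of_le_of_le' tendsto_const_nhds hlim
      (Eventually.of_forall fun u => by positivity) ?_
    filter_upwards [self_mem_nhdsWithin] with u hu
    have hu' := abs_le.2 hu
    have h1 := div_le_one_sub_mate_sq hσ hρ hρ1 hu'
    refine div_le_of_le_mul₀ (Real.sqrt_nonneg _) (Real.sqrt_nonneg _) ?_
    rw [← Real.sqrt_mul (by positivity)]
    refine Real.le_sqrt_of_sq_le ?_
    have h2 : |u| ≤ (1 - mate σ ρ u ^ 2) * σ := (div_le_iff₀ hσ).1 h1
    nlinarith [abs_nonneg u]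
  · refine ContinuousAt.continuousWithinAt (continuous_abs.continuousAt.div ?_ ?_)
    · exact (continuous_const.sub ((continuous_mate σ ρ).pow 2)).sqrt.continuousAt
    · exact (Real.sqrt_pos.2 (one_sub_mate_sq_pos hσ hρ hρ1 (abs_le.2 hu) h)).ne'

theorem continuousOn_claspSlope {σ ρ : ℝ} (hσ : 0 < σ) (hσ1 : σ ≤ 1) (hρ : 0 ≤ ρ)
    (hρ1 : ρ ≤ 1) : ContinuousOn (claspSlope σ ρ) (Icc (-σ) σ) := by
  have hm := continuous_mate σ ρ
  have hB : ∀ u ∈ Icc (-σ) σ, 0 < 1 - u ^ 2 * mate σ ρ u ^ 2 := fun u hu =>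
    one_sub_sq_mul_mate_sq_pos hσ hσ1 hρ hρ1 (abs_le.2 hu)
  refine ContinuousOn.add (ContinuousOn.sqrt (ContinuousOn.div ?_ ?_ fun u hu => (hB u hu).ne'))
    ((continuousOn_abs_div_sqrt hσ hρ hρ1).mul (ContinuousOn.div ?_ ?_ fun u hu =>
      (mul_pos (hB u hu) (Real.sqrt_pos.2 (hB u hu))).ne'))
  all_goals exact Continuous.continuousOn (by fun_prop)

theorem hasDerivAt_claspX_of_pos {σ ρ u : ℝ} (hσ : 0 < σ) (hσ1 : σ ≤ 1) (hρ : 0 ≤ ρ)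
    (hρ1 : ρ ≤ 1) (hu0 : 0 < u) (hu : u ≤ σ) :
    HasDerivAt (claspX σ ρ) (claspSlope σ ρ u) u := by
  have hu' : |u| ≤ σ := by rwa [abs_of_pos hu0]
  have hA := one_sub_mate_sq_pos hσ hρ hρ1 hu' hu0.ne'
  have hB := one_sub_sq_mul_mate_sq_pos hσ hσ1 hρ hρ1 hu'
  have hw : mate σ ρ u = ρ * (1 - u / σ) := by rw [mate, abs_of_pos hu0]
  have hdw : HasDerivAt (mate σ ρ) (-(ρ / σ)) u := by
    have h : HasDerivAt (fun x : ℝ => ρ * (1 - x / σ)) (ρ * (-(1 / σ))) u :=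
      (((hasDerivAt_id u).div_const σ).const_sub 1).const_mul ρ
    refine (h.congr_of_eventuallyEq ?_).congr_deriv (by ring)
    filter_upwards [lt_mem_nhds hu0] with x hx
    rw [mate, abs_of_pos hx]
  have hdA := (hdw.pow 2).const_sub 1
  have hdB := (((hasDerivAt_id u).pow 2).mul (hdw.pow 2)).const_sub 1
  have h := (hasDerivAt_id u).mul ((hdA.div hdB hB.ne').sqrt (div_pos hA hB).ne')
  refine h.congr_deriv ?_
  simp only [id, Pi.pow_apply, Pi.mul_apply, Pi.div_apply]
  rw [claspSlope, abs_of_pos hu0, Real.sqrt_div hA.le]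
  generalize mate σ ρ u = w at *
  have ha : √(1 - w ^ 2) ^ 2 = 1 - w ^ 2 := Real.sq_sqrt hA.le
  have hb : √(1 - u ^ 2 * w ^ 2) ^ 2 = 1 - u ^ 2 * w ^ 2 := Real.sq_sqrt hB.le
  have ha0 := Real.sqrt_pos.2 hA
  have hb0 := Real.sqrt_pos.2 hB
  rw [← ha, ← hb, Real.sqrt_sq ha0.le, Real.sqrt_sq hb0.le]
  generalize √(1 - w ^ 2) = a at ha ha0 ⊢
  generalize √(1 - u ^ 2 * w ^ 2) = b at hb hb0 ⊢
  -- Writing `1 - u²` through the two square roots makes the formula for the slope a rational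
  -- identity in `u`, `w`, `a`, `b`.
  have hab : b ^ 2 - u ^ 2 * a ^ 2 = 1 - u ^ 2 := by rw [ha, hb]; ring
  rw [← hab]
  push_cast
  field_simp
  ring

/-- Oddness gives `u < 0`. At the tip the chain rule may fail, since the root can vanish there when
`ρ = 1`; but the difference quotient is the root itself, which is continuous. -/
theorem hasDerivAt_claspX {σ ρ u : ℝ} (hσ : 0 < σ) (hσ1 : σ ≤ 1) (hρ : 0 ≤ ρ)
    (hρ1 : ρ ≤ 1) (hu : |u| ≤ σ) : HasDerivAt (claspX σ ρ) (claspSlope σ ρ u) u := by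
  rcases lt_trichotomy u 0 with h | rfl | h
  · have h1 := hasDerivAt_claspX_of_pos hσ hσ1 hρ hρ1 (neg_pos.2 h) (by rwa [← abs_of_neg h])
    have h2 : HasDerivAt (fun x => -claspX σ ρ (-x)) (claspSlope σ ρ u) u := by
      have := (h1.scomp u (hasDerivAt_neg u)).neg
      rw [neg_smul, one_smul, neg_neg, claspSlope_neg] at this
      exact this
    simpa only [claspX_neg, neg_neg] using h2
  · rw [hasDerivAt_iff_tendsto_slope]
    have hc : ContinuousAt
        (fun u => √((1 - mate σ ρ u ^ 2) / (1 - u ^ 2 * mate σ ρ u ^ 2))) 0 := by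
      have hm := continuous_mate σ ρ
      refine ContinuousAt.sqrt (ContinuousAt.div ?_ ?_ (by simp))
      all_goals exact Continuous.continuousAt (by fun_prop)
    have h0 : claspSlope σ ρ 0 = √((1 - mate σ ρ 0 ^ 2) / (1 - 0 ^ 2 * mate σ ρ 0 ^ 2)) := by
      simp [claspSlope]
    rw [h0]
    refine (hc.tendsto.mono_left nhdsWithin_le_nhds).congr' ?_
    filter_upwards [self_mem_nhdsWithin] with x hx
    have hx : x ≠ 0 := hx
    rw [slope_def_field, claspX_zero, claspX_eq, sub_zero, sub_zero, mul_div_cancel_left₀ _ hx]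
  · exact hasDerivAt_claspX_of_pos hσ hσ1 hρ hρ1 h (by rwa [← abs_of_pos h])

/-! ### The height of the clasp curve -/

theorem clamp_mem {r : ℝ} (hr : 0 ≤ r) (t : ℝ) : clamp r t ∈ Icc (-r) r :=
  ⟨le_max_left _ _, max_le (by linarith) (min_le_left _ _)⟩

theorem clamp_of_abs_le {r t : ℝ} (h : |t| ≤ r) : clamp r t = t := by
  rw [clamp, min_eq_right (abs_le.1 h).2, max_eq_right (abs_le.1 h).1]

theorem clamp_of_le {r t : ℝ} (hr : 0 ≤ r) (h : r ≤ t) : clamp r t = r := by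
  rw [clamp, min_eq_left h, max_eq_right (by linarith)]

theorem clamp_neg {r : ℝ} (hr : 0 ≤ r) (t : ℝ) : clamp r (-t) = -clamp r t := by
  unfold clamp
  rcases le_total r t with h | h <;> rcases le_total (-r) t with h' | h' <;>
    simp only [min_def, max_def] <;> split_ifs <;> linarith

theorem continuous_clamp (r : ℝ) : Continuous (clamp r) := by
  unfold clamp
  fun_prop

theorem sin_mem_of_mem_arcsin {σ t : ℝ} (hσ : 0 ≤ σ) (hσ1 : σ ≤ 1)
    (ht : t ∈ Icc (-Real.arcsin σ) (Real.arcsin σ)) : Real.sin t ∈ Icc (-σ) σ := by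
  have h1 := Real.arcsin_le_pi_div_two σ
  have hs : Real.sin (Real.arcsin σ) = σ := Real.sin_arcsin (by linarith) hσ1
  constructor
  · rw [← hs, ← Real.sin_neg]
    exact Real.sin_le_sin_of_le_of_le_pi_div_two (by linarith) (by linarith [ht.2]) ht.1
  · rw [← hs]
    exact Real.sin_le_sin_of_le_of_le_pi_div_two (by linarith [ht.1]) h1 ht.2

/-- The speed of the parametrization of the clasp curve by its tangent angle, extended to the real
line by its values at the ends. -/
def arcSpeed (σ ρ t : ℝ) : ℝ := claspSlope σ ρ (Real.sin (clamp (Real.arcsin σ) t))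

theorem continuous_arcSpeed {σ ρ : ℝ} (hσ : 0 < σ) (hσ1 : σ ≤ 1) (hρ : 0 ≤ ρ) (hρ1 : ρ ≤ 1) :
    Continuous (arcSpeed σ ρ) :=
  (continuousOn_claspSlope hσ hσ1 hρ hρ1).comp_continuous
    (Real.continuous_sin.comp (continuous_clamp _)) fun t =>
    sin_mem_of_mem_arcsin hσ.le hσ1 (clamp_mem (Real.arcsin_nonneg.2 hσ.le) t)

/-- Replacing `deriv` by the globally continuous `arcSpeed` makes the fundamental theorem of
calculus available. -/
theorem claspRise_eq {σ ρ θ : ℝ} (hσ : 0 < σ) (hσ1 : σ ≤ 1) (hρ : 0 ≤ ρ) (hρ1 : ρ ≤ 1)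
    (hθ : |θ| ≤ Real.arcsin σ) :
    claspRise σ ρ θ = ∫ φ in (0 : ℝ)..θ, arcSpeed σ ρ φ * Real.sin φ := by
  refine intervalIntegral.integral_congr fun φ hφ => ?_
  have hφ' : |φ| ≤ Real.arcsin σ := by
    rw [abs_le] at hθ ⊢
    have h0 := Real.arcsin_nonneg.2 hσ.le
    rcases le_total 0 θ with h | h
    · rw [uIcc_of_le h] at hφ
      exact ⟨by linarith [hφ.1], by linarith [hφ.2]⟩
    · rw [uIcc_of_ge h] at hφ
      exact ⟨by linarith [hφ.1], by linarith [hφ.2]⟩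
  simp only [arcSpeed, clamp_of_abs_le hφ']
  rw [(hasDerivAt_claspX hσ hσ1 hρ hρ1
    (abs_le.2 (sin_mem_of_mem_arcsin hσ.le hσ1 (abs_le.1 hφ')))).deriv]

theorem hasDerivAt_integral_arcSpeed {σ ρ : ℝ} (hσ : 0 < σ) (hσ1 : σ ≤ 1) (hρ : 0 ≤ ρ)
    (hρ1 : ρ ≤ 1) (θ : ℝ) : HasDerivAt (fun θ => ∫ φ in (0 : ℝ)..θ, arcSpeed σ ρ φ * Real.sin φ)
      (arcSpeed σ ρ θ * Real.sin θ) θ := by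
  have hc := (continuous_arcSpeed hσ hσ1 hρ hρ1).mul Real.continuous_sin
  exact intervalIntegral.integral_hasDerivAt_right (hc.intervalIntegrable _ _)
    (hc.stronglyMeasurableAtFilter _ _) hc.continuousAt

theorem hasDerivAt_claspRise {σ ρ θ : ℝ} (hσ : 0 < σ) (hσ1 : σ ≤ 1) (hρ : 0 ≤ ρ) (hρ1 : ρ ≤ 1)
    (hθ : |θ| < Real.arcsin σ) :
    HasDerivAt (claspRise σ ρ) (claspSlope σ ρ (Real.sin θ) * Real.sin θ) θ := by
  have h := hasDerivAt_integral_arcSpeed hσ hσ1 hρ hρ1 θ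
  rw [arcSpeed, clamp_of_abs_le hθ.le] at h
  refine h.congr_of_eventuallyEq ?_
  filter_upwards [continuous_abs.continuousAt.eventually_lt_const hθ] with x hx
  exact claspRise_eq hσ hσ1 hρ hρ1 hx.le

theorem continuousOn_claspRise {σ ρ : ℝ} (hσ : 0 < σ) (hσ1 : σ ≤ 1) (hρ : 0 ≤ ρ) (hρ1 : ρ ≤ 1) :
    ContinuousOn (claspRise σ ρ) (Icc (-Real.arcsin σ) (Real.arcsin σ)) :=
  (continuous_iff_continuousAt.2 fun θ =>
    (hasDerivAt_integral_arcSpeed hσ hσ1 hρ hρ1 θ).continuousAt).continuousOn.congr fun _ hθ =>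
    claspRise_eq hσ hσ1 hρ hρ1 (abs_le.2 hθ)

theorem claspRise_neg (σ ρ θ : ℝ) : claspRise σ ρ (-θ) = claspRise σ ρ θ := by
  have hd : ∀ u, deriv (claspX σ ρ) (-u) = deriv (claspX σ ρ) u := fun u => by
    have h1 : deriv (fun x => claspX σ ρ (-x)) u = -deriv (claspX σ ρ) (-u) :=
      deriv_comp_neg _ _
    have h2 : (fun x => claspX σ ρ (-x)) = fun x => -claspX σ ρ x := funext fun x => claspX_neg σ ρ x
    rw [h2, deriv.fun_neg] at h1
    linarith
  have := intervalIntegral.integral_comp_neg (a := 0) (b := θ)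
    fun φ => deriv (claspX σ ρ) (Real.sin φ) * Real.sin φ
  simp only [Real.sin_neg, hd, neg_zero] at this
  rw [claspRise, claspRise, intervalIntegral.integral_symm, ← this, ← intervalIntegral.integral_neg]
  simp

theorem monotoneOn_claspRise {σ ρ : ℝ} (hσ : 0 < σ) (hσ1 : σ ≤ 1) (hρ : 0 ≤ ρ) (hρ1 : ρ ≤ 1) :
    MonotoneOn (claspRise σ ρ) (Icc 0 (Real.arcsin σ)) := by
  have hsub : Icc 0 (Real.arcsin σ) ⊆ Icc (-Real.arcsin σ) (Real.arcsin σ) :=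
    Icc_subset_Icc_left (by linarith [Real.arcsin_nonneg.2 hσ.le])
  refine monotoneOn_of_hasDerivWithinAt_nonneg
    (f' := fun θ => claspSlope σ ρ (Real.sin θ) * Real.sin θ) (convex_Icc _ _)
    ((continuousOn_claspRise hσ hσ1 hρ hρ1).mono hsub) (fun θ hθ => ?_) fun θ hθ => ?_
  · rw [interior_Icc] at hθ
    exact (hasDerivAt_claspRise hσ hσ1 hρ hρ1 (by rw [abs_of_pos hθ.1]; exact hθ.2)).hasDerivWithinAt
  · rw [interior_Icc] at hθ
    have hpi := Real.arcsin_le_pi_div_two σ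
    refine mul_nonneg (claspSlope_nonneg hσ hσ1 hρ hρ1 (abs_le.2 (sin_mem_of_mem_arcsin hσ.le hσ1
      (hsub (Ioo_subset_Icc_self hθ))))) ?_
    exact Real.sin_nonneg_of_nonneg_of_le_pi hθ.1.le (by linarith [hθ.2, Real.pi_pos])

theorem claspRise_nonneg {σ ρ θ : ℝ} (hσ : 0 < σ) (hσ1 : σ ≤ 1) (hρ : 0 ≤ ρ) (hρ1 : ρ ≤ 1)
    (h : θ ∈ Icc 0 (Real.arcsin σ)) : 0 ≤ claspRise σ ρ θ := by
  have := monotoneOn_claspRise hσ hσ1 hρ hρ1 ⟨le_rfl, h.1.trans h.2⟩ h h.1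
  rwa [claspRise_zero] at this

end

section

/-! ### The struts between two clasped curves -/

/-- The height of the upper end of a strut above the lower one. -/
def strutHeight (u w : ℝ) : ℝ := √((1 - u ^ 2) * (1 - w ^ 2) / (1 - u ^ 2 * w ^ 2))

theorem strutHeight_nonneg (u w : ℝ) : 0 ≤ strutHeight u w := Real.sqrt_nonneg _

theorem mate_mul {σ ρ r : ℝ} (hσ : 0 < σ) (hr : 0 ≤ r) : mate σ ρ (σ * r) = ρ * (1 - r) := by
  rw [mate, abs_of_nonneg (by positivity), mul_div_cancel_left₀ _ hσ.ne']

theorem mul_mem_unit {σ r : ℝ} (hσ : 0 ≤ σ) (hσ1 : σ ≤ 1) (hr : r ∈ Icc (0 : ℝ) 1) :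
    σ * r ∈ Icc (0 : ℝ) σ ∧ (σ * r) ^ 2 ≤ 1 := by
  have h1 : 0 ≤ σ * r := mul_nonneg hσ hr.1
  have h2 : σ * r ≤ σ := mul_le_of_le_one_right hσ hr.2
  exact ⟨⟨h1, h2⟩, pow_le_one₀ h1 (h2.trans hσ1)⟩

theorem one_sub_mem_unit {r : ℝ} (hr : r ∈ Icc (0 : ℝ) 1) : 1 - r ∈ Icc (0 : ℝ) 1 :=
  ⟨by linarith [hr.2], by linarith [hr.1]⟩

theorem one_sub_sq_mul_sq_pos {σ ρ r : ℝ} (hσ : 0 < σ) (hσ1 : σ ≤ 1) (hρ : 0 < ρ) (hρ1 : ρ ≤ 1)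
    (hr : r ∈ Icc (0 : ℝ) 1) : 0 < 1 - (σ * r) ^ 2 * (ρ * (1 - r)) ^ 2 := by
  have h := one_sub_sq_mul_mate_sq_pos (u := σ * r) hσ hσ1 hρ.le hρ1 (by
    rw [abs_of_nonneg (mul_nonneg hσ.le hr.1)]
    exact mul_le_of_le_one_right hσ.le hr.2)
  rwa [mate_mul hσ hr.1] at h

/-- This is the orthogonality of strut and tangent: in the plane of the curve the strut is `(X, H)`
and the tangent `(√(1 - u²), -u)`, heights being measured upwards on the upper curve. -/
theorem claspX_mul_sqrt {σ ρ r : ℝ} (hσ : 0 < σ) (hσ1 : σ ≤ 1) (hr : r ∈ Icc (0 : ℝ) 1) :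
    claspX σ ρ (σ * r) * √(1 - (σ * r) ^ 2) = σ * r * strutHeight (σ * r) (ρ * (1 - r)) := by
  have h := (mul_mem_unit hσ.le hσ1 hr).2
  rw [claspX_eq, mate_mul hσ hr.1, strutHeight, mul_div_assoc, Real.sqrt_mul (by linarith)]
  ring

theorem strutHeight_comm (u w : ℝ) : strutHeight u w = strutHeight w u := by
  rw [strutHeight, strutHeight, mul_comm (1 - u ^ 2), mul_comm (u ^ 2)]

/-- The struts have length one. -/
theorem claspX_sq_add_claspX_sq {σ ρ r : ℝ} (hσ : 0 < σ) (hσ1 : σ ≤ 1) (hρ : 0 < ρ) (hρ1 : ρ ≤ 1)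
    (hr : r ∈ Icc (0 : ℝ) 1) :
    claspX σ ρ (σ * r) ^ 2 + claspX ρ σ (ρ * (1 - r)) ^ 2 +
      strutHeight (σ * r) (ρ * (1 - r)) ^ 2 = 1 := by
  have h1 := (mul_mem_unit hσ.le hσ1 hr).2
  have h2 := (mul_mem_unit hρ.le hρ1 (one_sub_mem_unit hr)).2
  have h3 := one_sub_sq_mul_sq_pos hσ hσ1 hρ hρ1 hr
  rw [claspX_eq, claspX_eq, mate_mul hσ hr.1, mate_mul hρ (one_sub_mem_unit hr).1, strutHeight,
    sub_sub_cancel]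
  generalize σ * r = u at *
  generalize ρ * (1 - r) = w at *
  have h3' : 0 < 1 - w ^ 2 * u ^ 2 := by rwa [mul_comm]
  rw [mul_pow, mul_pow, Real.sq_sqrt (div_nonneg (by linarith) h3.le),
    Real.sq_sqrt (div_nonneg (by linarith) h3'.le),
    Real.sq_sqrt (div_nonneg (mul_nonneg (by linarith) (by linarith)) h3.le), mul_comm (w ^ 2)
      (u ^ 2)]
  field_simp
  ring

theorem hasDerivAt_arcsin_mul {σ r : ℝ} (h : (σ * r) ^ 2 < 1) :
    HasDerivAt (fun r => Real.arcsin (σ * r)) (σ / √(1 - (σ * r) ^ 2)) r := by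
  have h' := abs_lt.1 ((sq_lt_one_iff_abs_lt_one _).1 h)
  have h1 := Real.hasDerivAt_arcsin (x := σ * r) (by linarith [h'.1]) (by linarith [h'.2])
  refine (h1.comp r ((hasDerivAt_id r).const_mul σ)).congr_deriv ?_
  simp only [mul_one]
  ring

theorem arcsin_mul_mem {σ r : ℝ} (hσ : 0 ≤ σ) (hr : r ∈ Icc (0 : ℝ) 1) :
    Real.arcsin (σ * r) ∈ Icc 0 (Real.arcsin σ) :=
  ⟨Real.arcsin_nonneg.2 (mul_nonneg hσ hr.1),
    Real.monotone_arcsin (mul_le_of_le_one_right hσ hr.2)⟩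

theorem mul_sq_lt_one {σ r : ℝ} (hσ : 0 < σ) (hσ1 : σ ≤ 1) (hr : r ∈ Ioo (0 : ℝ) 1) :
    (σ * r) ^ 2 < 1 :=
  pow_lt_one₀ (mul_nonneg hσ.le hr.1.le)
    ((mul_lt_of_lt_one_right hσ hr.2).trans_le hσ1) two_ne_zero

theorem hasDerivAt_claspRise_arcsin {σ ρ r : ℝ} (hσ : 0 < σ) (hσ1 : σ ≤ 1) (hρ : 0 ≤ ρ)
    (hρ1 : ρ ≤ 1) (hr : r ∈ Ioo (0 : ℝ) 1) :
    HasDerivAt (fun r => claspRise σ ρ (Real.arcsin (σ * r)))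
      (claspSlope σ ρ (σ * r) * (σ * r) * (σ / √(1 - (σ * r) ^ 2))) r := by
  have h0 : 0 < σ * r := mul_pos hσ hr.1
  have h1 : σ * r < σ := mul_lt_of_lt_one_right hσ hr.2
  have h2 := hasDerivAt_arcsin_mul (mul_sq_lt_one hσ hσ1 hr)
  have hlt : |Real.arcsin (σ * r)| < Real.arcsin σ := by
    rw [abs_of_nonneg (Real.arcsin_nonneg.2 h0.le)]
    exact Real.strictMonoOn_arcsin ⟨by linarith, by linarith⟩ ⟨by linarith, hσ1⟩ h1
  have h3 := (hasDerivAt_claspRise hσ hσ1 hρ hρ1 hlt).comp r h2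
  rwa [Real.sin_arcsin (by linarith) (by linarith)] at h3

/-- The difference in height of two clasped points. -/
theorem tipGap_sub_claspRise {σ ρ r : ℝ} (hσ : 0 < σ) (hσ1 : σ ≤ 1) (hρ : 0 < ρ) (hρ1 : ρ ≤ 1)
    (hr : r ∈ Icc (0 : ℝ) 1) :
    tipGap σ ρ - claspRise σ ρ (Real.arcsin (σ * r)) -
      claspRise ρ σ (Real.arcsin (ρ * (1 - r))) = strutHeight (σ * r) (ρ * (1 - r)) := by
  -- By orthogonality the rises have differentials `(X / H) dX` and `(Y / H) dY`, while `H dH = -(X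
  -- dX + Y dY)`; so `f` is constant. Its value at `r = 0` is the definition of `tipGap`.
  set f : ℝ → ℝ := fun r => claspRise σ ρ (Real.arcsin (σ * r)) +
    claspRise ρ σ (Real.arcsin (ρ * (1 - r))) + strutHeight (σ * r) (ρ * (1 - r)) with hf
  have hrise : ∀ {σ ρ : ℝ}, 0 < σ → σ ≤ 1 → 0 < ρ → ρ ≤ 1 →
      ContinuousOn (fun r => claspRise σ ρ (Real.arcsin (σ * r))) (Icc 0 1) :=
    fun {σ ρ} hσ hσ1 hρ hρ1 => (continuousOn_claspRise hσ hσ1 hρ.le hρ1).comp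
      (Real.continuous_arcsin.comp (continuous_const.mul continuous_id)).continuousOn fun r hr =>
      ⟨by linarith [(arcsin_mul_mem hσ.le hr).1, Real.arcsin_nonneg.2 hσ.le],
        (arcsin_mul_mem hσ.le hr).2⟩
  have hfc : ContinuousOn f (Icc 0 1) := by
    refine ((hrise hσ hσ1 hρ hρ1).add ((hrise hρ hρ1 hσ hσ1).comp
      (continuous_const.sub continuous_id).continuousOn fun r hr => one_sub_mem_unit hr)).add ?_
    refine ContinuousOn.sqrt (ContinuousOn.div (Continuous.continuousOn (by fun_prop))
      (Continuous.continuousOn (by fun_prop)) fun r hr => ?_)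
    exact (one_sub_sq_mul_sq_pos hσ hσ1 hρ hρ1 hr).ne'
  have hfd : ∀ x ∈ Ioo (0 : ℝ) 1, HasDerivAt f 0 x := by
    intro x hx
    have hx' := Ioo_subset_Icc_self hx
    have hy : 1 - x ∈ Ioo (0 : ℝ) 1 := ⟨by linarith [hx.2], by linarith [hx.1]⟩
    have hy' := Ioo_subset_Icc_self hy
    have hsub : HasDerivAt (fun x : ℝ => 1 - x) (-1) x := by
      simpa using (hasDerivAt_id x).const_sub 1
    have d1 := hasDerivAt_claspRise_arcsin hσ hσ1 hρ.le hρ1 hx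
    have d2 := (hasDerivAt_claspRise_arcsin hρ hρ1 hσ.le hσ1 hy).comp x hsub
    have hxu := mul_sq_lt_one hσ hσ1 hx
    have hyw := mul_sq_lt_one hρ hρ1 hy
    have hmu := (mul_mem_unit hσ.le hσ1 hx').1
    have hmw := (mul_mem_unit hρ.le hρ1 hy').1
    have e1 : HasDerivAt (fun x => claspX σ ρ (σ * x)) (claspSlope σ ρ (σ * x) * σ) x := by
      have := (hasDerivAt_claspX hσ hσ1 hρ.le hρ1 (u := σ * x)
        (by rw [abs_of_nonneg hmu.1]; exact hmu.2)).comp x ((hasDerivAt_id x).const_mul σ)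
      rwa [mul_one] at this
    have e2 : HasDerivAt (fun x => claspX ρ σ (ρ * (1 - x)))
        (claspSlope ρ σ (ρ * (1 - x)) * (ρ * -1)) x :=
      HasDerivAt.comp (h₂ := claspX ρ σ) (h := fun x => ρ * (1 - x)) x
        (hasDerivAt_claspX hρ hρ1 hσ.le hσ1 (by rw [abs_of_nonneg hmw.1]; exact hmw.2))
        (hsub.const_mul ρ)
    have hH : 0 < strutHeight (σ * x) (ρ * (1 - x)) :=
      Real.sqrt_pos.2 (div_pos (mul_pos (by linarith) (by linarith))
        (one_sub_sq_mul_sq_pos hσ hσ1 hρ hρ1 hx'))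
    have hid := claspX_sq_add_claspX_sq hσ hσ1 hρ hρ1 hx'
    -- `H` is differentiated as `√(1 - X² - Y²)`, so that only the slopes of the two curves enter.
    have d3 := (((e1.pow 2).add (e2.pow 2)).const_sub 1).sqrt (by
      simp only [Pi.add_apply, Pi.pow_apply]
      have := pow_pos hH 2
      linarith)
    have d3' := d3.congr_of_eventuallyEq
      (f₁ := fun x => strutHeight (σ * x) (ρ * (1 - x))) (by
      filter_upwards [Ioo_mem_nhds hx.1 hx.2] with z hz
      have := claspX_sq_add_claspX_sq hσ hσ1 hρ hρ1 (Ioo_subset_Icc_self hz)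
      simp only [Pi.add_apply, Pi.pow_apply]
      rw [eq_comm, Real.sqrt_eq_iff_eq_sq _ (strutHeight_nonneg _ _)]
      · linarith
      · nlinarith [sq_nonneg (strutHeight (σ * z) (ρ * (1 - z)))])
    refine ((d1.add d2).add d3').congr_deriv ?_
    have hroot : √(1 - ((fun x => claspX σ ρ (σ * x)) ^ 2 +
        (fun x => claspX ρ σ (ρ * (1 - x))) ^ 2) x) = strutHeight (σ * x) (ρ * (1 - x)) := by
      simp only [Pi.add_apply, Pi.pow_apply]
      rw [Real.sqrt_eq_iff_eq_sq _ hH.le]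
      · linarith
      · nlinarith [sq_nonneg (strutHeight (σ * x) (ρ * (1 - x)))]
    rw [hroot]
    have hs1 : 0 < √(1 - (σ * x) ^ 2) := Real.sqrt_pos.2 (by linarith)
    have hs2 : 0 < √(1 - (ρ * (1 - x)) ^ 2) := Real.sqrt_pos.2 (by linarith)
    have k1 := claspX_mul_sqrt (ρ := ρ) hσ hσ1 hx'
    have k2 := claspX_mul_sqrt (ρ := σ) hρ hρ1 hy'
    rw [sub_sub_cancel, strutHeight_comm] at k2
    rw [← eq_div_iff hs1.ne'] at k1
    rw [← eq_div_iff hs2.ne'] at k2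
    rw [k1, k2]
    push_cast
    field_simp
    ring
  have hconst := integral_eq_of_hasDerivAt_off_countable_of_le f (fun _ => 0) hr.1
    countable_empty (hfc.mono (Icc_subset_Icc_right hr.2))
    (fun x hx => hfd x ⟨hx.1.1, hx.1.2.trans_le hr.2⟩) (by simp)
  have h0 : f 0 = tipGap σ ρ := by
    simp only [hf, tipGap, strutHeight]
    simp [claspRise_zero]
    ring
  rw [h0] at hconst
  simp only [hf, intervalIntegral.integral_zero] at hconst
  linarith

/-- The parameters of two clasped curves: both curved, or both straight. -/
structure IsClaspPair (σ ρ : ℝ) : Prop where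
  nonneg : 0 ≤ σ
  le_one : σ ≤ 1
  mate_le_one : ρ ≤ 1
  dichotomy : (0 < σ ∧ 0 < ρ) ∨ (σ = 0 ∧ ρ = 0)

theorem IsClaspPair.symm {σ ρ : ℝ} (h : IsClaspPair σ ρ) : IsClaspPair ρ σ :=
  ⟨by rcases h.dichotomy with h | h <;> linarith, h.mate_le_one, h.le_one,
    h.dichotomy.imp And.symm And.symm⟩

/-- The case `r = 1`: the strut from the end of the `σ` arc to the tip of the `ρ` curve also has
length one, so the normalization of the tip gap is symmetric in the two curves. -/
theorem IsClaspPair.tipGap_sub {σ ρ : ℝ} (h : IsClaspPair σ ρ) :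
    tipGap σ ρ - claspRise σ ρ (Real.arcsin σ) = √(1 - σ ^ 2) := by
  rcases h.dichotomy with ⟨hσ, hρ⟩ | ⟨rfl, rfl⟩
  · have := tipGap_sub_claspRise hσ h.le_one hρ h.mate_le_one (r := 1) (by simp)
    simpa [strutHeight, claspRise_zero] using this
  · simp [tipGap, claspRise_zero]

theorem IsClaspPair.tipGap_comm {σ ρ : ℝ} (h : IsClaspPair σ ρ) : tipGap ρ σ = tipGap σ ρ := by
  have := h.tipGap_sub
  rw [tipGap]
  linarith

theorem IsClaspPair.claspRise_nonneg {σ ρ θ : ℝ} (h : IsClaspPair σ ρ)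
    (hθ : θ ∈ Icc 0 (Real.arcsin σ)) : 0 ≤ claspRise σ ρ θ := by
  rcases h.dichotomy with ⟨hσ, hρ⟩ | ⟨rfl, rfl⟩
  · exact Gehring.claspRise_nonneg hσ h.le_one hρ.le h.mate_le_one hθ
  · rw [Real.arcsin_zero, Icc_self, mem_singleton_iff] at hθ
    rw [hθ, claspRise_zero]

/-- Points on the curved arcs of two clasped curves have distance at least one. -/
theorem one_le_sq_dist_arcs {σ ρ t s : ℝ} (hσ : 0 < σ) (hσ1 : σ ≤ 1) (hρ : 0 < ρ) (hρ1 : ρ ≤ 1)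
    (ht : t ∈ Icc 0 (Real.arcsin σ)) (hs : s ∈ Icc 0 (Real.arcsin ρ)) :
    1 ≤ claspX σ ρ (Real.sin t) ^ 2 + claspX ρ σ (Real.sin s) ^ 2 +
      (tipGap σ ρ - claspRise σ ρ t - claspRise ρ σ s) ^ 2 := by
  have hπσ := Real.arcsin_le_pi_div_two σ
  have hπρ := Real.arcsin_le_pi_div_two ρ
  have hpi := Real.pi_pos
  have hparam : ∀ {σ t : ℝ}, 0 < σ → σ ≤ 1 → t ∈ Icc 0 (Real.arcsin σ) →
      Real.sin t / σ ∈ Icc (0 : ℝ) 1 ∧ σ * (Real.sin t / σ) = Real.sin t := by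
    intro σ t hσ hσ1 ht
    have h1 := sin_mem_of_mem_arcsin hσ.le hσ1 (t := t) ⟨by linarith [ht.1, ht.2], ht.2⟩
    have h2 : 0 ≤ Real.sin t := Real.sin_nonneg_of_nonneg_of_le_pi ht.1
      (by linarith [ht.2, Real.arcsin_le_pi_div_two σ])
    exact ⟨⟨by positivity, (div_le_one hσ).2 h1.2⟩, mul_div_cancel₀ _ hσ.ne'⟩
  have harcsin : ∀ {t : ℝ}, 0 ≤ t → t ≤ Real.pi / 2 → Real.arcsin (Real.sin t) = t :=
    fun h0 h1 => Real.arcsin_sin (by linarith) h1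
  obtain ⟨hr, hrt⟩ := hparam hσ hσ1 ht
  set r := Real.sin t / σ with hrdef
  have htr : Real.arcsin (σ * r) = t := by rw [hrt, harcsin ht.1 (ht.2.trans hπσ)]
  set G : ℝ → ℝ := fun s => claspX σ ρ (Real.sin t) ^ 2 + claspX ρ σ (Real.sin s) ^ 2 +
      (tipGap σ ρ - claspRise σ ρ t - claspRise ρ σ s) ^ 2 with hG
  set s₀ := Real.arcsin (ρ * (1 - r)) with hs₀
  have hs₀m : s₀ ∈ Icc 0 (Real.arcsin ρ) := arcsin_mul_mem hρ.le (one_sub_mem_unit hr)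
  -- For fixed `t` the candidate minimizer `s₀` is the mate of `t`, where the segment is a strut.
  have hGs₀ : G s₀ = 1 := by
    have h1 := tipGap_sub_claspRise hσ hσ1 hρ hρ1 hr
    have h2 := claspX_sq_add_claspX_sq hσ hσ1 hρ hρ1 hr
    have h3 := (mul_mem_unit hρ.le hρ1 (one_sub_mem_unit hr)).1
    rw [htr, ← hs₀] at h1
    rw [hG]
    dsimp only
    rw [h1, ← hrt, hs₀, Real.sin_arcsin (by linarith [h3.1]) (by linarith [h3.2]), h2]
  have hsub : Icc 0 (Real.arcsin ρ) ⊆ Icc (-Real.arcsin ρ) (Real.arcsin ρ) :=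
    Icc_subset_Icc_left (by linarith [Real.arcsin_nonneg.2 hρ.le])
  have hXd : ∀ s ∈ Icc 0 (Real.arcsin ρ), HasDerivAt (fun s => claspX ρ σ (Real.sin s))
      (claspSlope ρ σ (Real.sin s) * Real.cos s) s := fun s hs =>
    (hasDerivAt_claspX hρ hρ1 hσ.le hσ1
      (abs_le.2 (sin_mem_of_mem_arcsin hρ.le hρ1 (hsub hs)))).comp s (Real.hasDerivAt_sin s)
  have hGc : ContinuousOn G (Icc 0 (Real.arcsin ρ)) := by
    refine (continuousOn_const.add (ContinuousOn.pow (fun s hs => ?_) 2)).add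
      ((continuousOn_const.sub ((continuousOn_claspRise hρ hρ1 hσ.le hσ1).mono hsub)).pow 2)
    exact (hXd s hs).continuousAt.continuousWithinAt
  -- The strut from `s` to its own mate is orthogonal to the tangent at `s`. Subtracting this
  -- relation leaves only the difference between the rises at `t` and at the mate of `s`. The mate
  -- moves down as `s` grows, so the derivative turns from nonpositive to nonnegative at `s₀`.
  have hGd : ∀ s ∈ Ioo 0 (Real.arcsin ρ), HasDerivAt G
      (2 * claspSlope ρ σ (Real.sin s) * Real.sin s *
        (claspRise σ ρ t - claspRise σ ρ (Real.arcsin (σ * (1 - Real.sin s / ρ))))) s := by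
    intro s hs
    have hs' := Ioo_subset_Icc_self hs
    have d1 := (hXd s hs').pow 2
    have d2 := ((hasDerivAt_claspRise hρ hρ1 hσ.le hσ1 (θ := s)
      (by rw [abs_of_pos hs.1]; exact hs.2)).const_sub (tipGap σ ρ - claspRise σ ρ t)).pow 2
    refine ((d1.const_add (claspX σ ρ (Real.sin t) ^ 2)).add d2).congr_deriv ?_
    obtain ⟨hq, hqs⟩ := hparam hρ hρ1 hs'
    have h1 := tipGap_sub_claspRise hσ hσ1 hρ hρ1 (one_sub_mem_unit hq)
    have h2 := claspX_mul_sqrt (ρ := σ) hρ hρ1 hq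
    rw [sub_sub_cancel, hqs, harcsin hs'.1 (hs'.2.trans hπρ)] at h1
    rw [hqs, ← Real.cos_sq', Real.sqrt_sq (Real.cos_nonneg_of_mem_Icc
      ⟨by linarith [hs.1], by linarith [hs.2]⟩), strutHeight_comm, ← h1] at h2
    push_cast
    linear_combination (2 * claspSlope ρ σ (Real.sin s)) * h2
  have hsign : ∀ s ∈ Ioo 0 (Real.arcsin ρ),
      0 ≤ 2 * claspSlope ρ σ (Real.sin s) * Real.sin s := fun s hs => by
    have := claspSlope_nonneg hρ hρ1 hσ.le hσ1
      (abs_le.2 (sin_mem_of_mem_arcsin hρ.le hρ1 (hsub (Ioo_subset_Icc_self hs))))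
    have := Real.sin_nonneg_of_nonneg_of_le_pi hs.1.le (by linarith [hs.2])
    positivity
  have hmono := monotoneOn_claspRise hσ hσ1 hρ.le hρ1
  have hmateMem : ∀ s ∈ Icc 0 (Real.arcsin ρ),
      Real.arcsin (σ * (1 - Real.sin s / ρ)) ∈ Icc 0 (Real.arcsin σ) := fun s hs =>
    arcsin_mul_mem hσ.le (one_sub_mem_unit (hparam hρ hρ1 hs).1)
  have hsin₀ : Real.sin s₀ = ρ * (1 - r) := by
    have h3 := (mul_mem_unit hρ.le hρ1 (one_sub_mem_unit hr)).1
    rw [hs₀, Real.sin_arcsin (by linarith [h3.1]) (by linarith [h3.2])]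
  have hmono_sin : ∀ x y : ℝ, 0 ≤ x → x ≤ y → y ≤ Real.arcsin ρ →
      Real.sin x / ρ ≤ Real.sin y / ρ := fun x y h0 h1 h2 =>
    div_le_div_of_nonneg_right
      (Real.sin_le_sin_of_le_of_le_pi_div_two (by linarith) (by linarith) h1) hρ.le
  have hs₀r : Real.sin s₀ / ρ = 1 - r := by rw [hsin₀, mul_div_cancel_left₀ _ hρ.ne']
  change 1 ≤ G s
  rw [← hGs₀]
  rcases le_total s s₀ with hss | hss
  · have hanti : AntitoneOn G (Icc 0 s₀) := by
      refine antitoneOn_of_hasDerivWithinAt_nonpos (convex_Icc _ _)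
        (hGc.mono (Icc_subset_Icc_right hs₀m.2))
        (fun x hx => (hGd x ?_).hasDerivWithinAt) fun x hx => ?_
      · rw [interior_Icc] at hx
        exact ⟨hx.1, hx.2.trans_le hs₀m.2⟩
      · rw [interior_Icc] at hx
        have hx' : x ∈ Ioo 0 (Real.arcsin ρ) := ⟨hx.1, hx.2.trans_le hs₀m.2⟩
        refine mul_nonpos_of_nonneg_of_nonpos (hsign x hx') (sub_nonpos.2 ?_)
        refine hmono ht (hmateMem x (Ioo_subset_Icc_self hx')) ?_
        rw [← htr]
        refine Real.monotone_arcsin (mul_le_mul_of_nonneg_left ?_ hσ.le)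
        have := hmono_sin x s₀ hx.1.le hx.2.le hs₀m.2
        linarith
    exact hanti ⟨hs.1, hss⟩ ⟨hs₀m.1, le_rfl⟩ hss
  · have hmon : MonotoneOn G (Icc s₀ (Real.arcsin ρ)) := by
      refine monotoneOn_of_hasDerivWithinAt_nonneg (convex_Icc _ _)
        (hGc.mono (Icc_subset_Icc_left hs₀m.1))
        (fun x hx => (hGd x ?_).hasDerivWithinAt) fun x hx => ?_
      · rw [interior_Icc] at hx
        exact ⟨hs₀m.1.trans_lt hx.1, hx.2⟩
      · rw [interior_Icc] at hx
        have hx' : x ∈ Ioo 0 (Real.arcsin ρ) := ⟨hs₀m.1.trans_lt hx.1, hx.2⟩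
        refine mul_nonneg (hsign x hx') (sub_nonneg.2 ?_)
        refine hmono (hmateMem x (Ioo_subset_Icc_self hx')) ht ?_
        rw [← htr]
        refine Real.monotone_arcsin (mul_le_mul_of_nonneg_left ?_ hσ.le)
        have := hmono_sin s₀ x hs₀m.1 hx.1.le hx.2.le
        linarith
    exact hmon ⟨le_rfl, hs₀m.2⟩ ⟨hss, hs.2⟩ hss

end

section

/-! ### Clasp curves with straight ends -/

theorem clamp_cases {r : ℝ} (hr : 0 ≤ r) {t : ℝ} (ht : 0 ≤ t) :
    clamp r t ∈ Icc 0 r ∧ 0 ≤ t - clamp r t ∧ (t - clamp r t = 0 ∨ clamp r t = r) := by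
  rcases le_total t r with h | h
  · rw [clamp_of_abs_le (by rwa [abs_of_nonneg ht])]
    exact ⟨⟨ht, h⟩, by simp, Or.inl (sub_self t)⟩
  · rw [clamp_of_le hr h]
    exact ⟨⟨hr, le_rfl⟩, by linarith, Or.inr rfl⟩

theorem clamp_zero {r : ℝ} (hr : 0 ≤ r) : clamp r 0 = 0 := clamp_of_abs_le (by simpa using hr)

theorem armX_neg {σ : ℝ} (hσ : 0 ≤ σ) (ρ t : ℝ) : armX σ ρ (-t) = -armX σ ρ t := by
  rw [armX, armX, clamp_neg (Real.arcsin_nonneg.2 hσ), Real.sin_neg, claspX_neg]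
  ring

theorem armZ_neg {σ : ℝ} (hσ : 0 ≤ σ) (ρ t : ℝ) : armZ σ ρ (-t) = armZ σ ρ t := by
  rw [armZ, armZ, clamp_neg (Real.arcsin_nonneg.2 hσ), claspRise_neg, neg_sub_neg, abs_sub_comm]

theorem armX_zero {σ : ℝ} (hσ : 0 ≤ σ) (ρ : ℝ) : armX σ ρ 0 = 0 := by
  rw [armX, clamp_zero (Real.arcsin_nonneg.2 hσ), Real.sin_zero, claspX_zero]
  ring

theorem armZ_abs {σ : ℝ} (hσ : 0 ≤ σ) (ρ t : ℝ) : armZ σ ρ |t| = armZ σ ρ t := by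
  rcases abs_choice t with h | h
  · rw [h]
  · rw [h, armZ_neg hσ]

theorem sq_armX_abs {σ : ℝ} (hσ : 0 ≤ σ) (ρ t : ℝ) : armX σ ρ |t| ^ 2 = armX σ ρ t ^ 2 := by
  rcases abs_choice t with h | h
  · rw [h]
  · rw [h, armX_neg hσ, neg_sq]

theorem armX_nonneg {σ t : ℝ} (hσ : 0 ≤ σ) (ρ : ℝ) (ht : 0 ≤ t) : 0 ≤ armX σ ρ t := by
  obtain ⟨h1, h2, -⟩ := clamp_cases (Real.arcsin_nonneg.2 hσ) ht
  have h3 : 0 ≤ Real.sin (clamp (Real.arcsin σ) t) :=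
    Real.sin_nonneg_of_nonneg_of_le_pi h1.1
      (by linarith [h1.2, Real.arcsin_le_pi_div_two σ, Real.pi_pos])
  rw [armX, claspX_eq]
  positivity

theorem IsClaspPair.armZ_nonneg {σ ρ : ℝ} (h : IsClaspPair σ ρ) (t : ℝ) : 0 ≤ armZ σ ρ t := by
  rw [← armZ_abs h.nonneg]
  obtain ⟨h1, -, -⟩ := clamp_cases (Real.arcsin_nonneg.2 h.nonneg) (abs_nonneg t)
  have := h.claspRise_nonneg h1
  have := h.nonneg
  rw [armZ]
  positivity

/-- Pulling back a point on a straight end to the end of the curved arc decreases the distance to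
all points at nonnegative height on the other curve. -/
theorem IsClaspPair.sq_dist_straight {σ ρ : ℝ} (h : IsClaspPair σ ρ) {t z : ℝ} (ht : 0 ≤ t)
    (hz : 0 ≤ z) :
    claspX σ ρ (Real.sin (clamp (Real.arcsin σ) t)) ^ 2 +
        (tipGap σ ρ - claspRise σ ρ (clamp (Real.arcsin σ) t) - z) ^ 2 ≤
      armX σ ρ t ^ 2 + (tipGap σ ρ - armZ σ ρ t - z) ^ 2 := by
  obtain ⟨-, h2, h3 | h3⟩ := clamp_cases (Real.arcsin_nonneg.2 h.nonneg) ht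
  · simp [armX, armZ, h3]
  · rw [armX, armZ, abs_of_nonneg h2]
    generalize t - clamp (Real.arcsin σ) t = δ at h2 ⊢
    rw [h3, Real.sin_arcsin (by linarith [h.nonneg]) h.le_one, claspX_self _ _ h.nonneg]
    have h4 := h.tipGap_sub
    have h5 : √(1 - σ ^ 2) ^ 2 = 1 - σ ^ 2 := Real.sq_sqrt (by
      have := pow_le_one₀ (n := 2) h.nonneg h.le_one
      linarith)
    generalize √(1 - σ ^ 2) = c at h4 h5 ⊢
    have h6 : tipGap σ ρ - (claspRise σ ρ (Real.arcsin σ) + σ * δ) - z = c - z - σ * δ := by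
      linarith
    rw [h4, h6]
    -- Since `σ² + c² = 1`, the two squared distances differ by exactly `δ² + 2 σ δ z`.
    have h7 : 0 ≤ σ * δ * z := mul_nonneg (mul_nonneg h.nonneg h2) hz
    nlinarith [sq_nonneg δ]

/-- Both points are pulled back onto the arcs, one after the other; each time the other point has
nonnegative height above its own tip. What remains is the estimate for arcs, or a single pair of
tips if `σ = ρ = 0`. -/
theorem IsClaspPair.one_le_sq_dist {σ ρ : ℝ} (h : IsClaspPair σ ρ) (t s : ℝ) :
    1 ≤ armX σ ρ t ^ 2 + armX ρ σ s ^ 2 + (tipGap σ ρ - armZ σ ρ t - armZ ρ σ s) ^ 2 := by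
  rw [← sq_armX_abs h.nonneg ρ t, ← sq_armX_abs h.symm.nonneg σ s, ← armZ_abs h.nonneg ρ t,
    ← armZ_abs h.symm.nonneg σ s]
  have ht := abs_nonneg t
  have hs := abs_nonneg s
  generalize |t| = t at *
  generalize |s| = s at *
  have h1 := h.sq_dist_straight ht (h.symm.armZ_nonneg s)
  obtain ⟨hc, -, -⟩ := clamp_cases (Real.arcsin_nonneg.2 h.nonneg) ht
  obtain ⟨hc', -, -⟩ := clamp_cases (Real.arcsin_nonneg.2 h.symm.nonneg) hs
  have h2 := h.symm.sq_dist_straight hs (h.claspRise_nonneg hc)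
  rw [h.tipGap_comm] at h2
  have h3 : 1 ≤ claspX σ ρ (Real.sin (clamp (Real.arcsin σ) t)) ^ 2 +
      claspX ρ σ (Real.sin (clamp (Real.arcsin ρ) s)) ^ 2 +
      (tipGap σ ρ - claspRise σ ρ (clamp (Real.arcsin σ) t) -
        claspRise ρ σ (clamp (Real.arcsin ρ) s)) ^ 2 := by
    rcases h.dichotomy with ⟨hσ, hρ⟩ | ⟨rfl, rfl⟩
    · exact one_le_sq_dist_arcs hσ h.le_one hρ h.mate_le_one hc hc'
    · have hz : ∀ t : ℝ, clamp (Real.arcsin 0) t = 0 := fun t => by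
        have := clamp_mem (r := Real.arcsin 0) (by simp) t
        simpa using this
      rw [hz, hz]
      simp [tipGap, claspRise_zero, claspX_zero]
  rw [sub_right_comm (tipGap σ ρ) (claspRise ρ σ _)] at h2
  rw [sub_right_comm (tipGap σ ρ) (armZ ρ σ s)] at h2
  linarith

theorem splitX_neg {g σ : ℝ} (hg : 0 ≤ g) (hσ : 0 ≤ σ) (ρ t : ℝ) :
    splitX g σ ρ (-t) = -splitX g σ ρ t := by
  rw [splitX, splitX, clamp_neg (by positivity), neg_sub_neg, ← neg_sub t, armX_neg hσ]
  ring

theorem splitZ_neg {g σ : ℝ} (hg : 0 ≤ g) (hσ : 0 ≤ σ) (ρ t : ℝ) :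
    splitZ g σ ρ (-t) = splitZ g σ ρ t := by
  rw [splitZ, splitZ, clamp_neg (by positivity), neg_sub_neg, ← neg_sub t, armZ_neg hσ]

/-- Seen from a point over an end of the inserted segment, the split curve is at least as far away
horizontally as the curve itself. -/
theorem sq_armX_le_sq_splitX_sub {g σ c : ℝ} (hσ : 0 ≤ σ) (ρ t : ℝ) (hc : |c| = g / 2) :
    armX σ ρ (t - clamp (g / 2) t) ^ 2 ≤ (splitX g σ ρ t - c) ^ 2 := by
  have hg : 0 ≤ g / 2 := hc ▸ abs_nonneg c
  have hc1 := abs_le.1 hc.le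
  have key : ∀ t c : ℝ, 0 ≤ t → |c| ≤ g / 2 →
      armX σ ρ (t - clamp (g / 2) t) ^ 2 ≤ (splitX g σ ρ t - c) ^ 2 := fun t c ht hc => by
    obtain ⟨h1, h2, h3⟩ := clamp_cases hg ht
    rw [splitX]
    rcases h3 with h3 | h3
    · rw [h3, armX_zero hσ, zero_pow two_ne_zero]
      positivity
    · rw [h3]
      rw [h3] at h2
      refine pow_le_pow_left₀ (armX_nonneg hσ ρ h2) ?_ 2
      linarith [(abs_le.1 hc).2]
  rcases le_total 0 t with ht | ht
  · exact key t c ht hc.le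
  · have := key (-t) (-c) (neg_nonneg.2 ht) (by rw [abs_neg, hc])
    rw [splitX_neg (by linarith) hσ, clamp_neg hg, neg_sub_neg, ← neg_sub t, armX_neg hσ] at this
    nlinarith

/-- The offsets `c` and `c'` locate the plane of each curve relative to the centre of the other: it
passes through an end of the segment inserted there. -/
theorem IsClaspPair.one_le_sq_dist_split {σ ρ g g' c c' : ℝ} (h : IsClaspPair σ ρ)
    (hc : |c| = g / 2) (hc' : |c'| = g' / 2) (t s : ℝ) :
    1 ≤ (splitX g σ ρ t - c) ^ 2 + (splitX g' ρ σ s - c') ^ 2 +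
      (tipGap σ ρ - splitZ g σ ρ t - splitZ g' ρ σ s) ^ 2 := by
  have h1 := h.one_le_sq_dist (t - clamp (g / 2) t) (s - clamp (g' / 2) s)
  have h2 := sq_armX_le_sq_splitX_sub h.nonneg ρ t hc
  have h3 := sq_armX_le_sq_splitX_sub h.symm.nonneg σ s hc'
  rw [splitZ, splitZ]
  linarith

theorem splitX_nonneg {g σ t : ℝ} (hg : 0 ≤ g) (hσ : 0 ≤ σ) (ρ : ℝ) (ht : 0 ≤ t) :
    0 ≤ splitX g σ ρ t := by
  obtain ⟨h1, h2, -⟩ := clamp_cases (show 0 ≤ g / 2 by positivity) ht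
  exact add_nonneg h1.1 (armX_nonneg hσ ρ h2)

theorem splitX_le_abs {g σ : ℝ} (hg : 0 ≤ g) (hσ : 0 ≤ σ) (ρ t : ℝ) :
    splitX g σ ρ t ≤ splitX g σ ρ |t| := by
  rcases le_total 0 t with h | h
  · rw [abs_of_nonneg h]
  · have := splitX_nonneg hg hσ ρ (neg_nonneg.2 h)
    rw [abs_of_nonpos h]
    rw [splitX_neg hg hσ] at this ⊢
    linarith

theorem splitZ_abs {g σ : ℝ} (hg : 0 ≤ g) (hσ : 0 ≤ σ) (ρ t : ℝ) :
    splitZ g σ ρ |t| = splitZ g σ ρ t := by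
  rcases abs_choice t with h | h
  · rw [h]
  · rw [h, splitZ_neg hg hσ]

theorem claspX_le {σ ρ u : ℝ} (hσ : 0 < σ) (hσ1 : σ ≤ 1) (hρ : 0 ≤ ρ) (hρ1 : ρ ≤ 1)
    (hu0 : 0 ≤ u) (hu : u ≤ σ) : claspX σ ρ u ≤ u := by
  have hu' : |u| ≤ σ := by rwa [abs_of_nonneg hu0]
  rw [claspX_eq]
  refine mul_le_of_le_one_right hu0 (Real.sqrt_le_one.2 ?_)
  rw [div_le_one (one_sub_sq_mul_mate_sq_pos hσ hσ1 hρ hρ1 hu')]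
  nlinarith [sq_nonneg (mate σ ρ u), pow_le_one₀ (n := 2) hu0 (hu.trans hσ1)]

/-- The outermost position of a split curve in the direction of its right end. -/
theorem IsClaspPair.splitX_add_splitZ_le {σ ρ g e : ℝ} (h : IsClaspPair σ ρ) (hg : 0 ≤ g)
    (he : 0 ≤ e) {t : ℝ} (ht : |t| ≤ g / 2 + Real.arcsin σ + e) :
    √(1 - σ ^ 2) * splitX g σ ρ t + σ * splitZ g σ ρ t ≤
      √(1 - σ ^ 2) * (g / 2 + σ) + σ * claspRise σ ρ (Real.arcsin σ) + e := by
  have hσ := h.nonneg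
  have hle := mul_le_mul_of_nonneg_left (splitX_le_abs hg hσ ρ t) (Real.sqrt_nonneg (1 - σ ^ 2))
  rw [← splitZ_abs hg hσ]
  refine (add_le_add_left hle _).trans ?_
  have h0 := abs_nonneg t
  generalize |t| = t at *
  have hθ := Real.arcsin_nonneg.2 hσ
  obtain ⟨a1, a2, a3⟩ := clamp_cases (show 0 ≤ g / 2 by positivity) h0
  obtain ⟨b1, b2, b3⟩ := clamp_cases hθ a2
  rw [splitX, splitZ, armX, armZ, abs_of_nonneg b2]
  set γ := clamp (g / 2) t
  set c := clamp (Real.arcsin σ) (t - γ)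
  have hX : claspX σ ρ (Real.sin c) ≤ σ ∧
      claspRise σ ρ c ≤ claspRise σ ρ (Real.arcsin σ) := by
    rcases h.dichotomy with ⟨hσ', hρ⟩ | ⟨rfl, rfl⟩
    · have hs := sin_mem_of_mem_arcsin hσ h.le_one (t := c) ⟨by linarith [b1.1], b1.2⟩
      have hs0 := Real.sin_nonneg_of_nonneg_of_le_pi b1.1
        (by linarith [b1.2, Real.arcsin_le_pi_div_two σ, Real.pi_pos])
      exact ⟨(claspX_le hσ' h.le_one hρ.le h.mate_le_one hs0 hs.2).trans hs.2,
        monotoneOn_claspRise hσ' h.le_one hρ.le h.mate_le_one b1 ⟨hθ, le_rfl⟩ b1.2⟩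
    · have hc : c = 0 := by
        rw [Real.arcsin_zero] at b1
        exact le_antisymm b1.2 b1.1
      simp [hc, claspX_zero]
  -- A positive excess `t - γ - c` means that the point is on the straight end, where the excess is
  -- arclength.
  have hδ : t - γ - c ≤ e := by
    rcases b3 with b3 | b3
    · linarith
    · rcases a3 with a3 | a3 <;> linarith
  have hsq : √(1 - σ ^ 2) * √(1 - σ ^ 2) = 1 - σ ^ 2 := Real.mul_self_sqrt (by
    have := pow_le_one₀ (n := 2) hσ h.le_one
    linarith)
  have h1 := mul_le_mul_of_nonneg_left (add_le_add a1.2 hX.1) (Real.sqrt_nonneg (1 - σ ^ 2))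
  have h2 := mul_le_mul_of_nonneg_left hX.2 hσ
  -- The straight end points in the direction measured here, so its arclength counts with factor `(1
  -- - σ²) + σ² = 1`.
  calc _ = √(1 - σ ^ 2) * (γ + claspX σ ρ (Real.sin c)) + σ * claspRise σ ρ c +
        (√(1 - σ ^ 2) * √(1 - σ ^ 2) + σ ^ 2) * (t - γ - c) := by ring
    _ ≤ _ := by
      rw [hsq]
      linarith

theorem IsClaspPair.splitX_end {σ ρ g e : ℝ} (h : IsClaspPair σ ρ) (hg : 0 ≤ g) (he : 0 ≤ e) :
    splitX g σ ρ (g / 2 + Real.arcsin σ + e) = g / 2 + σ + √(1 - σ ^ 2) * e ∧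
    splitZ g σ ρ (g / 2 + Real.arcsin σ + e) = claspRise σ ρ (Real.arcsin σ) + σ * e := by
  have h1 := Real.arcsin_nonneg.2 h.nonneg
  have h2 : clamp (g / 2) (g / 2 + Real.arcsin σ + e) = g / 2 :=
    clamp_of_le (by positivity) (by linarith)
  have h3 : g / 2 + Real.arcsin σ + e - g / 2 = Real.arcsin σ + e := by ring
  have h4 : clamp (Real.arcsin σ) (Real.arcsin σ + e) = Real.arcsin σ :=
    clamp_of_le h1 (by linarith)
  rw [splitX, splitZ, h2, h3, armX, armZ, h4, add_sub_cancel_left, abs_of_nonneg he,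
    Real.sin_arcsin (by linarith [h.nonneg]) h.le_one, claspX_self _ _ h.nonneg]
  exact ⟨by ring, rfl⟩

end

section

/-! ### Tangents of the split clasp curves -/

theorem IsClaspPair.continuous_armX {σ ρ : ℝ} (h : IsClaspPair σ ρ) : Continuous (armX σ ρ) := by
  have hc := continuous_clamp (Real.arcsin σ)
  refine Continuous.add ?_ (by fun_prop)
  rcases h.dichotomy with ⟨hσ, hρ⟩ | ⟨rfl, rfl⟩
  · have hX : ContinuousOn (claspX σ ρ) (Icc (-σ) σ) := fun u hu =>
      (hasDerivAt_claspX hσ h.le_one hρ.le h.mate_le_one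
        (abs_le.2 hu)).continuousAt.continuousWithinAt
    exact hX.comp_continuous (Real.continuous_sin.comp hc) fun t =>
      sin_mem_of_mem_arcsin hσ.le h.le_one (clamp_mem (Real.arcsin_nonneg.2 hσ.le) t)
  · have hz : ∀ t : ℝ, clamp (Real.arcsin 0) t = 0 := fun t => by
      have := clamp_mem (r := Real.arcsin 0) (by simp) t
      simpa using this
    simp only [hz]
    exact continuous_const

theorem IsClaspPair.continuous_armZ {σ ρ : ℝ} (h : IsClaspPair σ ρ) : Continuous (armZ σ ρ) := by
  have hc := continuous_clamp (Real.arcsin σ)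
  refine Continuous.add ?_ (by fun_prop)
  rcases h.dichotomy with ⟨hσ, hρ⟩ | ⟨rfl, rfl⟩
  · exact (continuousOn_claspRise hσ h.le_one hρ.le h.mate_le_one).comp_continuous hc fun t =>
      clamp_mem (Real.arcsin_nonneg.2 hσ.le) t
  · have hz : ∀ t : ℝ, clamp (Real.arcsin 0) t = 0 := fun t => by
      have := clamp_mem (r := Real.arcsin 0) (by simp) t
      simpa using this
    simp only [hz]
    exact continuous_const

theorem IsClaspPair.continuous_splitX {σ ρ : ℝ} (h : IsClaspPair σ ρ) (g : ℝ) :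
    Continuous (splitX g σ ρ) :=
  (continuous_clamp _).add (h.continuous_armX.comp (continuous_id.sub (continuous_clamp _)))

theorem IsClaspPair.continuous_splitZ {σ ρ : ℝ} (h : IsClaspPair σ ρ) (g : ℝ) :
    Continuous (splitZ g σ ρ) :=
  h.continuous_armZ.comp (continuous_id.sub (continuous_clamp _))

theorem IsClaspPair.exists_speed_bound {σ ρ : ℝ} (h : IsClaspPair σ ρ) :
    ∃ C, 1 ≤ C ∧ (0 < σ → ∀ u ∈ Icc (-σ) σ, claspSlope σ ρ u ≤ C) := by
  rcases h.dichotomy with ⟨hσ, hρ⟩ | ⟨rfl, rfl⟩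
  · obtain ⟨C, hC⟩ := isCompact_Icc.exists_bound_of_continuousOn
      (continuousOn_claspSlope hσ h.le_one hρ.le h.mate_le_one)
    exact ⟨max 1 C, le_max_left _ _, fun _ u hu =>
      (le_abs_self _).trans ((hC u hu).trans (le_max_right _ _))⟩
  · exact ⟨1, le_rfl, fun h => absurd h (lt_irrefl _)⟩

/-- On the arc the parameter is the tangent angle and `s` the slope; on the straight end `s = 1`.
Two parameters are left out: the tip, where the speed vanishes if `ρ = 1`, and the end of the arc,
where the formula changes. -/
theorem IsClaspPair.exists_hasDerivAt_arm {σ ρ : ℝ} (h : IsClaspPair σ ρ) :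
    ∃ C, 1 ≤ C ∧ ∀ t, 0 < t → t ≠ Real.arcsin σ → ∃ s, 0 < s ∧ s ≤ C ∧
      HasDerivAt (armX σ ρ) (s * Real.cos (clamp (Real.arcsin σ) t)) t ∧
      HasDerivAt (armZ σ ρ) (s * Real.sin (clamp (Real.arcsin σ) t)) t := by
  obtain ⟨C, hC1, hC⟩ := h.exists_speed_bound
  have hθ := Real.arcsin_nonneg.2 h.nonneg
  refine ⟨C, hC1, fun t ht0 htθ => ?_⟩
  rcases htθ.lt_or_gt with ht | ht
  · have hσ : 0 < σ := by
      rcases h.nonneg.eq_or_lt with rfl | h'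
      · simp at ht
        linarith
      · exact h'
    have hρ : 0 ≤ ρ := h.symm.nonneg
    have habs : |t| < Real.arcsin σ := by rwa [abs_of_pos ht0]
    have hmem : Real.sin t ∈ Icc (-σ) σ :=
      sin_mem_of_mem_arcsin hσ.le h.le_one (abs_le.1 habs.le)
    have hne : Real.sin t ≠ 0 := (Real.sin_pos_of_pos_of_lt_pi ht0
      (by linarith [Real.arcsin_le_pi_div_two σ, Real.pi_pos])).ne'
    have hnear : ∀ᶠ x in 𝓝 t, clamp (Real.arcsin σ) x = x := by
      filter_upwards [continuous_abs.continuousAt.eventually_lt_const habs] with x hx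
      exact clamp_of_abs_le hx.le
    refine ⟨claspSlope σ ρ (Real.sin t), claspSlope_pos hσ h.le_one hρ h.mate_le_one
      (abs_le.2 hmem) hne, hC hσ _ hmem, ?_, ?_⟩
    · rw [clamp_of_abs_le habs.le]
      have h1 : HasDerivAt (fun t => claspX σ ρ (Real.sin t)) _ t :=
        (hasDerivAt_claspX hσ h.le_one hρ h.mate_le_one (abs_le.2 hmem)).comp t
          (Real.hasDerivAt_sin t)
      refine h1.congr_of_eventuallyEq ?_
      filter_upwards [hnear] with x hx
      rw [armX, hx]
      ring
    · rw [clamp_of_abs_le habs.le]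
      refine (hasDerivAt_claspRise hσ h.le_one hρ h.mate_le_one habs).congr_of_eventuallyEq ?_
      filter_upwards [hnear] with x hx
      rw [armZ, hx]
      simp
  · have hnear : ∀ᶠ x in 𝓝 t, clamp (Real.arcsin σ) x = Real.arcsin σ ∧ Real.arcsin σ < x := by
      filter_upwards [lt_mem_nhds ht] with x hx
      exact ⟨clamp_of_le hθ hx.le, hx⟩
    have hid : HasDerivAt (fun x => x - Real.arcsin σ) 1 t :=
      (hasDerivAt_id t).sub_const _
    refine ⟨1, one_pos, hC1, ?_, ?_⟩
    · rw [clamp_of_le hθ ht.le, Real.cos_arcsin, one_mul]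
      have h1 := (hid.const_mul √(1 - σ ^ 2)).const_add (claspX σ ρ (Real.sin (Real.arcsin σ)))
      rw [mul_one] at h1
      refine h1.congr_of_eventuallyEq ?_
      filter_upwards [hnear] with x hx
      rw [armX, hx.1]
    · rw [clamp_of_le hθ ht.le, Real.sin_arcsin (by linarith [h.nonneg]) h.le_one, one_mul]
      have h1 := (hid.const_mul σ).const_add (claspRise σ ρ (Real.arcsin σ))
      rw [mul_one] at h1
      refine h1.congr_of_eventuallyEq ?_
      filter_upwards [hnear] with x hx
      rw [armZ, hx.1, abs_of_nonneg (by linarith [hx.2])]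

/-- The tangent angle of a split curve. -/
def splitAngle (g σ t : ℝ) : ℝ := clamp (Real.arcsin σ) (t - clamp (g / 2) t)

/-- The derivative of the tangent angle of a split curve. -/
def splitTurn (g σ t : ℝ) : ℝ :=
  if g / 2 < |t| ∧ |t| < g / 2 + Real.arcsin σ then 1 else 0

/-- The parameters at which a split curve passes between straight segments and arcs. -/
def splitCorners (g σ : ℝ) : Set ℝ := {t | |t| = g / 2 ∨ |t| = g / 2 + Real.arcsin σ}

theorem countable_splitCorners (g σ : ℝ) : (splitCorners g σ).Countable := by
  have h : splitCorners g σ ⊆ {g / 2, -(g / 2), g / 2 + Real.arcsin σ, -(g / 2 + Real.arcsin σ)} := by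
    intro t ht
    simp only [mem_insert_iff, mem_singleton_iff]
    rcases ht with ht | ht <;> rcases abs_choice t with h | h <;> rw [h] at ht
    · tauto
    · right; left; linarith
    · tauto
    · right; right; right; linarith
  exact (toFinite _).countable.mono h

theorem splitAngle_neg {g σ : ℝ} (hg : 0 ≤ g) (hσ : 0 ≤ σ) (t : ℝ) :
    splitAngle g σ (-t) = -splitAngle g σ t := by
  rw [splitAngle, splitAngle, clamp_neg (by positivity), neg_sub_neg, ← neg_sub t,
    clamp_neg (Real.arcsin_nonneg.2 hσ)]

theorem splitTurn_neg (g σ t : ℝ) : splitTurn g σ (-t) = splitTurn g σ t := by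
  rw [splitTurn, splitTurn, abs_neg]

theorem continuous_splitAngle (g σ : ℝ) : Continuous (splitAngle g σ) :=
  (continuous_clamp _).comp (continuous_id.sub (continuous_clamp _))

theorem measurable_splitTurn (g σ : ℝ) : Measurable (splitTurn g σ) := by
  refine Measurable.ite ?_ measurable_const measurable_const
  exact (measurableSet_lt measurable_const measurable_id.abs).inter
    (measurableSet_lt measurable_id.abs measurable_const)

theorem splitAngle_of_mem {g σ t : ℝ} (hg : 0 ≤ g)
    (ht : t ∈ Icc (g / 2) (g / 2 + Real.arcsin σ)) : splitAngle g σ t = t - g / 2 := by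
  rw [splitAngle, clamp_of_le (by positivity) ht.1,
    clamp_of_abs_le (abs_le.2 ⟨by linarith [ht.1, ht.2], by linarith [ht.2]⟩)]

theorem splitAngle_of_ge {g σ t : ℝ} (hg : 0 ≤ g) (hσ : 0 ≤ σ)
    (ht : g / 2 + Real.arcsin σ ≤ t) : splitAngle g σ t = Real.arcsin σ := by
  have := Real.arcsin_nonneg.2 hσ
  have h1 : clamp (g / 2) t = g / 2 := clamp_of_le (by positivity) (by linarith)
  rw [splitAngle, h1, clamp_of_le this (by linarith)]

theorem splitAngle_of_abs_le {g σ t : ℝ} (hσ : 0 ≤ σ) (ht : |t| ≤ g / 2) :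
    splitAngle g σ t = 0 := by
  rw [splitAngle, clamp_of_abs_le ht, sub_self, clamp_zero (Real.arcsin_nonneg.2 hσ)]

theorem hasDerivAt_splitAngle {g σ t : ℝ} (hg : 0 ≤ g) (hσ : 0 ≤ σ) (ht : t ∉ splitCorners g σ) :
    HasDerivAt (splitAngle g σ) (splitTurn g σ t) t := by
  have key : ∀ t, 0 ≤ t → t ∉ splitCorners g σ →
      HasDerivAt (splitAngle g σ) (splitTurn g σ t) t := fun t ht0 ht => by
    have hθ := Real.arcsin_nonneg.2 hσ
    obtain ⟨h1, h2⟩ := not_or.1 ht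
    have habs := abs_of_nonneg ht0
    rw [splitTurn]
    rcases lt_or_gt_of_ne h1 with h1 | h1
    · rw [if_neg fun h => by linarith [h.1]]
      refine (hasDerivAt_const t (0 : ℝ)).congr_of_eventuallyEq ?_
      filter_upwards [continuous_abs.continuousAt.eventually_lt_const h1] with x hx
      exact splitAngle_of_abs_le hσ hx.le
    · rcases lt_or_gt_of_ne h2 with h2 | h2
      · rw [if_pos ⟨h1, h2⟩]
        rw [habs] at h1 h2
        refine ((hasDerivAt_id t).sub_const (g / 2)).congr_of_eventuallyEq ?_
        filter_upwards [Ioo_mem_nhds h1 h2] with x hx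
        exact splitAngle_of_mem hg (Ioo_subset_Icc_self hx)
      · rw [if_neg fun h => by linarith [h.2]]
        rw [habs] at h2
        refine (hasDerivAt_const t (Real.arcsin σ)).congr_of_eventuallyEq ?_
        filter_upwards [lt_mem_nhds h2] with x hx
        exact splitAngle_of_ge hg hσ hx.le
  rcases le_total 0 t with h | h
  · exact key t h ht
  · have h1 := key (-t) (neg_nonneg.2 h) (by simpa [splitCorners] using ht)
    have h2 := (h1.scomp t (hasDerivAt_neg t)).neg
    rw [neg_smul, one_smul, neg_neg, splitTurn_neg] at h2
    refine h2.congr_of_eventuallyEq (Eventually.of_forall fun x => ?_)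
    simp [splitAngle_neg hg hσ]

/-- The left half follows from the right one by mirror symmetry. For `g = 0` the tip is itself a
corner, so its possibly zero speed does no harm. -/
theorem IsClaspPair.exists_hasDerivAt_split {σ ρ g : ℝ} (h : IsClaspPair σ ρ) (hg : 0 ≤ g) :
    ∃ C, ∀ t ∉ splitCorners g σ, ∃ s, 0 < s ∧ s ≤ C ∧
      HasDerivAt (splitX g σ ρ) (s * Real.cos (splitAngle g σ t)) t ∧
      HasDerivAt (splitZ g σ ρ) (s * Real.sin (splitAngle g σ t)) t := by
  obtain ⟨C, hC1, hC⟩ := h.exists_hasDerivAt_arm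
  have hσ := h.nonneg
  have key : ∀ t, 0 ≤ t → t ∉ splitCorners g σ → ∃ s, 0 < s ∧ s ≤ C ∧
      HasDerivAt (splitX g σ ρ) (s * Real.cos (splitAngle g σ t)) t ∧
      HasDerivAt (splitZ g σ ρ) (s * Real.sin (splitAngle g σ t)) t := fun t ht0 ht => by
    obtain ⟨h1, h2⟩ := not_or.1 ht
    rcases lt_or_gt_of_ne h1 with h1 | h1
    · rw [splitAngle_of_abs_le hσ h1.le, Real.cos_zero, Real.sin_zero]
      have hnear : ∀ᶠ x in 𝓝 t, clamp (g / 2) x = x := by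
        filter_upwards [continuous_abs.continuousAt.eventually_lt_const h1] with x hx
        exact clamp_of_abs_le hx.le
      refine ⟨1, one_pos, hC1, ?_, ?_⟩
      · rw [one_mul]
        refine ((hasDerivAt_id t).add_const (armX σ ρ 0)).congr_of_eventuallyEq ?_
        filter_upwards [hnear] with x hx
        rw [splitX, hx, sub_self, id]
      · rw [one_mul]
        refine (hasDerivAt_const t (armZ σ ρ 0)).congr_of_eventuallyEq ?_
        filter_upwards [hnear] with x hx
        rw [splitZ, hx, sub_self]
    · rw [abs_of_nonneg ht0] at h1 h2
      have hnear : ∀ᶠ x in 𝓝 t, clamp (g / 2) x = g / 2 := by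
        filter_upwards [lt_mem_nhds h1] with x hx
        exact clamp_of_le (by positivity) hx.le
      obtain ⟨s, hs0, hsC, hX, hZ⟩ := hC (t - g / 2) (by linarith) (fun h => h2 (by linarith))
      have hsub : HasDerivAt (fun x => x - g / 2) 1 t := (hasDerivAt_id t).sub_const _
      rw [splitAngle, hnear.self_of_nhds]
      refine ⟨s, hs0, hsC, ?_, ?_⟩
      · have := (HasDerivAt.comp (h₂ := armX σ ρ) t hX hsub).const_add (g / 2)
        rw [mul_one] at this
        refine this.congr_of_eventuallyEq ?_
        filter_upwards [hnear] with x hx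
        rw [splitX, hx, Function.comp]
      · have := HasDerivAt.comp (h₂ := armZ σ ρ) t hZ hsub
        rw [mul_one] at this
        refine this.congr_of_eventuallyEq ?_
        filter_upwards [hnear] with x hx
        rw [splitZ, hx, Function.comp]
  refine ⟨C, fun t ht => ?_⟩
  rcases le_total 0 t with h0 | h0
  · exact key t h0 ht
  · obtain ⟨s, hs0, hsC, hX, hZ⟩ := key (-t) (neg_nonneg.2 h0) (by simpa [splitCorners] using ht)
    rw [splitAngle_neg hg hσ, Real.cos_neg] at hX
    rw [splitAngle_neg hg hσ, Real.sin_neg] at hZ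
    refine ⟨s, hs0, hsC, ?_, ?_⟩
    · have h2 := (hX.scomp t (hasDerivAt_neg t)).neg
      rw [neg_smul, one_smul, neg_neg] at h2
      refine h2.congr_of_eventuallyEq (Eventually.of_forall fun x => ?_)
      simp [splitX_neg hg hσ]
    · have h2 := hZ.scomp t (hasDerivAt_neg t)
      rw [neg_smul, one_smul, mul_neg, neg_neg] at h2
      refine h2.congr_of_eventuallyEq (Eventually.of_forall fun x => ?_)
      simp [splitZ_neg hg hσ]

section Planar

variable {E : Type*} [NormedAddCommGroup E] [InnerProductSpace ℝ E]

theorem norm_cos_smul_add_sin_smul {p q : E} (hp : ‖p‖ = 1) (hq : ‖q‖ = 1) (hpq : ⟪p, q⟫ = 0)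
    (c s : ℝ) : ‖c • p + s • q‖ ^ 2 = c ^ 2 + s ^ 2 := by
  rw [norm_add_sq_real, inner_smul_left, inner_smul_right, hpq, norm_smul, norm_smul, hp, hq]
  simp

/-- The tangent of a split curve drawn in the plane of the orthonormal vectors `p` and `q`. -/
def splitTangent (g σ : ℝ) (p q : E) (t : ℝ) : E :=
  Real.cos (splitAngle g σ t) • p + Real.sin (splitAngle g σ t) • q

/-- The curvature vector of a split curve drawn in the plane of `p` and `q`. -/
def splitNormal (g σ : ℝ) (p q : E) (t : ℝ) : E :=
  splitTurn g σ t • (-Real.sin (splitAngle g σ t) • p + Real.cos (splitAngle g σ t) • q)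

/-- Parametrizing the arcs by tangent angle keeps the derivative of the tangent of norm at most one,
although the curvature with respect to arclength is unbounded at the tip when `ρ = 1`. -/
theorem IsClaspPair.isTurningCurve {σ ρ g : ℝ} (h : IsClaspPair σ ρ) (hg : 0 ≤ g) {p q : E}
    (hp : ‖p‖ = 1) (hq : ‖q‖ = 1) (hpq : ⟪p, q⟫ = 0) (c : E) :
    IsTurningCurve (fun t => c + (splitX g σ ρ t • p + splitZ g σ ρ t • q))
      (splitTangent g σ p q) (splitNormal g σ p q) (splitCorners g σ) where
  countable := countable_splitCorners g σ
  continuous := continuous_const.add (((h.continuous_splitX g).smul continuous_const).add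
    ((h.continuous_splitZ g).smul continuous_const))
  velocity := by
    obtain ⟨C, hC⟩ := h.exists_hasDerivAt_split hg
    refine ⟨C, fun t ht => ?_⟩
    obtain ⟨s, hs0, hsC, hX, hZ⟩ := hC t ht
    refine ⟨s, hs0, hsC, ?_⟩
    have := ((hX.smul_const p).add (hZ.smul_const q)).const_add c
    rw [splitTangent, smul_add, smul_smul, smul_smul]
    exact this
  norm_tangent t := by
    have := norm_cos_smul_add_sin_smul hp hq hpq (Real.cos (splitAngle g σ t))
      (Real.sin (splitAngle g σ t))
    rw [Real.cos_sq_add_sin_sq] at this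
    exact (pow_eq_one_iff_of_nonneg (norm_nonneg _) two_ne_zero).1 this
  continuous_tangent := by
    have := continuous_splitAngle g σ
    unfold splitTangent
    fun_prop
  hasDerivAt_tangent t ht := by
    have h1 := hasDerivAt_splitAngle hg h.nonneg ht
    refine ((h1.cos.smul_const p).add (h1.sin.smul_const q)).congr_deriv ?_
    rw [splitNormal, smul_add, smul_smul, smul_smul, mul_comm, mul_comm (Real.cos _)]
  measurable_normal := by
    have := (continuous_splitAngle g σ)
    refine (measurable_splitTurn g σ).stronglyMeasurable.smul (Continuous.stronglyMeasurable ?_)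
    fun_prop
  norm_normal_le t := by
    have h1 := norm_cos_smul_add_sin_smul hp hq hpq (-Real.sin (splitAngle g σ t))
      (Real.cos (splitAngle g σ t))
    rw [neg_sq, Real.sin_sq_add_cos_sq] at h1
    have h2 := (pow_eq_one_iff_of_nonneg (norm_nonneg _) two_ne_zero).1 h1
    rw [splitNormal, norm_smul, h2, mul_one, splitTurn]
    split_ifs <;> simp

end Planar

end

section

/-! ### The curvature force in terms of the struts -/

/-- The horizontal component of the force on a clasp curve exerted by the struts. -/
def sideForce (σ r : ℝ) : ℝ := σ * r * (σ / √(1 - (σ * r) ^ 2))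

theorem integral_symm_eq_integral_add {f : ℝ → ℝ} {e : ℝ} (hf : IntervalIntegrable f volume (-e) 0)
    (hf' : IntervalIntegrable f volume 0 e) :
    ∫ t in (-e)..e, f t = ∫ t in (0 : ℝ)..e, (f t + f (-t)) := by
  have h1 : ∫ t in (0 : ℝ)..e, f (-t) = ∫ t in (-e)..0, f t := by
    rw [intervalIntegral.integral_comp_neg, neg_zero]
  have h2 : IntervalIntegrable (fun t => f (-t)) volume 0 e := by
    have := hf.comp_mul_left (c := -1)
    simp only [neg_mul, one_mul] at this
    simpa using this.symm
  rw [intervalIntegral.integral_add hf' h2, h1, add_comm,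
    intervalIntegral.integral_add_adjacent_intervals hf hf']

variable {E : Type*} [NormedAddCommGroup E] [InnerProductSpace ℝ E]

theorem splitNormal_eq_zero {g σ t : ℝ} (p q : E)
    (ht : |t| ≤ g / 2 ∨ g / 2 + Real.arcsin σ ≤ |t|) : splitNormal g σ p q t = 0 := by
  rw [splitNormal, splitTurn, if_neg, zero_smul]
  rcases ht with ht | ht
  · exact fun h => by linarith [h.1]
  · exact fun h => by linarith [h.2]

theorem splitNormal_arc {g σ r : ℝ} (hg : 0 ≤ g) (hσ : 0 < σ) (hσ1 : σ ≤ 1)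
    (hr : r ∈ Ioo (0 : ℝ) 1) (p q : E) :
    splitNormal g σ p q (g / 2 + Real.arcsin (σ * r)) =
        -(σ * r) • p + √(1 - (σ * r) ^ 2) • q ∧
      splitNormal g σ p q (-(g / 2 + Real.arcsin (σ * r))) =
        (σ * r) • p + √(1 - (σ * r) ^ 2) • q := by
  have h0 : 0 < σ * r := mul_pos hσ hr.1
  have h1 : σ * r < σ := mul_lt_of_lt_one_right hσ hr.2
  have h2 : 0 < Real.arcsin (σ * r) := Real.arcsin_pos.2 h0
  have h3 : Real.arcsin (σ * r) < Real.arcsin σ :=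
    Real.strictMonoOn_arcsin ⟨by linarith, by linarith⟩ ⟨by linarith, hσ1⟩ h1
  have hturn : splitTurn g σ (g / 2 + Real.arcsin (σ * r)) = 1 := by
    rw [splitTurn, abs_of_nonneg (by positivity), if_pos ⟨by linarith, by linarith⟩]
  have hangle : splitAngle g σ (g / 2 + Real.arcsin (σ * r)) = Real.arcsin (σ * r) := by
    rw [splitAngle_of_mem hg ⟨by linarith, by linarith⟩, add_sub_cancel_left]
  have hsin : Real.sin (Real.arcsin (σ * r)) = σ * r :=
    Real.sin_arcsin (by linarith) (by linarith)
  constructor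
  · rw [splitNormal, hturn, hangle, hsin, Real.cos_arcsin, one_smul]
  · rw [splitNormal, splitTurn_neg, splitAngle_neg hg hσ.le, hturn, hangle, Real.sin_neg, hsin,
      Real.cos_neg, Real.cos_arcsin, one_smul, neg_neg]

variable [SecondCountableTopology E]

/-- Only the arcs contribute. Folding the two halves together and substituting `t = g / 2 + arcsin
(σ r)`, the Jacobian `σ / √(1 - u²)` cancels the cosine in the normal, which leaves the constant
vertical density `σ`. -/
theorem IsClaspPair.integral_inner_splitNormal {σ ρ g e : ℝ} (h : IsClaspPair σ ρ) (hσ : 0 < σ)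
    (hg : 0 ≤ g) (he : 0 ≤ e) {p q : E} (hp : ‖p‖ = 1) (hq : ‖q‖ = 1) (hpq : ⟪p, q⟫ = 0)
    {ξ : ℝ → E} (hξ : Continuous ξ) :
    IntegrableOn (fun r => σ * ⟪q, ξ (g / 2 + Real.arcsin (σ * r)) +
        ξ (-(g / 2 + Real.arcsin (σ * r)))⟫ - sideForce σ r *
        ⟪p, ξ (g / 2 + Real.arcsin (σ * r)) - ξ (-(g / 2 + Real.arcsin (σ * r)))⟫) (Ioo 0 1) ∧
    ∫ t in (-(g / 2 + Real.arcsin σ + e))..(g / 2 + Real.arcsin σ + e),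
      ⟪splitNormal g σ p q t, ξ t⟫ =
    ∫ r in Ioo (0 : ℝ) 1, (σ * ⟪q, ξ (g / 2 + Real.arcsin (σ * r)) +
        ξ (-(g / 2 + Real.arcsin (σ * r)))⟫ - sideForce σ r *
        ⟪p, ξ (g / 2 + Real.arcsin (σ * r)) - ξ (-(g / 2 + Real.arcsin (σ * r)))⟫) := by
  have hcurve := h.isTurningCurve hg hp hq hpq (0 : E)
  have hθ := Real.arcsin_nonneg.2 hσ.le
  have hint := hcurve.intervalIntegrable_inner_normal hξ
  set Ψ : ℝ → ℝ := fun t => ⟪splitNormal g σ p q t, ξ t⟫ + ⟪splitNormal g σ p q (-t), ξ (-t)⟫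
    with hΨ
  have hΨi : ∀ a b, IntervalIntegrable Ψ volume a b := fun a b => by
    refine (hint a b).add ?_
    have := (hint (-a) (-b)).comp_mul_left (c := -1)
    simp only [neg_mul, one_mul] at this
    simpa using this
  have hzero : ∀ a b : ℝ, 0 ≤ a → a ≤ b → (b ≤ g / 2 ∨ g / 2 + Real.arcsin σ ≤ a) →
      ∫ t in a..b, Ψ t = 0 := fun a b ha hab hcase => by
    rw [intervalIntegral.integral_congr (g := fun _ => (0 : ℝ)), intervalIntegral.integral_zero]
    intro t ht
    rw [uIcc_of_le hab] at ht
    have ht' : |t| ≤ g / 2 ∨ g / 2 + Real.arcsin σ ≤ |t| := by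
      rw [abs_of_nonneg (ha.trans ht.1)]
      exact hcase.imp (fun h => ht.2.trans h) fun h => h.trans ht.1
    simp only [hΨ]
    rw [splitNormal_eq_zero p q ht', splitNormal_eq_zero p q (by rwa [abs_neg]), inner_zero_left,
      inner_zero_left, add_zero]
  have hsplit : ∫ t in (-(g / 2 + Real.arcsin σ + e))..(g / 2 + Real.arcsin σ + e),
      ⟪splitNormal g σ p q t, ξ t⟫ = ∫ t in (g / 2)..(g / 2 + Real.arcsin σ), Ψ t := by
    rw [integral_symm_eq_integral_add (hint _ _) (hint _ _)]
    change ∫ t in (0 : ℝ)..(g / 2 + Real.arcsin σ + e), Ψ t = _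
    rw [← intervalIntegral.integral_add_adjacent_intervals (hΨi 0 (g / 2)) (hΨi _ _),
      ← intervalIntegral.integral_add_adjacent_intervals (hΨi (g / 2) (g / 2 + Real.arcsin σ))
        (hΨi _ _), hzero 0 (g / 2) le_rfl (by positivity) (Or.inl le_rfl),
      hzero (g / 2 + Real.arcsin σ) _ (by positivity) (by linarith) (Or.inr le_rfl), zero_add,
      add_zero]
  have hfc : ContinuousOn (fun r => g / 2 + Real.arcsin (σ * r)) (uIcc 0 1) :=
    (continuous_const.add (Real.continuous_arcsin.comp
      (continuous_const.mul continuous_id))).continuousOn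
  have hfd : ∀ r ∈ Ioo (min (0 : ℝ) 1) (max 0 1),
      HasDerivAt (fun r => g / 2 + Real.arcsin (σ * r)) (σ / √(1 - (σ * r) ^ 2)) r := fun r hr => by
    rw [min_eq_left zero_le_one, max_eq_right zero_le_one] at hr
    exact (hasDerivAt_arcsin_mul (mul_sq_lt_one hσ h.le_one hr)).const_add _
  have hf0 : ∀ r ∈ Ioo (min (0 : ℝ) 1) (max 0 1), 0 ≤ σ / √(1 - (σ * r) ^ 2) := fun r _ => by
    positivity
  -- The substitution rule for monotone functions is used because the Jacobian is unbounded at `r =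
  -- 1` when `σ = 1`.
  have hsubst := intervalIntegral.integral_comp_mul_deriv_of_deriv_nonneg (g := Ψ) hfc hfd hf0
  have hsubsti := (intervalIntegral.integrable_comp_mul_deriv_iff_of_deriv_nonneg (g := Ψ)
    hfc hfd hf0).2 (hΨi _ _)
  rw [mul_zero, Real.arcsin_zero, add_zero, mul_one] at hsubst
  rw [intervalIntegrable_iff_integrableOn_Ioo_of_le zero_le_one] at hsubsti
  have hpoint : ∀ r ∈ Ioo (0 : ℝ) 1, (Ψ ∘ fun r => g / 2 + Real.arcsin (σ * r)) r *
      (σ / √(1 - (σ * r) ^ 2)) = σ * ⟪q, ξ (g / 2 + Real.arcsin (σ * r)) +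
        ξ (-(g / 2 + Real.arcsin (σ * r)))⟫ - sideForce σ r *
        ⟪p, ξ (g / 2 + Real.arcsin (σ * r)) - ξ (-(g / 2 + Real.arcsin (σ * r)))⟫ := fun r hr => by
    obtain ⟨h1, h2⟩ := splitNormal_arc hg hσ h.le_one hr p q
    have h3 : 0 < √(1 - (σ * r) ^ 2) :=
      Real.sqrt_pos.2 (by linarith [mul_sq_lt_one hσ h.le_one hr])
    simp only [Function.comp, hΨ]
    rw [h1, h2, sideForce]
    simp only [inner_add_left, inner_smul_left, inner_add_right, inner_sub_right, neg_smul,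
      inner_neg_left, RCLike.conj_to_real]
    generalize √(1 - (σ * r) ^ 2) = c at h3 ⊢
    field_simp
    ring
  refine ⟨hsubsti.congr_fun hpoint measurableSet_Ioo, ?_⟩
  rw [hsplit, ← hsubst, intervalIntegral.integral_of_le zero_le_one, integral_Ioc_eq_integral_Ioo]
  exact setIntegral_congr_fun measurableSet_Ioo hpoint

theorem integrableOn_one_sub {f : ℝ → ℝ} (hf : IntegrableOn f (Ioo 0 1)) :
    IntegrableOn (fun r => f (1 - r)) (Ioo 0 1) := by
  rw [← intervalIntegrable_iff_integrableOn_Ioo_of_le zero_le_one] at hf ⊢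
  simpa using (hf.comp_sub_left 1).symm

theorem integral_one_sub (f : ℝ → ℝ) :
    ∫ r in Ioo (0 : ℝ) 1, f (1 - r) = ∫ r in Ioo (0 : ℝ) 1, f r := by
  rw [← integral_Ioc_eq_integral_Ioo, ← integral_Ioc_eq_integral_Ioo,
    ← intervalIntegral.integral_of_le zero_le_one, ← intervalIntegral.integral_of_le zero_le_one,
    intervalIntegral.integral_comp_sub_left, sub_self, sub_zero]

/-! ### The strut forces -/

/-- The density of the force on the struts between the two clasped curves. -/
def strutForce (σ ρ r : ℝ) : ℝ := σ / strutHeight (σ * r) (ρ * (1 - r))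

/-- Nonnegative derivatives of continuous functions on a compact interval are integrable; this
covers the singularity at `r = 1` for `σ = 1`. -/
theorem integrableOn_deriv_arcsin_mul {σ : ℝ} (hσ : 0 < σ) (hσ1 : σ ≤ 1) :
    IntegrableOn (fun r => σ / √(1 - (σ * r) ^ 2)) (Ioo 0 1) := by
  have := intervalIntegral.integrableOn_deriv_of_nonneg (a := 0) (b := 1)
    (g := fun r => Real.arcsin (σ * r)) (g' := fun r => σ / √(1 - (σ * r) ^ 2))
    (Real.continuous_arcsin.comp (continuous_const.mul continuous_id)).continuousOn
    (fun r hr => hasDerivAt_arcsin_mul (mul_sq_lt_one hσ hσ1 hr)) fun r _ => by positivity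
  exact this.mono_set Ioo_subset_Ioc_self

theorem sideForce_pos {σ r : ℝ} (hσ : 0 < σ) (hσ1 : σ ≤ 1) (hr : r ∈ Ioo (0 : ℝ) 1) :
    0 < sideForce σ r := by
  have h3 : 0 < √(1 - (σ * r) ^ 2) :=
    Real.sqrt_pos.2 (by linarith [mul_sq_lt_one hσ hσ1 hr])
  exact mul_pos (mul_pos hσ hr.1) (by positivity)

theorem integrableOn_sideForce {σ : ℝ} (hσ : 0 < σ) (hσ1 : σ ≤ 1) :
    IntegrableOn (sideForce σ) (Ioo 0 1) := by
  refine (integrableOn_deriv_arcsin_mul hσ hσ1).bdd_mul (c := 1)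
    (continuous_const.mul continuous_id).aestronglyMeasurable ?_
  filter_upwards [ae_restrict_mem measurableSet_Ioo] with r hr
  have := (mul_mem_unit hσ.le hσ1 (Ioo_subset_Icc_self hr)).1
  change |σ * r| ≤ 1
  rw [abs_of_nonneg this.1]
  exact this.2.trans hσ1

theorem strutHeight_pos {σ ρ r : ℝ} (hσ : 0 < σ) (hσ1 : σ ≤ 1) (hρ : 0 < ρ) (hρ1 : ρ ≤ 1)
    (hr : r ∈ Ioo (0 : ℝ) 1) : 0 < strutHeight (σ * r) (ρ * (1 - r)) := by
  have h1 := mul_sq_lt_one hσ hσ1 hr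
  have h2 := mul_sq_lt_one hρ hρ1 (r := 1 - r) ⟨by linarith [hr.2], by linarith [hr.1]⟩
  exact Real.sqrt_pos.2 (div_pos (mul_pos (by linarith) (by linarith))
    (one_sub_sq_mul_sq_pos hσ hσ1 hρ hρ1 (Ioo_subset_Icc_self hr)))

theorem strutForce_pos {σ ρ r : ℝ} (hσ : 0 < σ) (hσ1 : σ ≤ 1) (hρ : 0 < ρ) (hρ1 : ρ ≤ 1)
    (hr : r ∈ Ioo (0 : ℝ) 1) : 0 < strutForce σ ρ r :=
  div_pos hσ (strutHeight_pos hσ hσ1 hρ hρ1 hr)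

theorem strutForce_mul_strutHeight {σ ρ r : ℝ} (hσ : 0 < σ) (hσ1 : σ ≤ 1) (hρ : 0 < ρ)
    (hρ1 : ρ ≤ 1) (hr : r ∈ Ioo (0 : ℝ) 1) :
    strutForce σ ρ r * strutHeight (σ * r) (ρ * (1 - r)) = σ :=
  div_mul_cancel₀ _ (strutHeight_pos hσ hσ1 hρ hρ1 hr).ne'

/-- By orthogonality `X / H = u / √(1 - u²)`, so a vertical force `σ` brings along exactly the
horizontal curvature force. -/
theorem strutForce_mul_claspX {σ ρ r : ℝ} (hσ : 0 < σ) (hσ1 : σ ≤ 1) (hρ : 0 < ρ)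
    (hρ1 : ρ ≤ 1) (hr : r ∈ Ioo (0 : ℝ) 1) :
    strutForce σ ρ r * claspX σ ρ (σ * r) = sideForce σ r := by
  have h3 : 0 < √(1 - (σ * r) ^ 2) :=
    Real.sqrt_pos.2 (by linarith [mul_sq_lt_one hσ hσ1 hr])
  have h1 := claspX_mul_sqrt (ρ := ρ) hσ hσ1 (Ioo_subset_Icc_self hr)
  rw [← eq_div_iff h3.ne'] at h1
  have h2 := strutForce_mul_strutHeight hσ hσ1 hρ hρ1 hr
  calc _ = σ * r * (strutForce σ ρ r * strutHeight (σ * r) (ρ * (1 - r)) /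
        √(1 - (σ * r) ^ 2)) := by
        rw [h1]
        ring
    _ = _ := by rw [h2, sideForce]

/-- Seen from the other curve the same strut would carry `ρ / H` instead of `σ / H`; hence the
factor `σ / ρ`. -/
theorem strutForce_mul_claspX_mate {σ ρ r : ℝ} (hσ : 0 < σ) (hσ1 : σ ≤ 1) (hρ : 0 < ρ)
    (hρ1 : ρ ≤ 1) (hr : r ∈ Ioo (0 : ℝ) 1) :
    strutForce σ ρ r * claspX ρ σ (ρ * (1 - r)) = σ / ρ * sideForce ρ (1 - r) := by
  have hr' : 1 - r ∈ Ioo (0 : ℝ) 1 := ⟨by linarith [hr.2], by linarith [hr.1]⟩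
  have h1 := strutForce_mul_claspX hρ hρ1 hσ hσ1 hr'
  rw [← h1, strutForce, strutForce, sub_sub_cancel, strutHeight_comm]
  field_simp

/-- The force is at most `σ / (√(1 - u²) √(1 - w²))`. The roots can vanish only at opposite ends of
the interval, so their product is bounded below through their sum, and two arcsine derivatives
dominate. -/
theorem integrableOn_strutForce {σ ρ : ℝ} (hσ : 0 < σ) (hσ1 : σ ≤ 1) (hρ : 0 < ρ)
    (hρ1 : ρ ≤ 1) : IntegrableOn (strutForce σ ρ) (Ioo 0 1) := by
  have h1 := (integrableOn_deriv_arcsin_mul hσ hσ1).const_mul 2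
  have h2 := (integrableOn_one_sub (integrableOn_deriv_arcsin_mul hρ hρ1)).const_mul (2 * (σ / ρ))
  have hmeas : Measurable (strutForce σ ρ) := by
    unfold strutForce strutHeight
    fun_prop
  refine (h1.add h2).mono' hmeas.aestronglyMeasurable ?_
  filter_upwards [ae_restrict_mem measurableSet_Ioo] with r hr
  have hr' := Ioo_subset_Icc_self hr
  rw [Real.norm_eq_abs, abs_of_pos (strutForce_pos hσ hσ1 hρ hρ1 hr)]
  have hu := mul_sq_lt_one hσ hσ1 hr
  have hw := mul_sq_lt_one hρ hρ1 (r := 1 - r) ⟨by linarith [hr.2], by linarith [hr.1]⟩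
  have hur : σ * r ≤ r := mul_le_of_le_one_left hr.1.le hσ1
  have hwr : ρ * (1 - r) ≤ 1 - r := mul_le_of_le_one_left (by linarith [hr.2]) hρ1
  have hu0 : 0 ≤ σ * r := mul_nonneg hσ.le hr.1.le
  have hw0 : 0 ≤ ρ * (1 - r) := mul_nonneg hρ.le (by linarith [hr.2])
  have hB := one_sub_sq_mul_sq_pos hσ hσ1 hρ hρ1 hr'
  simp only [Pi.add_apply]
  rw [strutForce, strutHeight, Real.sqrt_div (mul_nonneg (by linarith) (by linarith)),
    Real.sqrt_mul (by linarith)]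
  generalize σ * r = u at *
  generalize ρ * (1 - r) = w at *
  have hA0 : 0 < √(1 - u ^ 2) := Real.sqrt_pos.2 (by linarith)
  have hC0 : 0 < √(1 - w ^ 2) := Real.sqrt_pos.2 (by linarith)
  -- As `u ≤ r` and `w ≤ 1 - r`, one of `u`, `w` is at most `1 / 2`.
  have hAC : 1 / 2 ≤ √(1 - u ^ 2) + √(1 - w ^ 2) := by
    rcases le_total r (1 / 2) with h | h
    · have : 1 / 2 ≤ √(1 - u ^ 2) := Real.le_sqrt_of_sq_le (by nlinarith)
      linarith
    · have : 1 / 2 ≤ √(1 - w ^ 2) := Real.le_sqrt_of_sq_le (by nlinarith)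
      linarith
  have hB1 : √(1 - u ^ 2 * w ^ 2) ≤ 1 :=
    Real.sqrt_le_one.2 (by nlinarith [mul_nonneg (sq_nonneg u) (sq_nonneg w)])
  have e1 : σ / (√(1 - u ^ 2) * √(1 - w ^ 2) / √(1 - u ^ 2 * w ^ 2)) =
      σ * √(1 - u ^ 2 * w ^ 2) / (√(1 - u ^ 2) * √(1 - w ^ 2)) := by
    rw [div_div_eq_mul_div]
  have e2 : 2 * (σ / √(1 - u ^ 2)) + 2 * (σ / ρ) * (ρ / √(1 - w ^ 2)) =
      σ * (2 * (√(1 - u ^ 2) + √(1 - w ^ 2))) / (√(1 - u ^ 2) * √(1 - w ^ 2)) := by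
    field_simp
    ring
  rw [e1, e2]
  refine div_le_div_of_nonneg_right (mul_le_mul_of_nonneg_left ?_ hσ.le) (by positivity)
  linarith

theorem splitX_arc {g σ r : ℝ} (hg : 0 ≤ g) (hσ : 0 ≤ σ) (hσ1 : σ ≤ 1) (ρ : ℝ)
    (hr : r ∈ Icc (0 : ℝ) 1) :
    splitX g σ ρ (g / 2 + Real.arcsin (σ * r)) = g / 2 + claspX σ ρ (σ * r) ∧
      splitZ g σ ρ (g / 2 + Real.arcsin (σ * r)) = claspRise σ ρ (Real.arcsin (σ * r)) := by
  obtain ⟨h1, h2⟩ := arcsin_mul_mem hσ hr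
  have h3 : clamp (g / 2) (g / 2 + Real.arcsin (σ * r)) = g / 2 :=
    clamp_of_le (by positivity) (by linarith)
  have h4 := (mul_mem_unit hσ hσ1 hr).1
  rw [splitX, splitZ, h3, add_sub_cancel_left, armX, armZ,
    clamp_of_abs_le (by rwa [abs_of_nonneg h1]),
    Real.sin_arcsin (by linarith [h4.1]) (by linarith [h4.2])]
  simp

end

section

/-! ### The configuration is a generalized link of thickness one -/

theorem inner_cons (v : E3) (x y z : ℝ) : ⟪!₂[x, y, z], v⟫ = x * v 0 + y * v 1 + z * v 2 := by
  rw [PiLp.inner_apply, Fin.sum_univ_three]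
  simp
  ring

theorem one_le_norm_of_sq {v : E3} (h : 1 ≤ v 0 ^ 2 + v 1 ^ 2 + v 2 ^ 2) : 1 ≤ ‖v‖ := by
  rw [EuclideanSpace.norm_eq, Fin.sum_univ_three]
  simpa using h

theorem abs_offset_two (i : Fin 2) : |offset 2 i| = 1 / 2 := by
  fin_cases i <;> norm_num [offset, abs_of_nonneg, abs_of_neg]

theorem one_le_sq_offset_sub {n : ℕ} {i j : Fin n} (hij : i ≠ j) :
    1 ≤ (offset n i - offset n j) ^ 2 := by
  have h1 : offset n i - offset n j = ((i.val : ℤ) - (j.val : ℤ) : ℤ) := by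
    simp only [offset]
    push_cast
    ring
  have h2 : (i.val : ℤ) - (j.val : ℤ) ≠ 0 := by
    rw [sub_ne_zero]
    exact fun h => hij (Fin.ext (by exact_mod_cast h))
  rw [h1, ← Int.cast_pow, ← Int.cast_one, Int.cast_le]
  exact Int.add_one_le_iff.2 (sq_pos_iff.2 h2)

/-- The cases of the theorem: all components are at their standard distances. -/
structure IsClaspCase (m : ℕ) (τ a b : ℝ) : Prop where
  one_le : 1 ≤ m
  abs_offset : ∀ i : Fin m, |offset m i| = ((m : ℝ) - 1) / 2
  pair : IsClaspPair (τ / 2) (τ / m)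
  pos_a : 0 < a
  pos_b : 0 < b

variable {m : ℕ} {τ a b : ℝ}

theorem IsClaspCase.gap_nonneg (h : IsClaspCase m τ a b) : 0 ≤ (m : ℝ) - 1 := by
  have : (1 : ℝ) ≤ m := by exact_mod_cast h.one_le
  linarith

theorem one_sub_sq_nonneg {σ ρ : ℝ} (h : IsClaspPair σ ρ) : 0 ≤ 1 - σ ^ 2 := by
  have := pow_le_one₀ (n := 2) h.nonneg h.le_one
  linarith

theorem inner_wallNormal (m : ℕ) (τ : ℝ) (v : E3) :
    ⟪wallNormal m τ 0, v⟫ = -√(1 - (τ / 2) ^ 2) * v 0 - τ / 2 * v 2 ∧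
    ⟪wallNormal m τ 1, v⟫ = √(1 - (τ / 2) ^ 2) * v 0 - τ / 2 * v 2 ∧
    ⟪wallNormal m τ 2, v⟫ = -√(1 - (τ / m) ^ 2) * v 1 + τ / m * v 2 ∧
    ⟪wallNormal m τ 3, v⟫ = √(1 - (τ / m) ^ 2) * v 1 + τ / m * v 2 := by
  simp only [wallNormal, inner_cons, Matrix.cons_val]
  refine ⟨?_, ?_, ?_, ?_⟩ <;> ring

theorem IsClaspCase.norm_wallNormal (h : IsClaspCase m τ a b) (j : Fin 4) :
    ‖wallNormal m τ j‖ = 1 := by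
  have h1 : ∀ {σ ρ : ℝ}, IsClaspPair σ ρ → √(1 - σ ^ 2) ^ 2 = 1 - σ ^ 2 := fun h =>
    Real.sq_sqrt (one_sub_sq_nonneg h)
  have h2 := h1 h.pair
  have h3 := h1 h.pair.symm
  have hv : ∀ v : E3, v 0 ^ 2 + v 1 ^ 2 + v 2 ^ 2 = 1 → ‖v‖ = 1 := fun v hv => by
    simp only [EuclideanSpace.norm_eq, Fin.sum_univ_three, Real.norm_eq_abs, sq_abs, hv,
      Real.sqrt_one]
  refine hv _ ?_
  rcases (by omega : j = 0 ∨ j = 1 ∨ j = 2 ∨ j = 3) with rfl | rfl | rfl | rfl <;>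
    simp only [wallNormal, Matrix.cons_val, neg_sq, h2, h3] <;> ring

theorem IsClaspCase.mem_wall (h : IsClaspCase m τ a b) (j : Fin 4) {p : E3}
    (hp : ⟪wallNormal m τ j, p⟫ = wallDist m τ a b j) : p ∈ wall m τ a b j := by
  rw [wall, AffineSubspace.mem_mk', Submodule.mem_orthogonal_singleton_iff_inner_right,
    vsub_eq_sub, inner_sub_right, inner_smul_right, real_inner_self_eq_norm_sq, hp,
    h.norm_wallNormal]
  ring

theorem mem_direction_wall {j : Fin 4} {v : E3} :
    v ∈ (wall m τ a b j).direction ↔ ⟪wallNormal m τ j, v⟫ = 0 := by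
  rw [wall, AffineSubspace.direction_mk', Submodule.mem_orthogonal_singleton_iff_inner_right]

/-- The tip gap less the rise of the arc is `√(1 - (τ / 2)²)`, so the contributions of the arc
cancel; the straight end is normal to the wall and contributes its length. -/
theorem IsClaspCase.wallDist_beta (h : IsClaspCase m τ a b) {j : Fin 4} (hj : j = 0 ∨ j = 1) :
    wallDist m τ a b j = √(1 - (τ / 2) ^ 2) * (((m : ℝ) - 1) / 2) + a := by
  obtain ⟨h1, h2⟩ := h.pair.splitX_end h.gap_nonneg h.pos_a.le
  have h3 := h.pair.tipGap_sub
  have h4 := Real.mul_self_sqrt (one_sub_sq_nonneg h.pair)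
  have key : ⟪wallNormal m τ 1, beta m τ 0 (betaEnd m τ a)⟫ =
      √(1 - (τ / 2) ^ 2) * (((m : ℝ) - 1) / 2) + a := by
    rw [beta, betaEnd, h1, h2, (inner_wallNormal m τ _).2.1]
    simp only [Matrix.cons_val]
    linear_combination a * h4 - τ / 2 * h3
  rcases hj with rfl | rfl <;> exact key

theorem IsClaspCase.wallDist_gamma (h : IsClaspCase m τ a b) {j : Fin 4} (hj : j = 2 ∨ j = 3) :
    wallDist m τ a b j = √(1 - (τ / m) ^ 2) * (1 / 2) + τ / m * tipGap (τ / 2) (τ / m) + b := by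
  obtain ⟨h1, h2⟩ := h.pair.symm.splitX_end zero_le_one h.pos_b.le
  have h3 : tipGap (τ / 2) (τ / m) =
    √(1 - (τ / m) ^ 2) + claspRise (τ / m) (τ / 2) (Real.arcsin (τ / m)) := rfl
  have h4 := Real.mul_self_sqrt (one_sub_sq_nonneg h.pair.symm)
  have key : ⟪wallNormal m τ 3, gamma m τ 0 (gammaEnd m τ b)⟫ =
      √(1 - (τ / m) ^ 2) * (1 / 2) + τ / m * tipGap (τ / 2) (τ / m) + b := by
    rw [gamma, gammaEnd, h1, h2, (inner_wallNormal m τ _).2.2.2]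
    simp only [Matrix.cons_val]
    linear_combination b * h4 - τ / m * h3
  rcases hj with rfl | rfl <;> exact key

/-- The walls bound the `β` curves. -/
theorem IsClaspCase.wall_beta (h : IsClaspCase m τ a b) (j : Fin 4) {y t : ℝ} (hy : |y| = 1 / 2)
    (ht : |t| ≤ betaEnd m τ a) : ⟪wallNormal m τ j, beta m τ y t⟫ ≤ wallDist m τ a b j := by
  have h1 := h.pair.splitX_add_splitZ_le h.gap_nonneg h.pos_a.le ht
  have h2 := h.pair.splitX_add_splitZ_le h.gap_nonneg h.pos_a.le (t := -t) (by rwa [abs_neg])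
  rw [splitX_neg h.gap_nonneg h.pair.nonneg, splitZ_neg h.gap_nonneg h.pair.nonneg] at h2
  have h3 := h.pair.tipGap_sub
  have h4 : 0 ≤ τ / m * splitZ ((m : ℝ) - 1) (τ / 2) (τ / m) t :=
    mul_nonneg h.pair.symm.nonneg (h.pair.armZ_nonneg _)
  have hy' := abs_le.1 hy.le
  have h5 := Real.sqrt_nonneg (1 - (τ / m) ^ 2)
  have h6 := h.pos_b
  have h7 := mul_le_mul_of_nonneg_left hy'.1 h5
  have h8 := mul_le_mul_of_nonneg_left hy'.2 h5
  obtain ⟨i0, i1, i2, i3⟩ := inner_wallNormal m τ (beta m τ y t)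
  rcases (by omega : j = 0 ∨ j = 1 ∨ j = 2 ∨ j = 3) with rfl | rfl | rfl | rfl
  · rw [h.wallDist_beta (Or.inl rfl), i0]
    simp only [beta, Matrix.cons_val]
    linarith [congrArg (τ / 2 * ·) h3]
  · rw [h.wallDist_beta (Or.inr rfl), i1]
    simp only [beta, Matrix.cons_val]
    linarith [congrArg (τ / 2 * ·) h3]
  -- For the walls of the `γ`s it suffices that a `β` lies at most at the height of its tip and that
  -- `|y| = 1 / 2`; the distance `b` is to spare.
  · rw [h.wallDist_gamma (Or.inl rfl), i2]
    simp only [beta, Matrix.cons_val]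
    linarith
  · rw [h.wallDist_gamma (Or.inr rfl), i3]
    simp only [beta, Matrix.cons_val]
    linarith

/-- The walls bound the `γ` curves. -/
theorem IsClaspCase.wall_gamma (h : IsClaspCase m τ a b) (j : Fin 4) {y t : ℝ}
    (hy : |y| = ((m : ℝ) - 1) / 2) (ht : |t| ≤ gammaEnd m τ b) :
    ⟪wallNormal m τ j, gamma m τ y t⟫ ≤ wallDist m τ a b j := by
  have h1 := h.pair.symm.splitX_add_splitZ_le zero_le_one h.pos_b.le ht
  have h2 := h.pair.symm.splitX_add_splitZ_le zero_le_one h.pos_b.le (t := -t) (by rwa [abs_neg])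
  rw [splitX_neg zero_le_one h.pair.symm.nonneg, splitZ_neg zero_le_one h.pair.symm.nonneg] at h2
  have h3 := h.pair.symm.tipGap_sub
  have h4 : 0 ≤ τ / 2 * splitZ 1 (τ / m) (τ / 2) t :=
    mul_nonneg h.pair.nonneg (h.pair.symm.armZ_nonneg _)
  have hy' := abs_le.1 hy.le
  have h5 := Real.sqrt_nonneg (1 - (τ / 2) ^ 2)
  have h6 := h.pos_a
  have h7 := mul_le_mul_of_nonneg_left hy'.1 h5
  have h8 := mul_le_mul_of_nonneg_left hy'.2 h5
  rw [h.pair.tipGap_comm] at h3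
  obtain ⟨i0, i1, i2, i3⟩ := inner_wallNormal m τ (gamma m τ y t)
  rcases (by omega : j = 0 ∨ j = 1 ∨ j = 2 ∨ j = 3) with rfl | rfl | rfl | rfl
  · rw [h.wallDist_beta (Or.inl rfl), i0]
    simp only [gamma, Matrix.cons_val]
    linarith
  · rw [h.wallDist_beta (Or.inr rfl), i1]
    simp only [gamma, Matrix.cons_val]
    linarith
  · rw [h.wallDist_gamma (Or.inl rfl), i2]
    simp only [gamma, Matrix.cons_val]
    linarith [congrArg (τ / m * ·) h3]
  · rw [h.wallDist_gamma (Or.inr rfl), i3]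
    simp only [gamma, Matrix.cons_val]
    linarith [congrArg (τ / m * ·) h3]

theorem IsClaspCase.betaEnd_pos (h : IsClaspCase m τ a b) : 0 < betaEnd m τ a := by
  have h1 := h.gap_nonneg
  have h2 := Real.arcsin_nonneg.2 h.pair.nonneg
  have h3 := h.pos_a
  rw [betaEnd]
  positivity

theorem IsClaspCase.gammaEnd_pos (h : IsClaspCase m τ a b) : 0 < gammaEnd m τ b := by
  have h2 := Real.arcsin_nonneg.2 h.pair.symm.nonneg
  have h3 := h.pos_b
  rw [gammaEnd]
  positivity

theorem IsClaspCase.inner_wallNormal_beta_end (h : IsClaspCase m τ a b) (y : ℝ) :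
    ⟪wallNormal m τ 1, beta m τ y (betaEnd m τ a)⟫ = wallDist m τ a b 1 ∧
      ⟪wallNormal m τ 0, beta m τ y (-betaEnd m τ a)⟫ = wallDist m τ a b 0 := by
  change _ = ⟪wallNormal m τ 1, beta m τ 0 (betaEnd m τ a)⟫ ∧
    _ = ⟪wallNormal m τ 1, beta m τ 0 (betaEnd m τ a)⟫
  simp [beta, wallNormal, inner_cons, splitX_neg h.gap_nonneg h.pair.nonneg,
    splitZ_neg h.gap_nonneg h.pair.nonneg]

theorem IsClaspCase.inner_wallNormal_gamma_end (h : IsClaspCase m τ a b) (y : ℝ) :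
    ⟪wallNormal m τ 3, gamma m τ y (gammaEnd m τ b)⟫ = wallDist m τ a b 3 ∧
      ⟪wallNormal m τ 2, gamma m τ y (-gammaEnd m τ b)⟫ = wallDist m τ a b 2 := by
  change _ = ⟪wallNormal m τ 3, gamma m τ 0 (gammaEnd m τ b)⟫ ∧
    _ = ⟪wallNormal m τ 3, gamma m τ 0 (gammaEnd m τ b)⟫
  simp [gamma, wallNormal, inner_cons, splitX_neg zero_le_one h.pair.symm.nonneg,
    splitZ_neg zero_le_one h.pair.symm.nonneg]

theorem IsClaspCase.one_le_dist_beta_gamma (h : IsClaspCase m τ a b) {y y' : ℝ} (hy : |y| = 1 / 2)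
    (hy' : |y'| = ((m : ℝ) - 1) / 2) (t s : ℝ) : 1 ≤ dist (beta m τ y t) (gamma m τ y' s) := by
  rw [dist_eq_norm]
  refine one_le_norm_of_sq ?_
  have := h.pair.one_le_sq_dist_split hy' hy t s
  simp [beta, gamma]
  nlinarith

theorem IsClaspCase.one_le_dist (h : IsClaspCase m τ a b) {x y : (claspProblem m τ a b).Point}
    (hxy : x.1 ≠ y.1) :
    1 ≤ dist (splitClasp m τ a b x.1 x.2) (splitClasp m τ a b y.1 y.2) := by
  obtain ⟨i, t⟩ := x
  obtain ⟨j, s⟩ := y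
  rcases i with i | i <;> rcases j with j | j
  · have hij : i ≠ j := fun e => hxy (by rw [e])
    rw [dist_eq_norm]
    refine one_le_norm_of_sq ?_
    have := one_le_sq_offset_sub hij
    simp only [splitClasp, beta, PiLp.sub_apply, Matrix.cons_val]
    nlinarith [sq_nonneg (splitX ((m : ℝ) - 1) (τ / 2) (τ / m) t -
      splitX ((m : ℝ) - 1) (τ / 2) (τ / m) s), sq_nonneg (tipGap (τ / 2) (τ / m) -
      splitZ ((m : ℝ) - 1) (τ / 2) (τ / m) t - (tipGap (τ / 2) (τ / m) -
      splitZ ((m : ℝ) - 1) (τ / 2) (τ / m) s))]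
  · exact h.one_le_dist_beta_gamma (abs_offset_two i) (h.abs_offset j) _ _
  · rw [dist_comm]
    exact h.one_le_dist_beta_gamma (abs_offset_two j) (h.abs_offset i) _ _
  · have hij : i ≠ j := fun e => hxy (by rw [e])
    rw [dist_eq_norm]
    refine one_le_norm_of_sq ?_
    have := one_le_sq_offset_sub hij
    simp only [splitClasp, gamma, PiLp.sub_apply, Matrix.cons_val]
    nlinarith [sq_nonneg (splitX 1 (τ / m) (τ / 2) t -
      splitX 1 (τ / m) (τ / 2) s), sq_nonneg (splitZ 1 (τ / m) (τ / 2) t -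
      splitZ 1 (τ / m) (τ / 2) s)]

theorem IsClaspCase.lo_lt_hi (h : IsClaspCase m τ a b) (i : Fin 2 ⊕ Fin m) :
    (claspProblem m τ a b).lo i < (claspProblem m τ a b).hi i := by
  rcases i with i | i
  · exact neg_lt_self h.betaEnd_pos
  · exact neg_lt_self h.gammaEnd_pos

/-- The curves of the configuration, parametrized by the whole real line. -/
def claspCurve (m : ℕ) (τ : ℝ) : Fin 2 ⊕ Fin m → ℝ → E3 :=
  Sum.elim (fun i t => beta m τ (offset 2 i) t) fun i t => gamma m τ (offset m i) t

theorem splitClasp_eq (i : Fin 2 ⊕ Fin m) (t : (claspProblem m τ a b).Dom i) :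
    splitClasp m τ a b i t = claspCurve m τ i t := by
  rcases i with i | i <;> rfl

theorem beta_eq (y t : ℝ) : beta m τ y t = !₂[0, y, tipGap (τ / 2) (τ / m)] +
    (splitX ((m : ℝ) - 1) (τ / 2) (τ / m) t • !₂[1, 0, 0] +
      splitZ ((m : ℝ) - 1) (τ / 2) (τ / m) t • !₂[0, 0, -1]) := by
  ext i
  fin_cases i <;> simp [beta]
  ring

theorem gamma_eq (y t : ℝ) : gamma m τ y t = !₂[y, 0, 0] +
    (splitX 1 (τ / m) (τ / 2) t • !₂[0, 1, 0] + splitZ 1 (τ / m) (τ / 2) t • !₂[0, 0, 1]) := by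
  ext i
  fin_cases i <;> simp [gamma]

/-- The first vector of the plane in which a component is drawn. -/
def claspSide : Fin 2 ⊕ Fin m → E3 := Sum.elim (fun _ => !₂[1, 0, 0]) fun _ => !₂[0, 1, 0]

/-- The second vector of the plane in which a component is drawn: the direction of its opening. -/
def claspUp : Fin 2 ⊕ Fin m → E3 := Sum.elim (fun _ => !₂[0, 0, -1]) fun _ => !₂[0, 0, 1]

/-- The length of the segment inserted in a component. -/
def claspGap (m : ℕ) : Fin 2 ⊕ Fin m → ℝ := Sum.elim (fun _ => (m : ℝ) - 1) fun _ => 1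

/-- The parameter of a component. -/
def claspOwn (m : ℕ) (τ : ℝ) : Fin 2 ⊕ Fin m → ℝ := Sum.elim (fun _ => τ / 2) fun _ => τ / m

theorem norm_unit_vectors : ‖(!₂[1, 0, 0] : E3)‖ = 1 ∧ ‖(!₂[0, 1, 0] : E3)‖ = 1 ∧
    ‖(!₂[0, 0, 1] : E3)‖ = 1 ∧ ‖(!₂[0, 0, -1] : E3)‖ = 1 := by
  simp [EuclideanSpace.norm_eq, Fin.sum_univ_three]

theorem IsClaspCase.isTurningCurve (h : IsClaspCase m τ a b) (i : Fin 2 ⊕ Fin m) :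
    IsTurningCurve (claspCurve m τ i)
      (splitTangent (claspGap m i) (claspOwn m τ i) (claspSide i) (claspUp i))
      (splitNormal (claspGap m i) (claspOwn m τ i) (claspSide i) (claspUp i))
      (splitCorners (claspGap m i) (claspOwn m τ i)) := by
  obtain ⟨h1, h2, h3, h4⟩ := norm_unit_vectors
  rcases i with i | i
  · have := h.pair.isTurningCurve h.gap_nonneg h1 h4 (by simp [inner_cons])
      !₂[0, offset 2 i, tipGap (τ / 2) (τ / m)]
    simp only [← beta_eq] at this
    exact this
  · have := h.pair.symm.isTurningCurve zero_le_one h2 h3 (by simp [inner_cons]) !₂[offset m i, 0, 0]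
    simp only [← gamma_eq] at this
    exact this

theorem IsClaspCase.continuous_splitClasp (h : IsClaspCase m τ a b) (i : Fin 2 ⊕ Fin m) :
    Continuous (splitClasp m τ a b i) := by
  have := (h.isTurningCurve i).continuous.comp
    (continuous_subtype_val (p := (· ∈ Icc ((claspProblem m τ a b).lo i) ((claspProblem m τ a b).hi i))))
  exact this.congr fun t => (splitClasp_eq i t).symm

theorem IsClaspCase.isGeneralizedLink (h : IsClaspCase m τ a b) :
    IsGeneralizedLink (claspProblem m τ a b) (splitClasp m τ a b) where
  lo_lt_hi := h.lo_lt_hi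
  continuous := h.continuous_splitClasp
  disjoint x y hxy heq := by
    have := h.one_le_dist hxy
    rw [heq, dist_self] at this
    linarith
  start_mem i t ht := by
    rw [splitClasp_eq, ht]
    rcases i with i | i
    · exact h.mem_wall 0 (h.inner_wallNormal_beta_end _).2
    · exact h.mem_wall 2 (h.inner_wallNormal_gamma_end _).2
  end_mem i t ht := by
    rw [splitClasp_eq, ht]
    rcases i with i | i
    · exact h.mem_wall 1 (h.inner_wallNormal_beta_end _).1
    · exact h.mem_wall 3 (h.inner_wallNormal_gamma_end _).1
  obstacle_contDiff j := contDiff_const.sub (contDiff_const.inner ℝ contDiff_id)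
  obstacle_regular j p _ hd := by
    have h1 : HasFDerivAt ((claspProblem m τ a b).obstacle j) (-innerSL ℝ (wallNormal m τ j)) p :=
      ((innerSL ℝ (wallNormal m τ j)).hasFDerivAt).const_sub _
    rw [h1.fderiv, neg_eq_zero] at hd
    have h2 : ⟪wallNormal m τ j, wallNormal m τ j⟫ = 0 := by
      rw [← innerSL_apply_apply ℝ, hd, _root_.zero_apply]
    rw [real_inner_self_eq_norm_sq, h.norm_wallNormal] at h2
    norm_num at h2
  avoids j x := by
    obtain ⟨i, t⟩ := x
    rw [splitClasp_eq]
    rcases i with i | i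
    · exact sub_nonneg.2 (h.wall_beta j (abs_offset_two i) (abs_le.2 t.2))
    · exact sub_nonneg.2 (h.wall_gamma j (h.abs_offset i) (abs_le.2 t.2))

theorem IsClaspCase.gThi_eq (h : IsClaspCase m τ a b) :
    gThi (claspProblem m τ a b) (splitClasp m τ a b) = 1 := by
  have hmem : (0 : ℝ) ∈ Icc (-betaEnd m τ a) (betaEnd m τ a) :=
    ⟨by linarith [h.betaEnd_pos], h.betaEnd_pos.le⟩
  -- The two `β`s are translates at distance one, so points with equal parameters attain the bound.
  let q : {q : (claspProblem m τ a b).Point × (claspProblem m τ a b).Point // q.1.1 ≠ q.2.1} :=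
    ⟨(⟨.inl 0, ⟨0, hmem⟩⟩, ⟨.inl 1, ⟨0, hmem⟩⟩), by simp⟩
  have : Nonempty {q : (claspProblem m τ a b).Point × (claspProblem m τ a b).Point //
    q.1.1 ≠ q.2.1} := ⟨q⟩
  refine le_antisymm ?_ (le_ciInf fun q => h.one_le_dist q.2)
  refine (ciInf_le ⟨0, by rintro _ ⟨_, rfl⟩; exact dist_nonneg⟩ q).trans_eq ?_
  simp [q, splitClasp, beta, dist_eq_norm, EuclideanSpace.norm_eq, Fin.sum_univ_three, offset]
  norm_num

end

section

/-! ### The first variation of length of the clasps -/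

variable {m : ℕ} {τ a b : ℝ}

theorem claspPair_own (h : IsClaspCase m τ a b) (c : Fin 2 ⊕ Fin m) :
    ∃ ρ, IsClaspPair (claspOwn m τ c) ρ := by
  rcases c with c | c
  exacts [⟨_, h.pair⟩, ⟨_, h.pair.symm⟩]

theorem IsClaspCase.claspGap_nonneg (h : IsClaspCase m τ a b) (c : Fin 2 ⊕ Fin m) :
    0 ≤ claspGap m c := by
  rcases c with c | c
  exacts [h.gap_nonneg, zero_le_one]

/-- The length of the straight ends of a component. -/
def claspTail (m : ℕ) (a b : ℝ) : Fin 2 ⊕ Fin m → ℝ := Sum.elim (fun _ => a) fun _ => b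

theorem claspProblem_hi (c : Fin 2 ⊕ Fin m) : (claspProblem m τ a b).hi c =
    claspGap m c / 2 + Real.arcsin (claspOwn m τ c) + claspTail m a b c := by
  rcases c with c | c <;> rfl

theorem claspProblem_lo (c : Fin 2 ⊕ Fin m) :
    (claspProblem m τ a b).lo c = -(claspProblem m τ a b).hi c := by
  rcases c with c | c <;> rfl

theorem IsClaspCase.claspTail_pos (h : IsClaspCase m τ a b) (c : Fin 2 ⊕ Fin m) :
    0 < claspTail m a b c := by
  rcases c with c | c
  exacts [h.pos_a, h.pos_b]

theorem IsClaspCase.splitTangent_end (h : IsClaspCase m τ a b) (c : Fin 2 ⊕ Fin m) :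
    splitTangent (claspGap m c) (claspOwn m τ c) (claspSide c) (claspUp c)
        ((claspProblem m τ a b).hi c) =
      √(1 - claspOwn m τ c ^ 2) • claspSide c + claspOwn m τ c • claspUp c ∧
    splitTangent (claspGap m c) (claspOwn m τ c) (claspSide c) (claspUp c)
        ((claspProblem m τ a b).lo c) =
      √(1 - claspOwn m τ c ^ 2) • claspSide c - claspOwn m τ c • claspUp c := by
  obtain ⟨ρ, hρ⟩ := claspPair_own h c
  have h1 := splitAngle_of_ge (h.claspGap_nonneg c) hρ.nonneg
    (t := (claspProblem m τ a b).hi c) (by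
      rw [claspProblem_hi]
      linarith [h.claspTail_pos c])
  have h2 := Real.sin_arcsin (by linarith [hρ.nonneg]) hρ.le_one
  rw [claspProblem_lo, splitTangent, splitTangent,
    splitAngle_neg (h.claspGap_nonneg c) hρ.nonneg, h1, Real.sin_neg, Real.cos_neg, h2,
    Real.cos_arcsin, neg_smul, ← sub_eq_add_neg]
  exact ⟨rfl, rfl⟩

/-- The end tangents are plus or minus the wall normals, so a field tangent to the walls does no
work against them. -/
theorem IsClaspCase.inner_splitTangent_end (h : IsClaspCase m τ a b)
    {ξ : (claspProblem m τ a b).Field} (hξ : IsCompatible _ ξ) (c : Fin 2 ⊕ Fin m)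
    (t : (claspProblem m τ a b).Dom c) :
    ((t : ℝ) = (claspProblem m τ a b).hi c →
      ⟪splitTangent (claspGap m c) (claspOwn m τ c) (claspSide c) (claspUp c)
        ((claspProblem m τ a b).hi c), ξ c t⟫ = 0) ∧
    ((t : ℝ) = (claspProblem m τ a b).lo c →
      ⟪splitTangent (claspGap m c) (claspOwn m τ c) (claspSide c) (claspUp c)
        ((claspProblem m τ a b).lo c), ξ c t⟫ = 0) := by
  obtain ⟨h1, h2⟩ := h.splitTangent_end c
  obtain ⟨i0, i1, i2, i3⟩ := inner_wallNormal m τ (ξ c t)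
  rw [h1, h2]
  refine ⟨fun ht => ?_, fun ht => ?_⟩
  · have := (hξ c t).2 ht
    rcases c with c | c
    · have := mem_direction_wall.1 this
      simp only [claspSide, claspUp, claspOwn, Sum.elim_inl, inner_add_left, real_inner_smul_left,
        inner_cons]
      linarith
    · have := mem_direction_wall.1 this
      simp only [claspSide, claspUp, claspOwn, Sum.elim_inr, inner_add_left, real_inner_smul_left,
        inner_cons]
      linarith
  · have := (hξ c t).1 ht
    rcases c with c | c
    · have := mem_direction_wall.1 this
      simp only [claspSide, claspUp, claspOwn, Sum.elim_inl, inner_sub_left, real_inner_smul_left,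
        inner_cons]
      linarith
    · have := mem_direction_wall.1 this
      simp only [claspSide, claspUp, claspOwn, Sum.elim_inr, inner_sub_left, real_inner_smul_left,
        inner_cons]
      linarith

theorem IsClaspCase.exists_isLengthVariation (h : IsClaspCase m τ a b) :
    ∃ D : (claspProblem m τ a b).Field →L[ℝ] ℝ, IsLengthVariation _ (splitClasp m τ a b) D ∧
      ∀ ξ, IsCompatible _ ξ → D ξ =
        -∑ c, ∫ t in (claspProblem m τ a b).lo c..(claspProblem m τ a b).hi c,
          ⟪splitNormal (claspGap m c) (claspOwn m τ c) (claspSide c) (claspUp c) t,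
            ξ c (projIcc _ _ (h.lo_lt_hi c).le t)⟫ := by
  obtain ⟨D, hD, hDξ⟩ := Gehring.exists_isLengthVariation (claspProblem m τ a b)
    (splitClasp m τ a b) _ _ _ _ h.isTurningCurve (fun i => (h.lo_lt_hi i).le) splitClasp_eq
  refine ⟨D, hD, fun ξ hξ => ?_⟩
  rw [hDξ, ← Finset.sum_neg_distrib]
  refine Finset.sum_congr rfl fun c _ => ?_
  rw [(h.inner_splitTangent_end hξ c _).1 rfl, (h.inner_splitTangent_end hξ c _).2 rfl]
  ring

/-- All components are straight, so the variation of length vanishes on compatible fields and no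
such field has variation `-1`; any `ε` serves. -/
theorem IsClaspCase.stronglyCritical_of_eq_zero (h : IsClaspCase m τ a b) (hτ : τ = 0) :
    StronglyCritical (claspProblem m τ a b) (splitClasp m τ a b) := by
  obtain ⟨D, hD, hDξ⟩ := h.exists_isLengthVariation
  refine ⟨D, hD, 1, one_pos, fun ξ hξ hneg => ?_⟩
  have hown : ∀ c, claspOwn m τ c = 0 := by
    rintro (c | c) <;> simp [claspOwn, hτ]
  have hν : ∀ c t, splitNormal (claspGap m c) (claspOwn m τ c) (claspSide c) (claspUp c) t = 0 :=
    fun c t => splitNormal_eq_zero _ _ (by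
      rw [hown, Real.arcsin_zero, add_zero]
      exact le_total _ _)
  rw [hDξ ξ hξ] at hneg
  simp [hν] at hneg

/-! ### The vertices of the polygons -/

/-- The parameter in `(0, 1)` at which a component takes part in the polygon number `r`. -/
def strutPhase : Fin 2 ⊕ Fin m → ℝ → ℝ := Sum.elim (fun _ r => r) fun _ r => 1 - r

/-- The parameter on the right half of a component of its vertex of the polygon number `r`. -/
def strutParam (m : ℕ) (τ : ℝ) (c : Fin 2 ⊕ Fin m) (r : ℝ) : ℝ :=
  claspGap m c / 2 + Real.arcsin (claspOwn m τ c * strutPhase c r)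

/-- The sign of a half of a curve. -/
def halfSign (s : Bool) : ℝ := if s then 1 else -1

/-- The vertex of the polygon number `r` on a half of a component. -/
def strutPoint (h : IsClaspCase m τ a b) (q : (Fin 2 ⊕ Fin m) × Bool) (r : ℝ) :
    (claspProblem m τ a b).Point :=
  ⟨q.1, projIcc _ _ (h.lo_lt_hi q.1).le (halfSign q.2 * strutParam m τ q.1 r)⟩

theorem strutPhase_mem (c : Fin 2 ⊕ Fin m) {r : ℝ} (hr : r ∈ Ioo (0 : ℝ) 1) :
    strutPhase c r ∈ Ioo (0 : ℝ) 1 := by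
  rcases c with c | c
  · exact hr
  · exact ⟨by simpa [strutPhase] using hr.2, by simpa [strutPhase] using hr.1⟩

theorem IsClaspCase.own_pos (h : IsClaspCase m τ a b) (hτ : 0 < τ) (c : Fin 2 ⊕ Fin m) :
    0 < claspOwn m τ c := by
  have : (0 : ℝ) < m := by exact_mod_cast h.one_le
  rcases c with c | c <;> simp only [claspOwn, Sum.elim_inl, Sum.elim_inr] <;> positivity

theorem IsClaspCase.strutParam_mem (h : IsClaspCase m τ a b) (hτ : 0 < τ) (c : Fin 2 ⊕ Fin m)
    {r : ℝ} (hr : r ∈ Ioo (0 : ℝ) 1) :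
    strutParam m τ c r ∈ Ioc 0 ((claspProblem m τ a b).hi c) := by
  obtain ⟨ρ, hρ⟩ := claspPair_own h c
  have hp := strutPhase_mem c hr
  have h1 := arcsin_mul_mem hρ.nonneg (Ioo_subset_Icc_self hp)
  have h2 := Real.arcsin_pos.2 (mul_pos (h.own_pos hτ c) hp.1)
  have h3 := h.claspTail_pos c
  have h4 := h.claspGap_nonneg c
  rw [claspProblem_hi, strutParam]
  exact ⟨by linarith, by linarith [h1.2]⟩

theorem coe_strutPoint (h : IsClaspCase m τ a b) (hτ : 0 < τ) (q : (Fin 2 ⊕ Fin m) × Bool)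
    {r : ℝ} (hr : r ∈ Ioo (0 : ℝ) 1) :
    ((strutPoint h q r).2 : ℝ) = halfSign q.2 * strutParam m τ q.1 r := by
  have h1 := h.strutParam_mem hτ q.1 hr
  rw [strutPoint, projIcc_of_mem]
  rw [claspProblem_lo]
  rcases q with ⟨c, _ | _⟩ <;> simp only [halfSign] <;> constructor <;>
    simp <;> linarith [h1.1, h1.2]

theorem continuous_strutPoint (h : IsClaspCase m τ a b) (q : (Fin 2 ⊕ Fin m) × Bool) :
    Continuous (strutPoint h q) := by
  have h1 : Continuous (strutPhase (m := m) q.1) := by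
    rcases q with ⟨c | c, s⟩
    · exact continuous_id
    · exact continuous_const.sub continuous_id
  have h2 : Continuous fun r => halfSign q.2 * strutParam m τ q.1 r :=
    continuous_const.mul (continuous_const.add
      (Real.continuous_arcsin.comp (continuous_const.mul h1)))
  exact continuous_sigmaMk.comp (continuous_projIcc.comp h2)

/-- On a given component the sign of the parameter tells the half and its size tells `r`. For `0 < r
< 1` it is never zero, so the halves stay apart even when nothing is inserted between them. -/
theorem strutPoint_inj (h : IsClaspCase m τ a b) (hτ : 0 < τ) {q q' : (Fin 2 ⊕ Fin m) × Bool}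
    {r r' : ℝ} (hr : r ∈ Ioo (0 : ℝ) 1) (hr' : r' ∈ Ioo (0 : ℝ) 1)
    (heq : strutPoint h q r = strutPoint h q' r') : q = q' ∧ r = r' := by
  have h1 := coe_strutPoint h hτ q hr
  have h2 := coe_strutPoint h hτ q' hr'
  have hc : q.1 = q'.1 := congrArg Sigma.fst heq
  rw [heq, h2] at h1
  obtain ⟨c, s⟩ := q
  obtain ⟨c', s'⟩ := q'
  obtain rfl : c = c' := hc
  have h3 := (h.strutParam_mem hτ c hr).1
  have h4 := (h.strutParam_mem hτ c hr').1
  have hs : s = s' ∧ strutParam m τ c r = strutParam m τ c r' := by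
    cases s <;> cases s' <;> simp [halfSign] at h1 ⊢ <;> linarith
  obtain ⟨ρ, hρ⟩ := claspPair_own h c
  have hσ := h.own_pos hτ c
  have hmem : ∀ x ∈ Ioo (0 : ℝ) 1, claspOwn m τ c * strutPhase c x ∈ Icc (-1 : ℝ) 1 := fun x hx => by
    have := (mul_mem_unit hρ.nonneg hρ.le_one (Ioo_subset_Icc_self (strutPhase_mem c hx))).1
    exact ⟨by linarith [this.1], this.2.trans hρ.le_one⟩
  have h5 := Real.injOn_arcsin (hmem r hr) (hmem r' hr') (add_left_cancel hs.2)
  have h6 := mul_left_cancel₀ hσ.ne' h5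
  refine ⟨by rw [hs.1], ?_⟩
  rcases c with c | c
  · exact h6
  · exact sub_right_injective h6

theorem splitX_sign {g σ : ℝ} (hg : 0 ≤ g) (hσ : 0 ≤ σ) (ρ t : ℝ) (s : Bool) :
    splitX g σ ρ (halfSign s * t) = halfSign s * splitX g σ ρ t ∧
      splitZ g σ ρ (halfSign s * t) = splitZ g σ ρ t := by
  cases s <;> simp [halfSign, splitX_neg hg hσ, splitZ_neg hg hσ]

theorem splitClasp_strutPoint_beta (h : IsClaspCase m τ a b) (hτ : 0 < τ) (i : Fin 2) (s : Bool)
    {r : ℝ} (hr : r ∈ Ioo (0 : ℝ) 1) :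
    splitClasp m τ a b (strutPoint h (.inl i, s) r).1 (strutPoint h (.inl i, s) r).2 =
      !₂[halfSign s * (((m : ℝ) - 1) / 2 + claspX (τ / 2) (τ / m) (τ / 2 * r)), offset 2 i,
        tipGap (τ / 2) (τ / m) - claspRise (τ / 2) (τ / m) (Real.arcsin (τ / 2 * r))] := by
  rw [splitClasp_eq, coe_strutPoint h hτ _ hr]
  obtain ⟨h1, h2⟩ := splitX_arc h.gap_nonneg h.pair.nonneg h.pair.le_one (τ / m)
    (Ioo_subset_Icc_self hr)
  obtain ⟨h3, h4⟩ := splitX_sign h.gap_nonneg h.pair.nonneg (τ / m)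
    (((m : ℝ) - 1) / 2 + Real.arcsin (τ / 2 * r)) s
  change beta m τ (offset 2 i) (halfSign s * (((m : ℝ) - 1) / 2 + Real.arcsin (τ / 2 * r))) = _
  rw [beta, h3, h4, h1, h2]

theorem splitClasp_strutPoint_gamma (h : IsClaspCase m τ a b) (hτ : 0 < τ) (i : Fin m) (s : Bool)
    {r : ℝ} (hr : r ∈ Ioo (0 : ℝ) 1) :
    splitClasp m τ a b (strutPoint h (.inr i, s) r).1 (strutPoint h (.inr i, s) r).2 =
      !₂[offset m i, halfSign s * (1 / 2 + claspX (τ / m) (τ / 2) (τ / m * (1 - r))),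
        claspRise (τ / m) (τ / 2) (Real.arcsin (τ / m * (1 - r)))] := by
  rw [splitClasp_eq, coe_strutPoint h hτ _ hr]
  obtain ⟨h1, h2⟩ := splitX_arc zero_le_one h.pair.symm.nonneg h.pair.symm.le_one (τ / 2)
    (one_sub_mem_unit (Ioo_subset_Icc_self hr))
  obtain ⟨h3, h4⟩ := splitX_sign zero_le_one h.pair.symm.nonneg (τ / 2)
    (1 / 2 + Real.arcsin (τ / m * (1 - r))) s
  change gamma m τ (offset m i) (halfSign s * (1 / 2 + Real.arcsin (τ / m * (1 - r)))) = _
  rw [gamma, h3, h4, h1, h2]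

/-! ### The struts -/

variable {ι κ : Type}

/-- The first variation of the length of the unit segment between two points of a link. -/
def edgeVariation (P : LinkProblem ι κ) (L : P.Arcs) (ξ : P.Field) (x y : P.Point) : ℝ :=
  ⟪ξ x.1 x.2 - ξ y.1 y.2, L x.1 x.2 - L y.1 y.2⟫

theorem edgeVariation_comm (P : LinkProblem ι κ) (L : P.Arcs) (ξ : P.Field) (x y : P.Point) :
    edgeVariation P L ξ x y = edgeVariation P L ξ y x := by
  rw [edgeVariation, edgeVariation, ← neg_sub, ← neg_sub (L y.1 y.2), inner_neg_neg]

theorem IsGStrut.symm {P : LinkProblem ι κ} {L : P.Arcs} {x y : P.Point} (h : IsGStrut P L x y) :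
    IsGStrut P L y x :=
  ⟨h.1.symm, by rw [dist_comm, h.2]⟩

theorem IsClaspCase.own_gamma_pos (h : IsClaspCase m τ a b) (hτ : 0 < τ) : 0 < τ / m :=
  div_pos hτ (by exact_mod_cast h.one_le)

/-- The halves of a `β` and of a `γ` which are joined by struts. -/
def AreClasped (m : ℕ) (i : Fin 2) (j : Fin m) (s s' : Bool) : Prop :=
  offset m j = halfSign s * (((m : ℝ) - 1) / 2) ∧ offset 2 i = halfSign s' * (1 / 2)

theorem strutPoint_beta_sub_gamma (h : IsClaspCase m τ a b) (hτ : 0 < τ) {i : Fin 2} {j : Fin m}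
    {s s' : Bool} (hij : AreClasped m i j s s') {r : ℝ} (hr : r ∈ Ioo (0 : ℝ) 1) :
    splitClasp m τ a b (strutPoint h (.inl i, s) r).1 (strutPoint h (.inl i, s) r).2 -
      splitClasp m τ a b (strutPoint h (.inr j, s') r).1 (strutPoint h (.inr j, s') r).2 =
    !₂[halfSign s * claspX (τ / 2) (τ / m) (τ / 2 * r),
      -(halfSign s' * claspX (τ / m) (τ / 2) (τ / m * (1 - r))),
      strutHeight (τ / 2 * r) (τ / m * (1 - r))] := by
  rw [splitClasp_strutPoint_beta h hτ i s hr, splitClasp_strutPoint_gamma h hτ j s' hr,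
    ← tipGap_sub_claspRise (half_pos hτ) h.pair.le_one (h.own_gamma_pos hτ) h.pair.mate_le_one
      (Ioo_subset_Icc_self hr), hij.1, hij.2]
  ext k
  fin_cases k <;> simp <;> ring

theorem isGStrut_beta_gamma (h : IsClaspCase m τ a b) (hτ : 0 < τ) {i : Fin 2} {j : Fin m}
    {s s' : Bool} (hij : AreClasped m i j s s') {r : ℝ} (hr : r ∈ Ioo (0 : ℝ) 1) :
    IsGStrut _ (splitClasp m τ a b) (strutPoint h (.inl i, s) r) (strutPoint h (.inr j, s') r) := by
  refine ⟨Sum.inl_ne_inr, ?_⟩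
  have hs : ∀ s, halfSign s ^ 2 = 1 := by rintro (_ | _) <;> simp [halfSign]
  rw [h.gThi_eq, dist_eq_norm, strutPoint_beta_sub_gamma h hτ hij hr, EuclideanSpace.norm_eq,
    Real.sqrt_eq_one, Fin.sum_univ_three]
  simp only [Matrix.cons_val, Real.norm_eq_abs, sq_abs, neg_sq, mul_pow, hs, one_mul]
  exact claspX_sq_add_claspX_sq (half_pos hτ) h.pair.le_one (h.own_gamma_pos hτ)
    h.pair.mate_le_one (Ioo_subset_Icc_self hr)

/-- In the three coordinate directions the strut supplies the horizontal curvature force of the `β`,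
a multiple of that of the `γ`, and the constant vertical force. -/
theorem strutForce_mul_edgeVariation (h : IsClaspCase m τ a b) (hτ : 0 < τ) {i : Fin 2} {j : Fin m}
    {s s' : Bool} (hij : AreClasped m i j s s') {r : ℝ} (hr : r ∈ Ioo (0 : ℝ) 1)
    (ξ : (claspProblem m τ a b).Field) :
    let v := ξ _ (strutPoint h (.inl i, s) r).2 - ξ _ (strutPoint h (.inr j, s') r).2
    strutForce (τ / 2) (τ / m) r * edgeVariation _ (splitClasp m τ a b) ξ
      (strutPoint h (.inl i, s) r) (strutPoint h (.inr j, s') r) =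
    halfSign s * sideForce (τ / 2) r * v 0 -
      halfSign s' * (τ / 2 / (τ / m) * sideForce (τ / m) (1 - r)) * v 1 + τ / 2 * v 2 := by
  intro v
  have hρ := h.own_gamma_pos hτ
  rw [edgeVariation, strutPoint_beta_sub_gamma h hτ hij hr, real_inner_comm, inner_cons,
    ← strutForce_mul_claspX (half_pos hτ) h.pair.le_one hρ h.pair.mate_le_one hr,
    ← strutForce_mul_claspX_mate (half_pos hτ) h.pair.le_one hρ h.pair.mate_le_one hr]
  change strutForce (τ / 2) (τ / m) r * (_ * v 0 + _ * v 1 + _ * v 2) = _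
  linear_combination (v 2) * strutForce_mul_strutHeight (half_pos hτ) h.pair.le_one hρ
    h.pair.mate_le_one hr

theorem strutPoint_beta_sub_beta (h : IsClaspCase m τ a b) (hτ : 0 < τ) (s : Bool) {r : ℝ}
    (hr : r ∈ Ioo (0 : ℝ) 1) :
    splitClasp m τ a b (strutPoint h (.inl 1, s) r).1 (strutPoint h (.inl 1, s) r).2 -
      splitClasp m τ a b (strutPoint h (.inl 0, s) r).1 (strutPoint h (.inl 0, s) r).2 =
    !₂[0, 1, 0] := by
  rw [splitClasp_strutPoint_beta h hτ 1 s hr, splitClasp_strutPoint_beta h hτ 0 s hr]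
  ext k
  fin_cases k <;> simp [offset]

theorem isGStrut_beta_beta (h : IsClaspCase m τ a b) (hτ : 0 < τ) (s : Bool) {r : ℝ}
    (hr : r ∈ Ioo (0 : ℝ) 1) :
    IsGStrut _ (splitClasp m τ a b) (strutPoint h (.inl 1, s) r) (strutPoint h (.inl 0, s) r) := by
  refine ⟨by simp [strutPoint], ?_⟩
  rw [h.gThi_eq, dist_eq_norm, strutPoint_beta_sub_beta h hτ s hr]
  exact norm_unit_vectors.2.1

theorem edgeVariation_beta_beta (h : IsClaspCase m τ a b) (hτ : 0 < τ) (s : Bool) {r : ℝ}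
    (hr : r ∈ Ioo (0 : ℝ) 1) (ξ : (claspProblem m τ a b).Field) :
    edgeVariation _ (splitClasp m τ a b) ξ (strutPoint h (.inl 1, s) r)
        (strutPoint h (.inl 0, s) r) =
      (ξ _ (strutPoint h (.inl 1, s) r).2 - ξ _ (strutPoint h (.inl 0, s) r).2) 1 := by
  rw [edgeVariation, strutPoint_beta_sub_beta h hτ s hr, real_inner_comm, inner_cons]
  ring_nf

theorem strutPoint_gamma_sub_gamma (h : IsClaspCase 2 τ a b) (hτ : 0 < τ) (s : Bool) {r : ℝ}
    (hr : r ∈ Ioo (0 : ℝ) 1) :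
    splitClasp 2 τ a b (strutPoint h (.inr 1, s) r).1 (strutPoint h (.inr 1, s) r).2 -
      splitClasp 2 τ a b (strutPoint h (.inr 0, s) r).1 (strutPoint h (.inr 0, s) r).2 =
    !₂[1, 0, 0] := by
  rw [splitClasp_strutPoint_gamma h hτ 1 s hr, splitClasp_strutPoint_gamma h hτ 0 s hr]
  ext k
  fin_cases k <;> simp [offset]

theorem isGStrut_gamma_gamma (h : IsClaspCase 2 τ a b) (hτ : 0 < τ) (s : Bool) {r : ℝ}
    (hr : r ∈ Ioo (0 : ℝ) 1) :
    IsGStrut _ (splitClasp 2 τ a b) (strutPoint h (.inr 1, s) r) (strutPoint h (.inr 0, s) r) := by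
  refine ⟨by simp [strutPoint], ?_⟩
  rw [h.gThi_eq, dist_eq_norm, strutPoint_gamma_sub_gamma h hτ s hr]
  exact norm_unit_vectors.1

theorem edgeVariation_gamma_gamma (h : IsClaspCase 2 τ a b) (hτ : 0 < τ) (s : Bool) {r : ℝ}
    (hr : r ∈ Ioo (0 : ℝ) 1) (ξ : (claspProblem 2 τ a b).Field) :
    edgeVariation _ (splitClasp 2 τ a b) ξ (strutPoint h (.inr 1, s) r)
        (strutPoint h (.inr 0, s) r) =
      (ξ _ (strutPoint h (.inr 1, s) r).2 - ξ _ (strutPoint h (.inr 0, s) r).2) 0 := by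
  rw [edgeVariation, strutPoint_gamma_sub_gamma h hτ s hr, real_inner_comm, inner_cons]
  ring_nf

end

section

/-! ### The balance of forces -/

variable {m : ℕ} {τ a b : ℝ}

/-- The work of the curvature force of a component at its two vertices of the polygon number `r`. -/
def curvatureWork (h : IsClaspCase m τ a b) (ξ : (claspProblem m τ a b).Field) (c : Fin 2 ⊕ Fin m)
    (r : ℝ) : ℝ :=
  claspOwn m τ c *
      ⟪claspUp c, ξ _ (strutPoint h (c, true) r).2 + ξ _ (strutPoint h (c, false) r).2⟫ -
    sideForce (claspOwn m τ c) (strutPhase c r) *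
      ⟪claspSide c, ξ _ (strutPoint h (c, true) r).2 - ξ _ (strutPoint h (c, false) r).2⟫

theorem integral_curvatureWork (h : IsClaspCase m τ a b) (hτ : 0 < τ)
    (ξ : (claspProblem m τ a b).Field) (c : Fin 2 ⊕ Fin m) :
    IntegrableOn (curvatureWork h ξ c) (Ioo 0 1) ∧
    ∫ t in (claspProblem m τ a b).lo c..(claspProblem m τ a b).hi c,
      ⟪splitNormal (claspGap m c) (claspOwn m τ c) (claspSide c) (claspUp c) t,
        ξ c (projIcc _ _ (h.lo_lt_hi c).le t)⟫ =
    ∫ r in Ioo (0 : ℝ) 1, curvatureWork h ξ c r := by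
  obtain ⟨h1, h2, h3, h4⟩ := norm_unit_vectors
  obtain ⟨ρ, hρ⟩ := claspPair_own h c
  have hp : ‖claspSide c‖ = 1 := by rcases c with c | c; exacts [h1, h2]
  have hq : ‖claspUp c‖ = 1 := by rcases c with c | c; exacts [h4, h3]
  have hpq : ⟪claspSide c, claspUp c⟫ = 0 := by
    rcases c with c | c <;> simp [claspSide, claspUp, inner_cons]
  have hξ : Continuous fun t => ξ c (projIcc _ _ (h.lo_lt_hi c).le t) :=
    (ξ c).continuous.comp continuous_projIcc
  have key := hρ.integral_inner_splitNormal (h.own_pos hτ c) (h.claspGap_nonneg c)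
    (h.claspTail_pos c).le hp hq hpq hξ
  rw [← claspProblem_hi, ← claspProblem_lo] at key
  set F : ℝ → ℝ := _ with hF
  change IntegrableOn F _ ∧ _ = ∫ r in _, F r at key
  have hsub : ∀ r, curvatureWork h ξ c r = F (strutPhase c r) := fun r => by
    simp only [curvatureWork, hF, strutPoint, halfSign, strutParam, if_true, one_mul, neg_one_mul,
      Bool.false_eq_true, if_false]
    rfl
  have hsub' : curvatureWork h ξ c = fun r => F (strutPhase c r) := funext hsub
  rw [hsub', key.2]
  -- On a `γ` the polygon number is reversed, which does not change the integral over `(0, 1)`.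
  rcases c with c | c
  · exact ⟨key.1, rfl⟩
  · exact ⟨integrableOn_one_sub key.1, (integral_one_sub F).symm⟩

theorem exists_isLengthVariation_curvatureWork (h : IsClaspCase m τ a b) (hτ : 0 < τ) :
    ∃ D : (claspProblem m τ a b).Field →L[ℝ] ℝ, IsLengthVariation _ (splitClasp m τ a b) D ∧
      ∀ ξ, IsCompatible _ ξ → D ξ = ∫ r in Ioo (0 : ℝ) 1, -∑ c, curvatureWork h ξ c r := by
  obtain ⟨D, hD, hDξ⟩ := h.exists_isLengthVariation
  refine ⟨D, hD, fun ξ hξ => ?_⟩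
  rw [hDξ ξ hξ, integral_neg, integral_finsetSum _ fun c _ => (integral_curvatureWork h hτ ξ c).1]
  exact congrArg _ (Finset.sum_congr rfl fun c _ => (integral_curvatureWork h hτ ξ c).2)

/-- Both sides are integrals over `r` of expressions in the values of `ξ` at the vertices of one
polygon, so it is enough to balance each polygon separately. -/
theorem balancedByPolygons_of_cycle (h : IsClaspCase m τ a b) (hτ : 0 < τ) {N : ℕ} [NeZero N]
    (q : Fin N → (Fin 2 ⊕ Fin m) × Bool) (hq : Function.Injective q) (w : Fin N → ℝ → ℝ)
    (hstrut : ∀ k, ∀ r ∈ Ioo (0 : ℝ) 1,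
      IsGStrut _ (splitClasp m τ a b) (strutPoint h (q k) r) (strutPoint h (q (k + 1)) r))
    (hw : ∀ k, (∀ r ∈ Ioo (0 : ℝ) 1, 0 < w k r) ∧ IntegrableOn (w k) (Ioo 0 1))
    (hbal : ∀ ξ, ∀ r ∈ Ioo (0 : ℝ) 1, -∑ c, curvatureWork h ξ c r =
      ∑ k, w k r * edgeVariation _ (splitClasp m τ a b) ξ (strutPoint h (q k) r)
        (strutPoint h (q (k + 1)) r)) :
    BalancedByPolygons (claspProblem m τ a b) (splitClasp m τ a b) N := by
  obtain ⟨D, hD, hDξ⟩ := exists_isLengthVariation_curvatureWork h hτ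
  refine ⟨D, hD, fun k => strutPoint h (q k), w, fun k => (continuous_strutPoint h _).continuousOn,
    ?_, hstrut, fun k => (hw k).1, fun k => (hw k).2, fun ξ hξ => ?_⟩
  · rintro ⟨k, r⟩ ⟨-, hr⟩ ⟨k', r'⟩ ⟨-, hr'⟩ heq
    obtain ⟨h1, h2⟩ := strutPoint_inj h hτ hr hr' heq
    exact Prod.ext (hq h1) h2
  · rw [hDξ ξ hξ]
    exact setIntegral_congr_fun measurableSet_Ioo (hbal ξ)

theorem isClaspCase_one (hτ : 0 ≤ τ) (hτ1 : τ ≤ 1) (ha : 0 < a) (hb : 0 < b) :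
    IsClaspCase 1 τ a b where
  one_le := le_rfl
  abs_offset i := by simp [offset]
  pair := by
    refine ⟨by positivity, by linarith, by simpa using hτ1, ?_⟩
    rcases hτ.eq_or_lt with rfl | hτ
    · exact Or.inr (by simp)
    · exact Or.inl ⟨by positivity, by positivity⟩
  pos_a := ha
  pos_b := hb

theorem isClaspCase_two (hτ : 0 ≤ τ) (hτ2 : τ ≤ 2) (ha : 0 < a) (hb : 0 < b) :
    IsClaspCase 2 τ a b where
  one_le := one_le_two
  abs_offset i := by
    rw [abs_offset_two]
    norm_num
  pair := by
    refine ⟨by positivity, by linarith, ?_, ?_⟩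
    · push_cast
      linarith
    rcases hτ.eq_or_lt with rfl | hτ
    · exact Or.inr (by simp)
    · exact Or.inl ⟨by positivity, by positivity⟩
  pos_a := ha
  pos_b := hb

/-- Each vertex on the `γ` meets two mirror-image clasp struts: their `x₁`-components cancel and the
others add up to its curvature force. The clasp struts push the two `β`s towards each other, and the
two `β`–`β` edges resist with the `x₂`-component of the clasp force. -/
theorem hexagons (h : IsClaspCase 1 τ a b) (hτ : 0 < τ) :
    BalancedByPolygons (claspProblem 1 τ a b) (splitClasp 1 τ a b) 6 := by
  have hσ := half_pos hτ
  have hρ := h.own_gamma_pos hτ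
  have hσ1 := h.pair.le_one
  have hρ1 := h.pair.mate_le_one
  have hf : (∀ r ∈ Ioo (0 : ℝ) 1, 0 < strutForce (τ / 2) (τ / (1 : ℕ)) r) ∧
      IntegrableOn (strutForce (τ / 2) (τ / (1 : ℕ))) (Ioo 0 1) :=
    ⟨fun r hr => strutForce_pos hσ hσ1 hρ hρ1 hr, integrableOn_strutForce hσ hσ1 hρ hρ1⟩
  have hg : (∀ r ∈ Ioo (0 : ℝ) 1, 0 < τ / 2 / (τ / (1 : ℕ)) * sideForce (τ / (1 : ℕ)) (1 - r)) ∧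
      IntegrableOn (fun r => τ / 2 / (τ / (1 : ℕ)) * sideForce (τ / (1 : ℕ)) (1 - r)) (Ioo 0 1) :=
    ⟨fun r hr => mul_pos (div_pos hσ hρ) (sideForce_pos hρ hρ1
      ⟨by linarith [hr.2], by linarith [hr.1]⟩),
      (integrableOn_one_sub (integrableOn_sideForce hρ hρ1)).const_mul _⟩
  have hc : ∀ s, AreClasped 1 1 0 s true ∧ AreClasped 1 0 0 s false := fun s => by
    norm_num [AreClasped, offset, halfSign]
  have hc1 := fun s => (hc s).1
  have hc0 := fun s => (hc s).2
  refine balancedByPolygons_of_cycle h hτ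
    ![(.inl 1, true), (.inr 0, true), (.inl 1, false), (.inl 0, false), (.inr 0, false),
      (.inl 0, true)] (by decide)
    ![strutForce (τ / 2) (τ / (1 : ℕ)), strutForce (τ / 2) (τ / (1 : ℕ)),
      fun r => τ / 2 / (τ / (1 : ℕ)) * sideForce (τ / (1 : ℕ)) (1 - r),
      strutForce (τ / 2) (τ / (1 : ℕ)), strutForce (τ / 2) (τ / (1 : ℕ)),
      fun r => τ / 2 / (τ / (1 : ℕ)) * sideForce (τ / (1 : ℕ)) (1 - r)] ?_ ?_ ?_
  · intro k r hr
    fin_cases k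
    · exact isGStrut_beta_gamma h hτ (hc1 _) hr
    · exact (isGStrut_beta_gamma h hτ (hc1 _) hr).symm
    · exact isGStrut_beta_beta h hτ _ hr
    · exact isGStrut_beta_gamma h hτ (hc0 _) hr
    · exact (isGStrut_beta_gamma h hτ (hc0 _) hr).symm
    · exact (isGStrut_beta_beta h hτ _ hr).symm
  · intro k
    fin_cases k
    exacts [hf, hf, hg, hf, hf, hg]
  · intro ξ r hr
    have e1 := fun s => strutForce_mul_edgeVariation h hτ (hc1 s) hr ξ
    have e0 := fun s => strutForce_mul_edgeVariation h hτ (hc0 s) hr ξ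
    have eb := fun s => edgeVariation_beta_beta h hτ s hr ξ
    simp only [Fin.sum_univ_six, Fin.isValue, Fin.reduceAdd, Matrix.cons_val]
    -- Edges which the cycle runs through backwards are turned to the orientation of the force
    -- formulas.
    rw [edgeVariation_comm _ _ ξ (strutPoint h (.inr 0, true) r),
      edgeVariation_comm _ _ ξ (strutPoint h (.inr 0, false) r),
      edgeVariation_comm _ _ ξ (strutPoint h (.inl 0, true) r) (strutPoint h (.inl 1, true) r), e1, e1, e0, e0, eb, eb]
    simp only [Fintype.sum_sum_type, Fin.sum_univ_two, Fin.sum_univ_one,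
      curvatureWork, claspUp, claspSide, claspOwn, strutPhase, Sum.elim_inl, Sum.elim_inr,
      inner_cons, PiLp.sub_apply, PiLp.add_apply, halfSign, if_true, Bool.false_eq_true, if_false]
    -- Each of the two clasp struts at a vertex of the `γ` carries half of its curvature force.
    have : τ / 2 / (τ / (1 : ℕ)) = 1 / 2 := by
      field_simp
      norm_num
    rw [this]
    push_cast
    ring

/-- Now every vertex has one clasp strut, which balances the curvature force in the plane of its
curve. The component across that plane is taken up by the strut to the parallel neighbour, with
weight `sideForce` of the curve at the other end of the clasp strut. -/
theorem octagons (h : IsClaspCase 2 τ a b) (hτ : 0 < τ) :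
    BalancedByPolygons (claspProblem 2 τ a b) (splitClasp 2 τ a b) 8 := by
  have hσ := half_pos hτ
  have hρ := h.own_gamma_pos hτ
  have hσ1 := h.pair.le_one
  have hρ1 := h.pair.mate_le_one
  have hf : (∀ r ∈ Ioo (0 : ℝ) 1, 0 < strutForce (τ / 2) (τ / (2 : ℕ)) r) ∧
      IntegrableOn (strutForce (τ / 2) (τ / (2 : ℕ))) (Ioo 0 1) :=
    ⟨fun r hr => strutForce_pos hσ hσ1 hρ hρ1 hr, integrableOn_strutForce hσ hσ1 hρ hρ1⟩
  have hg : (∀ r ∈ Ioo (0 : ℝ) 1, 0 < τ / 2 / (τ / (2 : ℕ)) * sideForce (τ / (2 : ℕ)) (1 - r)) ∧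
      IntegrableOn (fun r => τ / 2 / (τ / (2 : ℕ)) * sideForce (τ / (2 : ℕ)) (1 - r)) (Ioo 0 1) :=
    ⟨fun r hr => mul_pos (div_pos hσ hρ) (sideForce_pos hρ hρ1
      ⟨by linarith [hr.2], by linarith [hr.1]⟩),
      (integrableOn_one_sub (integrableOn_sideForce hρ hρ1)).const_mul _⟩
  have hg' : (∀ r ∈ Ioo (0 : ℝ) 1, 0 < sideForce (τ / 2) r) ∧
      IntegrableOn (sideForce (τ / 2)) (Ioo 0 1) :=
    ⟨fun r hr => sideForce_pos hσ hσ1 hr, integrableOn_sideForce hσ hσ1⟩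
  have hc : AreClasped 2 1 1 true true ∧ AreClasped 2 1 0 false true ∧
      AreClasped 2 0 0 false false ∧ AreClasped 2 0 1 true false := by
    norm_num [AreClasped, offset, halfSign]
  obtain ⟨hc1, hc2, hc3, hc4⟩ := hc
  refine balancedByPolygons_of_cycle h hτ
    ![(.inl 1, true), (.inr 1, true), (.inr 0, true), (.inl 1, false), (.inl 0, false),
      (.inr 0, false), (.inr 1, false), (.inl 0, true)] (by decide)
    ![strutForce (τ / 2) (τ / (2 : ℕ)), sideForce (τ / 2), strutForce (τ / 2) (τ / (2 : ℕ)),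
      fun r => τ / 2 / (τ / (2 : ℕ)) * sideForce (τ / (2 : ℕ)) (1 - r),
      strutForce (τ / 2) (τ / (2 : ℕ)), sideForce (τ / 2), strutForce (τ / 2) (τ / (2 : ℕ)),
      fun r => τ / 2 / (τ / (2 : ℕ)) * sideForce (τ / (2 : ℕ)) (1 - r)] ?_ ?_ ?_
  · intro k r hr
    fin_cases k
    · exact isGStrut_beta_gamma h hτ hc1 hr
    · exact isGStrut_gamma_gamma h hτ _ hr
    · exact (isGStrut_beta_gamma h hτ hc2 hr).symm
    · exact isGStrut_beta_beta h hτ _ hr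
    · exact isGStrut_beta_gamma h hτ hc3 hr
    · exact (isGStrut_gamma_gamma h hτ _ hr).symm
    · exact (isGStrut_beta_gamma h hτ hc4 hr).symm
    · exact (isGStrut_beta_beta h hτ _ hr).symm
  · intro k
    fin_cases k
    exacts [hf, hg', hf, hg, hf, hg', hf, hg]
  · intro ξ r hr
    have e1 := strutForce_mul_edgeVariation h hτ hc1 hr ξ
    have e2 := strutForce_mul_edgeVariation h hτ hc2 hr ξ
    have e3 := strutForce_mul_edgeVariation h hτ hc3 hr ξ
    have e4 := strutForce_mul_edgeVariation h hτ hc4 hr ξ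
    have eb := fun s => edgeVariation_beta_beta h hτ s hr ξ
    have eg := fun s => edgeVariation_gamma_gamma h hτ s hr ξ
    simp only [Fin.sum_univ_eight, Fin.isValue, Fin.reduceAdd, Matrix.cons_val]
    rw [edgeVariation_comm _ _ ξ (strutPoint h (.inr 0, true) r),
      edgeVariation_comm _ _ ξ (strutPoint h (.inr 0, false) r),
      edgeVariation_comm _ _ ξ (strutPoint h (.inr 1, false) r) (strutPoint h (.inl 0, true) r),
      edgeVariation_comm _ _ ξ (strutPoint h (.inl 0, true) r) (strutPoint h (.inl 1, true) r),
      e1, e2, e3, e4, eb, eb, eg, eg]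
    simp only [Fintype.sum_sum_type, Fin.sum_univ_two,
      curvatureWork, claspUp, claspSide, claspOwn, strutPhase, Sum.elim_inl, Sum.elim_inr,
      inner_cons, PiLp.sub_apply, PiLp.add_apply, halfSign, if_true, Bool.false_eq_true, if_false]
    have : τ / 2 / (τ / (2 : ℕ)) = 1 := by
      push_cast
      field_simp
    rw [this]
    push_cast
    ring

theorem IsClaspCase.stronglyCritical (h : IsClaspCase m τ a b) (hτ : 0 ≤ τ) {N : ℕ} [NeZero N]
    (hbal : 0 < τ → BalancedByPolygons (claspProblem m τ a b) (splitClasp m τ a b) N) :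
    StronglyCritical (claspProblem m τ a b) (splitClasp m τ a b) := by
  rcases hτ.eq_or_lt with h0 | hτ
  · exact h.stronglyCritical_of_eq_zero h0.symm
  · have : Nonempty (claspProblem m τ a b).Point :=
      ⟨⟨.inl 0, ⟨_, left_mem_Icc.2 (h.lo_lt_hi (.inl 0)).le⟩⟩⟩
    exact (hbal hτ).stronglyCritical h.continuous_splitClasp h.gThi_eq (wallDist m τ a b)
      (wallNormal m τ) fun _ _ => rfl

theorem IsClaspCase.conclusion (h : IsClaspCase m τ a b) (hτ : 0 ≤ τ) {N : ℕ} [NeZero N]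
    (hbal : 0 < τ → BalancedByPolygons (claspProblem m τ a b) (splitClasp m τ a b) N) :
    IsGeneralizedLink (claspProblem m τ a b) (splitClasp m τ a b) ∧
      gThi (claspProblem m τ a b) (splitClasp m τ a b) = 1 ∧
      StronglyCritical (claspProblem m τ a b) (splitClasp m τ a b) ∧
      (0 < τ → BalancedByPolygons (claspProblem m τ a b) (splitClasp m τ a b) N) :=
  ⟨h.isGeneralizedLink, h.gThi_eq, h.stronglyCritical hτ hbal, hbal⟩

end

end Gehring

end

theorem theorem5p1 (τ a b : ℝ) (hτ : 0 ≤ τ) (ha : 0 < a) (hb : 0 < b) :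
    (τ ≤ 1 →
      Gehring.IsGeneralizedLink (Gehring.claspProblem 1 τ a b) (Gehring.splitClasp 1 τ a b) ∧
      Gehring.gThi (Gehring.claspProblem 1 τ a b) (Gehring.splitClasp 1 τ a b) = 1 ∧
      Gehring.StronglyCritical (Gehring.claspProblem 1 τ a b) (Gehring.splitClasp 1 τ a b) ∧
      (0 < τ → Gehring.BalancedByPolygons
        (Gehring.claspProblem 1 τ a b) (Gehring.splitClasp 1 τ a b) 6)) ∧
    (τ ≤ 2 →
      Gehring.IsGeneralizedLink (Gehring.claspProblem 2 τ a b) (Gehring.splitClasp 2 τ a b) ∧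
      Gehring.gThi (Gehring.claspProblem 2 τ a b) (Gehring.splitClasp 2 τ a b) = 1 ∧
      Gehring.StronglyCritical (Gehring.claspProblem 2 τ a b) (Gehring.splitClasp 2 τ a b) ∧
      (0 < τ → Gehring.BalancedByPolygons
        (Gehring.claspProblem 2 τ a b) (Gehring.splitClasp 2 τ a b) 8)) := by
  refine ⟨fun h => ?_, fun h => ?_⟩
  · have hc := Gehring.isClaspCase_one hτ h ha hb
    exact hc.conclusion hτ (Gehring.hexagons hc)
  · have hc := Gehring.isClaspCase_two hτ h ha hb
    exact hc.conclusion hτ (Gehring.octagons hc)
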